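/- **Setting.** Let $s_i=(i\ i{+}1)$. A word $w=w_1\cdots w_m$ in positive integers is a *reduced word* of the permutation $\sigma=s_{w_1}\cdots s_{w_m}$ if $m$ is minimal among all such words for $\sigma$ (products are composed so that right multiplication by $s_i$ exchanges the entries in positions $i,i+1$ of the one-line notation $\sigma_1\sigma_2\cdots$). We say that $w_l$ *exchanges* the values $a,b$ if these are the values of $s_{w_1}\cdots s_{w_{l-1}}$ at $w_l$ and $w_l+1$. An *inversion* of $\sigma$ is a pair $(i,j)$ with $i<j$, $\sigma_i>\sigma_j$; a *descent* is an inversion $(i,i+1)$; $\sigma$ is *Grassmannian* if it has exactly one descent, and then any reduced word of it is called Grassmannian. **Edelman–Greene recording tableau $Q(w)$.** To insert $n$ into a tableau with rows $R_1,R_2,\dots$: if no entry of $R_1$ exceeds $n$ (in particular if $R_1$ is empty), append $n$ to $R_1$. Otherwise let $r_j$ be the first entry of $R_1$ exceeding $n$; if $r_j=n+1$ and $r_{j-1}=n$, leave $R_1$ unchanged and insert $n+1$ into $R_2,R_3,\dots$; else replace $r_j$ by $n$ and insert $r_j$ into $R_2,R_3,\dots$. Insert $w_m,w_{m-1},\dots,w_1$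 in this order into the empty tableau; $Q(w)$ has the entry $t$ in the box added at the $t$-th step. **Little map $\mathrm{LS}(w)$.** For a position $i$ of a word $w$, *decrementing at $i$* replaces $w_i$ by $w_i-1$ if $w_i>1$, and adds $1$ to all letters other than $w_i$ if $w_i=1$. The *Little bump* $w{\uparrow_i}$ is obtained by decrementing at $i$; if the resulting word is reduced, stop; otherwise there is another position $j\neq i$ whose letter exchanges the same two values as the letter at $i$, and one continues by decrementing at $j$, and so on until the word is reduced. For a Grassmannian word $w$ of $\sigma=a_1\cdots a_kb_1b_2\cdots$, with descent at $k$, $\mathrm{Tab}(w)$ has rows indexed by $a_k,\dots,a_1$ and columns by $b_1,b_2,\dots$, and has the entry $m+1-l$ in row $a_i$ and column $b_j$ if $w_l$ exchanges $a_i$ and $b_j$ (and no box there if no letter does). The Little map is defined by $\mathrm{LS}(w)=\mathrm{Tab}(w)$ if $w$ is Grassmannian, and otherwise $\mathrm{LS}(w)=\mathrm{LS}(w{\uparrow_i})$, where $w_i$ is the letter exchanging $\sigma_r$ and $\sigma_s$ for the lexicographically last inversion $(r,s)$ of $\sigma$. (The empty word is assigned the empty tableau.) **Theorem.** For every reduced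 word $w$ of every permutation, the computation of $\mathrm{LS}(w)$ is well defined and terminates, and $$Q(w)=\mathrm{LS}(w).$$ -/

import Mathlib

namespace LittleEG

/-! Permutations in `S_n`, for any `n`, are viewed as permutations of `ℕ` that fix `0` and every
number above `n`.  Words are lists of natural numbers; positions in a word are counted from `0`. -/

/-- The simple transposition `s_i = (i  i+1)`. -/
def simpleSwap (i : ℕ) : Equiv.Perm ℕ := Equiv.swap i (i + 1)

/-- The permutation `s_{w_1} s_{w_2} ⋯ s_{w_m}` of the word `w = w_1 w_2 ⋯ w_m`.  In one-line
notation, multiplying by `s_i` on the right exchanges the values in the positions `i`, `i + 1`. -/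
def wordPerm (w : List ℕ) : Equiv.Perm ℕ := (w.map simpleSwap).prod

/-- `w` is a reduced word (of the permutation `wordPerm w`): its letters are positive, and it has
minimal length among all words in positive letters with the same permutation. -/
def IsReduced (w : List ℕ) : Prop :=
  (∀ x ∈ w, 1 ≤ x) ∧
    ∀ v : List ℕ, (∀ x ∈ v, 1 ≤ x) → wordPerm v = wordPerm w → w.length ≤ v.length

/-! ### Edelman–Greene insertion -/

/-- Edelman–Greene insertion of `n` into the tableau with the given list of rows.  Returns the new
tableau and the position (row, column), counted from `0`, of the box that was added. -/
def egInsert : ℕ → List (List ℕ) → List (List ℕ) × (ℕ × ℕ)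
  | n, [] => ([[n]], (0, 0))
  | n, R :: T =>
    match R.findIdx? (fun r => n < r) with
    | none => ((R ++ [n]) :: T, (0, R.length))
    | some j =>
      if R[j]? = some (n + 1) ∧ 1 ≤ j ∧ R[j - 1]? = some n then
        let U := egInsert (n + 1) T
        (R :: U.1, (U.2.1 + 1, U.2.2))
      else
        let U := egInsert (R.getD j 0) T
        (R.set j n :: U.1, (U.2.1 + 1, U.2.2))

/-- The insertion tableau `P(w)`, as a list of rows; letters are inserted from right to left. -/
def insertionTableau : List ℕ → List (List ℕ)
  | [] => []
  | x :: w => (egInsert x (insertionTableau w)).1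

/-- A filling of boxes with numbers: the entry in row `r` and column `c` (counted from `0`, rows
from top to bottom), or `none` if there is no box at that place. -/
abbrev Tableau : Type := ℕ → ℕ → Option ℕ

/-- The recording tableau `Q(w)`: each box contains the number of the step at which it was added
(the first letter `x` of `x :: w` is inserted last, at step `w.length + 1`). -/
def recordingTableau : List ℕ → Tableau
  | [] => fun _ _ => none
  | x :: w => fun r c =>
    if (r, c) = (egInsert x (insertionTableau w)).2 then some (w.length + 1)
    else recordingTableau w r c

/-! ### Swaps, Grassmannian words and their tableaux -/

/-- The unordered pair of values exchanged by the letter at position `l` of `w`: the values of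
`s_{w_1} ⋯ s_{w_{l-1}}` at the places `w_l` and `w_l + 1`. -/
def swapPair (w : List ℕ) (l : ℕ) : Sym2 ℕ :=
  s(wordPerm (w.take l) (w.getD l 0), wordPerm (w.take l) (w.getD l 0 + 1))

/-- The position of the (first) letter of `w` that exchanges the values `a` and `b`, if any. -/
def swapLocation (w : List ℕ) (a b : ℕ) : Option ℕ :=
  (List.range w.length).find? (fun l => swapPair w l = s(a, b))

/-- `i` is a descent of `σ`, that is, `(i, i + 1)` is an inversion. -/
def IsDescent (σ : Equiv.Perm ℕ) (i : ℕ) : Prop := σ (i + 1) < σ i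

/-- A permutation is Grassmannian if it has exactly one descent. -/
def IsGrassmannian (σ : Equiv.Perm ℕ) : Prop := ∃! i, IsDescent σ i

/-- For a Grassmannian word `w` with `σ = a_1 ⋯ a_k b_1 b_2 ⋯` and descent `k`: the rows are indexed
by `a_k, …, a_1`, the columns by `b_1, b_2, …`, and if `a_i` and `b_j` are exchanged by the `l`-th
letter (counted from `1`) then `m + 1 - l` is entered in row `a_i` and column `b_j`. -/
def grassmannianTableau (w : List ℕ) (k : ℕ) : Tableau := fun r c =>
  if r < k then
    (swapLocation w (wordPerm w (k - r)) (wordPerm w (k + 1 + c))).map (fun l => w.length - l)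
  else none

/-! ### Little bumps and the Little map -/

/-- Decrement the letter at position `i`; if that letter is `1`, increment all the others. -/
def decrementAt (w : List ℕ) (i : ℕ) : List ℕ :=
  if 1 < w.getD i 0 then w.set i (w.getD i 0 - 1)
  else (w.map (· + 1)).set i (w.getD i 0)

/-- The position, other than `i`, of a letter of `v` exchanging the same values as the letter at
position `i`. -/
def conflict (v : List ℕ) (i : ℕ) : Option ℕ :=
  (List.range v.length).find? (fun j => j ≠ i ∧ swapPair v j = swapPair v i)

open Classical in
/-- One step of a Little bump: decrement the letter at position `i`; stop if the result is reduced,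
and otherwise go on with the other letter that exchanges the same values. -/
noncomputable def bumpStep (p : List ℕ × ℕ) : Part (List ℕ ⊕ (List ℕ × ℕ)) :=
  let v := decrementAt p.1 p.2
  if IsReduced v then Part.some (Sum.inl v)
  else (Part.ofOption (conflict v p.2)).map (fun j => Sum.inr (v, j))

/-- The Little bump of `w` beginning at position `i`: iterate `bumpStep` until it stops.  It is
undefined if the iteration does not stop or if some step is undefined. -/
noncomputable def littleBump (w : List ℕ) (i : ℕ) : Part (List ℕ) := PFun.fix bumpStep (w, i)

/-- `p = (i, j)` is an inversion of `σ`: `i < j` and `σ_i > σ_j`. -/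
def IsInversion (σ : Equiv.Perm ℕ) (p : ℕ × ℕ) : Prop := p.1 < p.2 ∧ σ p.2 < σ p.1

/-- `p` is the lexicographically last inversion of `σ`. -/
def IsLastInversion (σ : Equiv.Perm ℕ) (p : ℕ × ℕ) : Prop :=
  IsInversion σ p ∧ ∀ q, IsInversion σ q → toLex q ≤ toLex p

open Classical in
/-- The position of the letter of `w` that exchanges the two values of the last inversion of the
permutation of `w`. -/
noncomputable def lastInversionLocation (w : List ℕ) : Option ℕ :=
  if h : ∃ p, IsLastInversion (wordPerm w) p then
    swapLocation w (wordPerm w h.choose.1) (wordPerm w h.choose.2)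
  else none

open Classical in
/-- One step of the Little map.  A Grassmannian word gives its tableau (and the empty word, whose
permutation has no inversion at all, gives the empty tableau); to any other word, the Little bump
beginning at the swap location of its last inversion is applied. -/
noncomputable def littleStep (w : List ℕ) : Part (Tableau ⊕ List ℕ) :=
  if w = [] then Part.some (Sum.inl (fun _ _ => none))
  else if h : IsGrassmannian (wordPerm w) then
    Part.some (Sum.inl (grassmannianTableau w h.exists.choose))
  else (Part.ofOption (lastInversionLocation w)).bind
    (fun i => (littleBump w i).map Sum.inr)

/-- The Little map `LS`: iterate `littleStep` until it outputs a tableau.  It is undefined if the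
iteration does not stop or if some step is undefined. -/
noncomputable def littleMap (w : List ℕ) : Part Tableau := PFun.fix littleStep w

end LittleEG

/-!
# The Little map computes Edelman–Greene recording tableaux

*Crossings.*  A word in positive letters is reduced exactly if no two of its letters exchange the
same two values (`isReduced_iff`): two letters that do can be deleted, and if there are none, the
letters correspond to the pairs of values reversed by the permutation.  All facts about bumps are
read off from the relative order of two values along the word, which changes only at a letter
exchanging them.

*The Little map is defined.*  After each step of a Little bump, deleting the letter just lowered
leaves a reduced word, so there is at most one conflict (`conflict_unique`), and the bump ends
because the sum of the letters decreases (`Lowered.exists_run`; renormalisation is postponed to the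
end).  The bump pushes a single wire downwards (`Lowered.wire_step`), which determines its effect on
the permutation (`LittleNext.exists_perm`): the last descent moves towards the first one until the
word is Grassmannian (`exists_littleChain`).  Bumps preserve the descents of the word
(`LittleNext.sameDescents`) and commute with Coxeter–Knuth moves, by a case check on three adjacent
letters (`KnuthTriple.exists_localRun`, `KnuthEquiv.littleChain`).

*Grassmannian words.*  Here Edelman–Greene insertion is explicit: a letter adds the box whose content
is the letter minus `k`.  Hence `Q(g) = Tab(g)` (`recordingTableau_eq_grassmannianTableau`), and a
decreasing or increasing run of letters adds a horizontal or vertical strip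
(`rowLen_of_decreasing`, `rowLen_of_increasing`).

*Comparison of shapes.*  Let the Little map lead from `w` to the Grassmannian word `g`.  Since `Q` is
determined by the shapes of the insertion tableaux of all suffixes (`recordingTableau_congr`), it
suffices that corresponding suffixes of `w` and `g` have insertion tableaux of the same shape.  By
Coxeter–Knuth moves inside the suffix of `w`, which do not change the shape reached at the end, it
can be replaced by the row reading word of its insertion tableau, or by a word ending with the first
columns of that tableau (`insertionTableau_spec`, `exists_knuthEquiv_columns`).  The decreasing and
increasing runs of these words survive the bumps, so the shapes dominate each other with respect to
rows and to columns, and are equal (`rowLen_eq_of_littleChain`).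
-/

namespace LittleEG

/-! ### Swap pairs and the relative order of two values -/

@[simp] theorem wordPerm_nil : wordPerm [] = 1 := rfl

theorem wordPerm_cons (x : ℕ) (w : List ℕ) : wordPerm (x :: w) = simpleSwap x * wordPerm w := by
  simp [wordPerm]

theorem wordPerm_append (v w : List ℕ) : wordPerm (v ++ w) = wordPerm v * wordPerm w := by
  simp [wordPerm]

/-- The permutation of the first `n` letters of `u`. -/
def prefixPerm (u : List ℕ) (n : ℕ) : Equiv.Perm ℕ := wordPerm (u.take n)

theorem swapPair_eq (u : List ℕ) (i : ℕ) :
    swapPair u i = s(prefixPerm u i (u.getD i 0), prefixPerm u i (u.getD i 0 + 1)) := rfl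

theorem prefixPerm_zero (u : List ℕ) : prefixPerm u 0 = 1 := by simp [prefixPerm]

theorem prefixPerm_length (u : List ℕ) : prefixPerm u u.length = wordPerm u := by
  simp [prefixPerm]

theorem prefixPerm_succ (u : List ℕ) {n : ℕ} (h : n < u.length) :
    prefixPerm u (n + 1) = prefixPerm u n * simpleSwap (u.getD n 0) := by
  have : u.take (n + 1) = u.take n ++ [u.getD n 0] := by
    rw [List.take_add_one]; simp [h]
  rw [prefixPerm, this, wordPerm_append]
  simp [prefixPerm, wordPerm]

theorem swapPair_append_left (p r : List ℕ) {l : ℕ} (h : l < p.length) :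
    swapPair (p ++ r) l = swapPair p l := by
  simp only [swapPair]
  rw [List.take_append_of_le_length h.le, List.getD_append _ _ _ _ h]

theorem swapPair_append_right (p r : List ℕ) (l : ℕ) :
    swapPair (p ++ r) (p.length + l) = Sym2.map (wordPerm p) (swapPair r l) := by
  simp only [swapPair]
  rw [List.take_length_add_append, List.getD_append_right _ _ _ _ (by omega), wordPerm_append]
  simp

/-- The word `u` crosses no two values twice.  By `isReduced_iff` this characterises reduced words
(for words in positive letters). -/
def DistinctSwaps (u : List ℕ) : Prop :=
  ∀ ⦃i j⦄, i < u.length → j < u.length → swapPair u i = swapPair u j → i = j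

theorem simpleSwap_lt_iff (x : ℕ) (p q : ℕ) :
    simpleSwap x p < simpleSwap x q ↔ (if s(p, q) = s(x, x + 1) then q < p else p < q) := by
  have h1 : s(p, q) = s(x, x + 1) ↔ (p = x ∧ q = x + 1) ∨ (p = x + 1 ∧ q = x) := by
    simp
  simp only [h1, simpleSwap, Equiv.swap_apply_def]
  split_ifs <;> omega

theorem simpleSwap_inv (x : ℕ) : (simpleSwap x)⁻¹ = simpleSwap x := by simp [simpleSwap]

theorem prefixPerm_succ_symm (u : List ℕ) {n : ℕ} (h : n < u.length) (a : ℕ) :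
    (prefixPerm u (n + 1)).symm a = simpleSwap (u.getD n 0) ((prefixPerm u n).symm a) := by
  rw [prefixPerm_succ u h, ← Equiv.Perm.inv_def, mul_inv_rev, simpleSwap_inv]; rfl

theorem swapPair_eq_iff_symm (u : List ℕ) (n a b : ℕ) :
    swapPair u n = s(a, b) ↔
      s((prefixPerm u n).symm a, (prefixPerm u n).symm b) = s(u.getD n 0, u.getD n 0 + 1) := by
  rw [swapPair_eq]
  simp only [Sym2.eq_iff, Equiv.symm_apply_eq]
  grind

/-- A letter reverses the order of the two values it exchanges and of no others. -/
theorem order_succ (u : List ℕ) {n : ℕ} (h : n < u.length) {a b : ℕ} :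
    (prefixPerm u (n + 1)).symm a < (prefixPerm u (n + 1)).symm b ↔
      (if swapPair u n = s(a, b) then (prefixPerm u n).symm b < (prefixPerm u n).symm a
        else (prefixPerm u n).symm a < (prefixPerm u n).symm b) := by
  rw [prefixPerm_succ_symm u h, prefixPerm_succ_symm u h, simpleSwap_lt_iff]
  simp only [swapPair_eq_iff_symm]

/-- The order of `a` and `b` does not change along a stretch without a letter exchanging them. -/
theorem order_same (u : List ℕ) {m n : ℕ} (hmn : m ≤ n) (hn : n ≤ u.length) {a b : ℕ}
    (h : ∀ l, m ≤ l → l < n → swapPair u l ≠ s(a, b)) :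
    (prefixPerm u n).symm a < (prefixPerm u n).symm b ↔
      (prefixPerm u m).symm a < (prefixPerm u m).symm b := by
  induction n, hmn using Nat.le_induction with
  | base => rfl
  | succ n hmn ih =>
    rw [order_succ u (by omega), if_neg (h n hmn (by omega))]
    exact ih (by omega) (fun l h1 h2 => h l h1 (by omega))

/-- The order of `a` and `b` is reversed along a stretch with one letter exchanging them. -/
theorem order_flip (u : List ℕ) {m l n : ℕ} (hml : m ≤ l) (hln : l < n) (hn : n ≤ u.length)
    {a b : ℕ} (hl : swapPair u l = s(a, b))
    (h : ∀ l', m ≤ l' → l' < n → swapPair u l' = s(a, b) → l' = l) :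
    (prefixPerm u n).symm a < (prefixPerm u n).symm b ↔
      (prefixPerm u m).symm b < (prefixPerm u m).symm a := by
  rw [order_same u (m := l + 1) hln hn, order_succ u (by omega), if_pos hl,
    order_same u hml (by omega)]
  · intro k h1 h2 h3
    have := h k h1 (by omega) (by rw [h3, Sym2.eq_swap])
    omega
  · intro k h1 h2 h3
    have := h k (by omega) h2 h3
    omega

theorem symm_lt_asymm {σ : Equiv.Perm ℕ} {a b : ℕ} (hab : a ≠ b) :
    σ.symm b < σ.symm a ↔ ¬ σ.symm a < σ.symm b := by
  have : σ.symm a ≠ σ.symm b := by simpa using hab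
  omega

theorem swapPair_ne_diag (u : List ℕ) (i a : ℕ) : swapPair u i ≠ s(a, a) := by
  rw [swapPair_eq]
  intro h
  have h' := Sym2.eq_iff.1 h
  have : prefixPerm u i (u.getD i 0) = prefixPerm u i (u.getD i 0 + 1) := by
    rcases h' with ⟨h1, h2⟩ | ⟨h1, h2⟩ <;> rw [h1, h2]
  simp at this

theorem exists_swapPair (u : List ℕ) (i : ℕ) : ∃ a b, a < b ∧ swapPair u i = s(a, b) := by
  have h : prefixPerm u i (u.getD i 0) ≠ prefixPerm u i (u.getD i 0 + 1) := by simp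
  rcases lt_or_gt_of_ne h with h | h
  · exact ⟨_, _, h, rfl⟩
  · exact ⟨_, _, h, by rw [swapPair_eq, Sym2.eq_swap]⟩

/-- Two values that are adjacent at the moment `i` lie on the same side of any third value. -/
theorem order_adjacent (u : List ℕ) {i c d e : ℕ} (h : swapPair u i = s(c, e)) (hc : d ≠ c)
    (he : d ≠ e) : (prefixPerm u i).symm c < (prefixPerm u i).symm d ↔
      (prefixPerm u i).symm e < (prefixPerm u i).symm d := by
  rw [swapPair_eq_iff_symm, Sym2.eq_iff] at h
  have h1 : (prefixPerm u i).symm d ≠ (prefixPerm u i).symm c := by simpa using hc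
  have h2 : (prefixPerm u i).symm d ≠ (prefixPerm u i).symm e := by simpa using he
  omega

theorem order_start (u : List ℕ) {n a b : ℕ} (hn : n ≤ u.length)
    (h : ∀ l < n, swapPair u l ≠ s(a, b)) :
    (prefixPerm u n).symm a < (prefixPerm u n).symm b ↔ a < b := by
  rw [order_same u (Nat.zero_le _) hn (fun l _ => h l), prefixPerm_zero]; rfl

theorem order_start_flip (u : List ℕ) {n l a b : ℕ} (hn : n ≤ u.length) (hl : l < n)
    (hs : swapPair u l = s(a, b)) (h : ∀ l' < n, swapPair u l' = s(a, b) → l' = l) :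
    (prefixPerm u n).symm a < (prefixPerm u n).symm b ↔ b < a := by
  rw [order_flip u (Nat.zero_le _) hl hn hs (fun l' _ => h l'), prefixPerm_zero]; rfl

/-- Values reversed by the permutation of `u` are exchanged by some letter of `u`. -/
theorem exists_swapPair_of_inverted (u : List ℕ) {a b : ℕ} (hab : a < b)
    (h : (wordPerm u).symm b < (wordPerm u).symm a) :
    ∃ l < u.length, swapPair u l = s(a, b) := by
  by_contra! hc
  have := order_start u le_rfl hc
  rw [prefixPerm_length] at this
  omega

/-- In a word with distinct swap pairs, the permutation reverses every exchanged pair. -/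
theorem DistinctSwaps.inverted {u : List ℕ} (hu : DistinctSwaps u) {l a b : ℕ}
    (hl : l < u.length) (hab : a < b) (h : swapPair u l = s(a, b)) :
    (wordPerm u).symm b < (wordPerm u).symm a := by
  have := order_start_flip u le_rfl hl h (fun l' h1 h2 => hu h1 hl (h2.trans h.symm))
  rw [prefixPerm_length] at this
  rw [symm_lt_asymm hab.ne, this]
  omega

/-- A word with distinct swap pairs is as short as possible: its letters correspond to the pairs of
values that its permutation reverses. -/
theorem DistinctSwaps.length_le {u v : List ℕ} (hu : DistinctSwaps u)
    (h : wordPerm v = wordPerm u) : u.length ≤ v.length := by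
  have hsub : (Finset.range u.length).image (swapPair u) ⊆
      (Finset.range v.length).image (swapPair v) := by
    intro P hP
    obtain ⟨l, hl, rfl⟩ := Finset.mem_image.1 hP
    obtain ⟨a, b, hab, hs⟩ := exists_swapPair u l
    have h1 := hu.inverted (Finset.mem_range.1 hl) hab hs
    rw [← h] at h1
    obtain ⟨l', hl', h2⟩ := exists_swapPair_of_inverted v hab h1
    exact Finset.mem_image.2 ⟨l', Finset.mem_range.2 hl', h2.trans hs.symm⟩
  have h1 := Finset.card_le_card hsub
  rw [Finset.card_image_of_injOn] at h1
  · simpa using h1.trans Finset.card_image_le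
  · intro i hi j hj hij
    exact hu (by simpa using hi) (by simpa using hj) hij

/-! ### Deleting a letter -/

theorem eq_take_cons_drop (u : List ℕ) {i : ℕ} (h : i < u.length) :
    u = u.take i ++ u.getD i 0 :: u.drop (i + 1) := by
  have h1 := List.take_append_drop i u
  rw [List.drop_eq_getElem_cons h] at h1
  rw [List.getD_eq_getElem _ _ h]
  exact h1.symm

/-- The transposition of the two values exchanged by the letter at position `i`. -/
def letterSwap (u : List ℕ) (i : ℕ) : Equiv.Perm ℕ :=
  Equiv.swap (prefixPerm u i (u.getD i 0)) (prefixPerm u i (u.getD i 0 + 1))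

theorem letterSwap_eq_of_swapPair {u v : List ℕ} {i j : ℕ} (h : swapPair u i = swapPair v j) :
    letterSwap u i = letterSwap v j := by
  rw [swapPair_eq, swapPair_eq, Sym2.eq_iff] at h
  unfold letterSwap
  rcases h with ⟨h1, h2⟩ | ⟨h1, h2⟩
  · rw [h1, h2]
  · rw [h1, h2, Equiv.swap_comm]

theorem letterSwap_eq {u : List ℕ} {i a b : ℕ} (h : swapPair u i = s(a, b)) :
    letterSwap u i = Equiv.swap a b := by
  rw [swapPair_eq, Sym2.eq_iff] at h
  unfold letterSwap
  rcases h with ⟨h1, h2⟩ | ⟨h1, h2⟩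
  · rw [h1, h2]
  · rw [h1, h2, Equiv.swap_comm]

theorem letterSwap_mul_prefixPerm (u : List ℕ) (i : ℕ) :
    letterSwap u i * prefixPerm u i = prefixPerm u i * simpleSwap (u.getD i 0) := by
  rw [letterSwap, simpleSwap, Equiv.swap_apply_apply]; simp

@[simp] theorem letterSwap_mul_self (u : List ℕ) (i : ℕ) : letterSwap u i * letterSwap u i = 1 := by
  simp [letterSwap]

theorem wordPerm_eraseIdx (u : List ℕ) {i : ℕ} (h : i < u.length) :
    wordPerm (u.eraseIdx i) = letterSwap u i * wordPerm u := by
  have hu : wordPerm u =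
      prefixPerm u i * (simpleSwap (u.getD i 0) * wordPerm (u.drop (i + 1))) := by
    conv_lhs => rw [eq_take_cons_drop u h, wordPerm_append, wordPerm_cons]
    rfl
  rw [List.eraseIdx_eq_take_drop_succ, wordPerm_append, ← prefixPerm, hu, ← mul_assoc,
    letterSwap_mul_prefixPerm]
  simp [mul_assoc, simpleSwap]

theorem swapPair_eraseIdx_of_lt (u : List ℕ) {i k : ℕ} (hi : i < u.length) (h : k < i) :
    swapPair (u.eraseIdx i) k = swapPair u k := by
  conv_rhs => rw [eq_take_cons_drop u hi]
  rw [List.eraseIdx_eq_take_drop_succ, swapPair_append_left _ _ (by simp; omega),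
    swapPair_append_left _ _ (by simp; omega)]

theorem swapPair_eraseIdx_of_ge (u : List ℕ) {i k : ℕ} (hi : i < u.length) (h : i ≤ k) :
    swapPair (u.eraseIdx i) k = Sym2.map (letterSwap u i) (swapPair u (k + 1)) := by
  obtain ⟨l, rfl⟩ := Nat.exists_eq_add_of_le h
  have hlen : (u.take i).length = i := by simp; omega
  have e1 : swapPair (u.eraseIdx i) (i + l) =
      Sym2.map (prefixPerm u i) (swapPair (u.drop (i + 1)) l) := by
    have := swapPair_append_right (u.take i) (u.drop (i + 1)) l
    rwa [hlen, ← List.eraseIdx_eq_take_drop_succ] at this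
  have e2 : swapPair u (i + l + 1) = Sym2.map (prefixPerm u i * simpleSwap (u.getD i 0))
      (swapPair (u.drop (i + 1)) l) := by
    have : u = (u.take i ++ [u.getD i 0]) ++ u.drop (i + 1) := by
      rw [List.append_assoc]; exact eq_take_cons_drop u hi
    have hlen' : (u.take i ++ [u.getD i 0]).length = i + 1 := by simp; omega
    conv_lhs => rw [this, show i + l + 1 = (u.take i ++ [u.getD i 0]).length + l by omega]
    rw [swapPair_append_right, wordPerm_append]
    simp [prefixPerm, wordPerm]
  rw [e1, e2, ← letterSwap_mul_prefixPerm, Sym2.map_map]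
  congr 1
  ext x
  have : (letterSwap u i) ((letterSwap u i) (prefixPerm u i x)) = prefixPerm u i x := by
    rw [← Equiv.Perm.mul_apply, letterSwap_mul_self]; rfl
  simp [this]

/-- Deleting two letters that exchange the same values does not change the permutation. -/
theorem exists_shorter {u : List ℕ} (h : ¬ DistinctSwaps u) :
    ∃ v, wordPerm v = wordPerm u ∧ v.length < u.length ∧ ∀ x ∈ v, x ∈ u := by
  unfold DistinctSwaps at h
  push Not at h
  obtain ⟨i, j, hi, hj, hij, hne⟩ := h
  wlog hlt : i < j generalizing i j
  · exact this j i hj hi hij.symm hne.symm (by omega)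
  have hi' : i < (u.eraseIdx j).length := by rw [List.length_eraseIdx_of_lt hj]; omega
  refine ⟨(u.eraseIdx j).eraseIdx i, ?_, ?_, ?_⟩
  · rw [wordPerm_eraseIdx _ hi', wordPerm_eraseIdx _ hj, ← mul_assoc,
      letterSwap_eq_of_swapPair ((swapPair_eraseIdx_of_lt u hj hlt).trans hij)]
    simp
  · rw [List.length_eraseIdx_of_lt hi', List.length_eraseIdx_of_lt hj]; omega
  · intro x hx
    exact List.mem_of_mem_eraseIdx (List.mem_of_mem_eraseIdx hx)

theorem isReduced_iff {u : List ℕ} (hpos : ∀ x ∈ u, 1 ≤ x) : IsReduced u ↔ DistinctSwaps u := by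
  constructor
  · intro h
    by_contra hc
    obtain ⟨v, h1, h2, h3⟩ := exists_shorter hc
    exact absurd (h.2 v (fun x hx => hpos x (h3 x hx)) h1) (by omega)
  · exact fun h => ⟨hpos, fun v _ hv => h.length_le hv⟩

theorem distinctSwaps_of_length_le {u : List ℕ} (h : ∀ v, wordPerm v = wordPerm u →
    u.length ≤ v.length) : DistinctSwaps u := by
  by_contra hc
  obtain ⟨v, h1, h2, -⟩ := exists_shorter hc
  exact absurd (h v h1) (by omega)

theorem DistinctSwaps.of_wordPerm_eq {u v : List ℕ} (hu : DistinctSwaps u)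
    (h : wordPerm v = wordPerm u) (hl : v.length = u.length) : DistinctSwaps v :=
  distinctSwaps_of_length_le fun _ hx => hl ▸ hu.length_le (hx.trans h)

theorem DistinctSwaps.append_right {u v : List ℕ} (h : DistinctSwaps (u ++ v)) :
    DistinctSwaps v := by
  intro i j hi hj hij
  have := @h (u.length + i) (u.length + j) (by simp; omega) (by simp; omega)
    (by rw [swapPair_append_right, swapPair_append_right, hij])
  omega

theorem DistinctSwaps.append_left {u v : List ℕ} (h : DistinctSwaps (u ++ v)) :
    DistinctSwaps u := by
  intro i j hi hj hij
  exact h (by simp; omega) (by simp; omega)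
    (by rw [swapPair_append_left _ _ hi, swapPair_append_left _ _ hj, hij])

/-- If a pair is changed by the transposition of `p` and `q`, then exactly one of its elements is `p`
or `q`, and it is exchanged for the other one. -/
theorem swapPair_map_swap_cases {p q : ℕ} {P : Sym2 ℕ} (hd : ∀ a, P ≠ s(a, a))
    (hne : Sym2.map (Equiv.swap p q) P ≠ P) :
    ∃ c d e, P = s(c, d) ∧ s(p, q) = s(c, e) ∧ d ≠ c ∧ d ≠ e ∧
      Sym2.map (Equiv.swap p q) P = s(e, d) := by
  induction P using Sym2.ind with
  | _ x y =>
    rw [Sym2.map_mk] at hne ⊢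
    by_cases hx : x = p ∨ x = q <;> by_cases hy : y = p ∨ y = q
    · exfalso
      apply hne
      rcases hx with rfl | rfl <;> rcases hy with rfl | rfl <;>
        first | exact absurd rfl (hd _) | simp [Sym2.eq_swap]
    · push Not at hy
      rw [Equiv.swap_apply_of_ne_of_ne hy.1 hy.2]
      rcases hx with rfl | rfl
      · exact ⟨x, y, q, rfl, rfl, hy.1, hy.2, by rw [Equiv.swap_apply_left]⟩
      · exact ⟨x, y, p, rfl, Sym2.eq_swap, hy.2, hy.1, by rw [Equiv.swap_apply_right]⟩
    · push Not at hx
      rw [Equiv.swap_apply_of_ne_of_ne hx.1 hx.2]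
      rcases hy with rfl | rfl
      · exact ⟨y, x, q, Sym2.eq_swap, rfl, hx.1, hx.2, by
          rw [Equiv.swap_apply_left, Sym2.eq_swap]⟩
      · exact ⟨y, x, p, Sym2.eq_swap, Sym2.eq_swap, hx.2, hx.1, by
          rw [Equiv.swap_apply_right, Sym2.eq_swap]⟩
    · push Not at hx hy
      exact absurd (by rw [Equiv.swap_apply_of_ne_of_ne hx.1 hx.2,
        Equiv.swap_apply_of_ne_of_ne hy.1 hy.2]) hne

section Erase
variable {u : List ℕ} {i : ℕ}

theorem swapPair_ne_of_erase (hi : i < u.length) (hnr : DistinctSwaps (u.eraseIdx i)) {k l : ℕ}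
    (hkl : k < l) (hl : l < u.length) (hside : l < i ∨ i < k) : swapPair u k ≠ swapPair u l := by
  intro h
  have hlen := List.length_eraseIdx_of_lt hi
  rcases hside with hs | hs
  · have := @hnr k l (by omega) (by omega)
      (by rw [swapPair_eraseIdx_of_lt u hi (by omega), swapPair_eraseIdx_of_lt u hi hs, h])
    omega
  · have := @hnr (k - 1) (l - 1) (by omega) (by omega)
      (by rw [swapPair_eraseIdx_of_ge u hi (by omega), swapPair_eraseIdx_of_ge u hi (by omega),
            Nat.sub_add_cancel (by omega), Nat.sub_add_cancel (by omega), h])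
    omega

theorem swapPair_ne_across_of_erase (hi : i < u.length) (hnr : DistinctSwaps (u.eraseIdx i))
    {k l : ℕ} (hki : k < i) (hil : i < l) (hl : l < u.length) :
    swapPair u k ≠ Sym2.map (letterSwap u i) (swapPair u l) := by
  intro h
  have hlen := List.length_eraseIdx_of_lt hi
  have := @hnr k (l - 1) (by omega) (by omega)
    (by rw [swapPair_eraseIdx_of_lt u hi hki, swapPair_eraseIdx_of_ge u hi (by omega),
          Nat.sub_add_cancel (by omega), h])
  omega

theorem map_letterSwap_self (u : List ℕ) (i : ℕ) :
    Sym2.map (letterSwap u i) (swapPair u i) = swapPair u i := by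
  rw [swapPair_eq, letterSwap]; simp [Sym2.eq_swap]

theorem letterSwap_letterSwap (u : List ℕ) (i x : ℕ) : letterSwap u i (letterSwap u i x) = x := by
  rw [← Equiv.Perm.mul_apply, letterSwap_mul_self]; rfl

theorem map_letterSwap_map (u : List ℕ) (i : ℕ) (P : Sym2 ℕ) :
    Sym2.map (letterSwap u i) (Sym2.map (letterSwap u i) P) = P := by
  rw [Sym2.map_map]
  have : (letterSwap u i : ℕ → ℕ) ∘ (letterSwap u i) = id := by
    ext x; exact letterSwap_letterSwap u i x
  rw [this, Sym2.map_id]; rfl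

/-- At most one other letter exchanges the same values as a letter whose deletion leaves a word
with distinct swap pairs. -/
theorem conflict_unique (hi : i < u.length) (hnr : DistinctSwaps (u.eraseIdx i)) {k l : ℕ}
    (hk : k < u.length) (hl : l < u.length) (hki : k ≠ i) (hli : l ≠ i)
    (hk' : swapPair u k = swapPair u i) (hl' : swapPair u l = swapPair u i) : k = l := by
  by_contra hne
  wlog hlt : k < l generalizing k l
  · exact this hl hk hli hki hl' hk' (Ne.symm hne) (by omega)
  by_cases hs : l < i ∨ i < k
  · exact swapPair_ne_of_erase hi hnr hlt hl hs (hk'.trans hl'.symm)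
  · apply swapPair_ne_across_of_erase hi hnr (k := k) (l := l) (by omega) (by omega) hl
    rw [hl', hk', map_letterSwap_self]

/-- Deleting the other letter that exchanges the same values also leaves a word with distinct
swap pairs. -/
theorem distinctSwaps_erase_conflict (hi : i < u.length) (hnr : DistinctSwaps (u.eraseIdx i))
    {j : ℕ} (hj : j < u.length) (h : swapPair u j = swapPair u i) :
    DistinctSwaps (u.eraseIdx j) := by
  apply hnr.of_wordPerm_eq
  · rw [wordPerm_eraseIdx u hi, wordPerm_eraseIdx u hj, letterSwap_eq_of_swapPair h]
  · rw [List.length_eraseIdx_of_lt hi, List.length_eraseIdx_of_lt hj]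

/-- If deleting a letter gives a word with distinct swap pairs but the word itself has a repeated
pair, then the pair of that letter is repeated. -/
theorem exists_conflict (hi : i < u.length) (hnr : DistinctSwaps (u.eraseIdx i))
    (hu : ¬ DistinctSwaps u) : ∃ j < u.length, j ≠ i ∧ swapPair u j = swapPair u i := by
  by_contra! hno
  apply hu
  intro k l hk hl hkl
  by_contra hne
  wlog hlt : k < l generalizing k l
  · exact this hl hk hkl.symm (Ne.symm hne) (by omega)
  by_cases hki : k = i
  · exact hno l hl (by omega) (by rw [← hkl, hki])
  by_cases hli : l = i
  · exact hno k hk (by omega) (by rw [hkl, hli])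
  by_cases hs : l < i ∨ i < k
  · exact swapPair_ne_of_erase hi hnr hlt hl hs hkl
  have h1 : k < i := by omega
  have h2 : i < l := by omega
  have hac := swapPair_ne_across_of_erase hi hnr h1 h2 hl
  rw [hkl] at hac
  obtain ⟨c, d, e, hP, hT, hdc, hde, hmap⟩ := swapPair_map_swap_cases (swapPair_ne_diag u l) (Ne.symm hac)
  change swapPair u i = s(c, e) at hT
  change Sym2.map (letterSwap u i) (swapPair u l) = s(e, d) at hmap
  have hce : c ≠ e := by
    rintro rfl; exact swapPair_ne_diag u i c hT
  have hk' : swapPair u k = s(c, d) := hkl.trans hP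
  -- the order at the moment `i`: `c`, `d` have been exchanged, `e`, `d` have not
  have o1 := order_start_flip u hi.le h1 hk' (fun l' hl' hs' => by
    by_contra hne'
    rcases lt_or_gt_of_ne hne' with hh | hh
    · exact swapPair_ne_of_erase hi hnr hh hk (Or.inl h1) (hs'.trans hk'.symm)
    · exact swapPair_ne_of_erase hi hnr hh (by omega) (Or.inl hl') (hk'.trans hs'.symm))
  have o2 := order_start u hi.le (fun l' hl' hs' => by
    exact swapPair_ne_across_of_erase hi hnr hl' h2 hl (hs'.trans hmap.symm))
  have o3 := order_adjacent u hT hdc hde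
  -- the order at the end: `c`, `d` are exchanged again, `e`, `d` still not, `c`, `e` once
  have p1 := order_flip u h2.le hl le_rfl hP (fun l' hl1 hl2 hs' => by
    by_contra hne'
    have hl3 : i < l' := lt_of_le_of_ne hl1 (fun hh => by
      subst hh
      rw [hT, Sym2.eq_iff] at hs'
      omega)
    rcases lt_or_gt_of_ne hne' with hh | hh
    · exact swapPair_ne_of_erase hi hnr hh hl (Or.inr hl3) (hs'.trans hP.symm)
    · exact swapPair_ne_of_erase hi hnr hh hl2 (Or.inr h2) (hP.trans hs'.symm))
  have p2 := order_same u (a := e) (b := d) hi.le le_rfl (fun l' hl1 hl2 hs' => by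
    rcases hl1.eq_or_lt with hh | hh
    · subst hh
      rw [hT, Sym2.eq_iff] at hs'
      omega
    · apply swapPair_ne_across_of_erase hi hnr h1 hh hl2
      rw [hs', ← hmap, map_letterSwap_map, hkl])
  have p3 := order_start_flip u le_rfl hi hT (fun l' hl' hs' => by
    by_contra hne'
    exact hno l' hl' hne' (hs'.trans hT.symm))
  have q1 := symm_lt_asymm (σ := prefixPerm u i) hdc
  have q2 := symm_lt_asymm (σ := prefixPerm u u.length) hdc
  have q3 := symm_lt_asymm (σ := prefixPerm u i) hde
  omega

/-- Deleting a letter that exchanges values without an intermediate value in an intermediate place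
keeps the swap pairs distinct. -/
theorem DistinctSwaps.eraseIdx_of_cover (hu : DistinctSwaps u) (hi : i < u.length) {a b : ℕ}
    (hab : swapPair u i = s(a, b)) (hba : b < a)
    (hcov : ∀ d, b < d → d < a → (wordPerm u).symm a < (wordPerm u).symm d →
      (wordPerm u).symm d < (wordPerm u).symm b → False) : DistinctSwaps (u.eraseIdx i) := by
  have hlen := List.length_eraseIdx_of_lt hi
  have across : ∀ k l, k < i → i < l → l < u.length →
      swapPair u k ≠ Sym2.map (letterSwap u i) (swapPair u l) := by
    intro k l hki hil hl h
    have hne : Sym2.map (letterSwap u i) (swapPair u l) ≠ swapPair u l := by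
      rw [← h]; intro h'
      have := hu (by omega) hl h'
      omega
    obtain ⟨c, d, e, hP, hT, hdc, hde, hmap⟩ := swapPair_map_swap_cases (swapPair_ne_diag u l) hne
    change swapPair u i = s(c, e) at hT
    change Sym2.map (letterSwap u i) (swapPair u l) = s(e, d) at hmap
    have hk' := h.trans hmap
    have hce : c ≠ e := by
      rintro rfl; exact swapPair_ne_diag u i c hT
    have hk : k < u.length := by omega
    have o1 := order_start_flip u hi.le hki hk' (fun l' hl' hs' =>
      hu (by omega) hk (hs'.trans hk'.symm))
    have o2 := order_start u hi.le (fun l' hl' hs' => by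
      have := hu (by omega) hl (hs'.trans hP.symm)
      omega)
    have o3 := order_adjacent u hT hdc hde
    have p1 := order_start_flip u le_rfl hk hk' (fun l' hl' hs' =>
      hu (by omega) hk (hs'.trans hk'.symm))
    have p2 := order_start_flip u le_rfl hl hP (fun l' hl' hs' =>
      hu (by omega) hl (hs'.trans hP.symm))
    have q1 := symm_lt_asymm (σ := prefixPerm u i) hdc
    have q3 := symm_lt_asymm (σ := prefixPerm u i) hde
    have q2 := symm_lt_asymm (σ := prefixPerm u u.length) hdc
    have q4 := symm_lt_asymm (σ := prefixPerm u u.length) hde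
    rw [prefixPerm_length] at p1 p2 q2 q4
    have hcases := Sym2.eq_iff.1 (hT.symm.trans hab)
    rcases hcases with ⟨h1, h2⟩ | ⟨h1, h2⟩
    · subst h1 h2
      exact hcov d (by omega) (by omega) (by omega) (by omega)
    · subst h1 h2
      exact hcov d (by omega) (by omega) (by omega) (by omega)
  intro k l hk hl hkl
  by_contra hne
  wlog hlt : k < l generalizing k l
  · exact this hl hk hkl.symm (Ne.symm hne) (by omega)
  rcases lt_or_ge l i with h1 | h1
  · rw [swapPair_eraseIdx_of_lt u hi (by omega), swapPair_eraseIdx_of_lt u hi h1] at hkl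
    have := hu (by omega) (by omega) hkl
    omega
  rw [swapPair_eraseIdx_of_ge u hi h1] at hkl
  rcases lt_or_ge k i with h2 | h2
  · rw [swapPair_eraseIdx_of_lt u hi h2] at hkl
    exact across k (l + 1) h2 (by omega) (by omega) hkl
  · rw [swapPair_eraseIdx_of_ge u hi h2] at hkl
    have := hu (by omega) (by omega)
      (Sym2.map.injective (letterSwap u i).injective hkl)
    omega

end Erase

/-! ### Fixed point `0` and shifting -/

theorem wordPerm_apply_zero {u : List ℕ} (hu : ∀ x ∈ u, 1 ≤ x) : wordPerm u 0 = 0 := by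
  induction u with
  | nil => rfl
  | cons x u ih =>
    rw [wordPerm_cons, Equiv.Perm.mul_apply, ih fun y hy => hu y (List.mem_cons_of_mem _ hy)]
    have := hu x (by simp)
    exact Equiv.swap_apply_of_ne_of_ne (by omega) (by omega)

theorem prefixPerm_apply_zero {u : List ℕ} {i : ℕ} (hu : ∀ j < i, j < u.length → 1 ≤ u.getD j 0) :
    prefixPerm u i 0 = 0 := by
  apply wordPerm_apply_zero
  intro x hx
  obtain ⟨j, hj, rfl⟩ := List.mem_iff_getElem.1 hx
  rw [List.length_take] at hj
  have := hu j (by omega) (by omega)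
  rw [List.getD_eq_getElem _ _ (by omega)] at this
  simpa using this

theorem zero_notMem_swapPair {u : List ℕ} {i : ℕ}
    (hu : ∀ j ≤ i, 1 ≤ u.getD j 0) : 0 ∉ swapPair u i := by
  have h0 := prefixPerm_apply_zero (u := u) (i := i) (fun j hj _ => hu j hj.le)
  have h1 := hu i le_rfl
  rw [swapPair_eq]
  intro h
  rcases Sym2.mem_iff.1 h with h | h
  · have := (prefixPerm u i).injective (h0.trans h); omega
  · have := (prefixPerm u i).injective (h0.trans h); omega

/-- A single letter `0` cannot create a repeated pair. -/
theorem distinctSwaps_of_zero {u : List ℕ} {i : ℕ} (hi : i < u.length)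
    (hnr : DistinctSwaps (u.eraseIdx i)) (h0 : u.getD i 0 = 0)
    (hpos : ∀ j < u.length, j ≠ i → 1 ≤ u.getD j 0) : DistinctSwaps u := by
  by_contra hc
  obtain ⟨j, hj, hji, hs⟩ := exists_conflict hi hnr hc
  have hz := prefixPerm_apply_zero (u := u) (i := i) (fun j hj h => hpos j h (by omega))
  have hmem : 0 ∈ swapPair u i := by
    rw [swapPair_eq, h0, hz]; simp
  rcases lt_or_gt_of_ne hji with h | h
  · exact zero_notMem_swapPair (fun k hk => hpos k (by omega) (by omega)) (hs ▸ hmem)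
  · have hlen := List.length_eraseIdx_of_lt hi
    have e := swapPair_eraseIdx_of_ge u hi (k := j - 1) (by omega)
    rw [Nat.sub_add_cancel (by omega), hs, map_letterSwap_self] at e
    refine zero_notMem_swapPair (u := u.eraseIdx i) (i := j - 1) (fun k hk => ?_)
      (e ▸ hmem)
    rw [List.getD_eq_getElem _ _ (by omega), List.getElem_eraseIdx]
    split
    · have := hpos k (by omega) (by omega)
      rwa [List.getD_eq_getElem _ _ (by omega)] at this
    · have := hpos (k + 1) (by omega) (by omega)
      rwa [List.getD_eq_getElem _ _ (by omega)] at this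

theorem simpleSwap_shift (x y : ℕ) : simpleSwap (x + 1) (y + 1) = simpleSwap x y + 1 := by
  simp only [simpleSwap, Equiv.swap_apply_def]
  split_ifs <;> omega

theorem wordPerm_shift (u : List ℕ) (y : ℕ) :
    wordPerm (u.map (· + 1)) (y + 1) = wordPerm u y + 1 := by
  induction u with
  | nil => rfl
  | cons x u ih =>
    rw [List.map_cons, wordPerm_cons, wordPerm_cons, Equiv.Perm.mul_apply, ih, simpleSwap_shift]
    rfl

theorem wordPerm_shift_zero (u : List ℕ) : wordPerm (u.map (· + 1)) 0 = 0 :=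
  wordPerm_apply_zero (by simp)

theorem swapPair_shift (u : List ℕ) {l : ℕ} (hl : l < u.length) :
    swapPair (u.map (· + 1)) l = Sym2.map (· + 1) (swapPair u l) := by
  have : (u.map (· + 1)).getD l 0 = u.getD l 0 + 1 := by
    rw [List.getD_eq_getElem _ _ (by simpa using hl), List.getD_eq_getElem _ _ hl]; simp
  rw [swapPair, swapPair, this, ← List.map_take, wordPerm_shift, wordPerm_shift, Sym2.map_mk]

theorem distinctSwaps_shift (u : List ℕ) : DistinctSwaps (u.map (· + 1)) ↔ DistinctSwaps u := by
  have hinj : Function.Injective (fun x : ℕ => x + 1) := fun a b h => by simpa using h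
  constructor
  · intro h i j hi hj hij
    exact h (by simpa using hi) (by simpa using hj)
      (by rw [swapPair_shift u hi, swapPair_shift u hj, hij])
  · intro h i j hi hj hij
    rw [List.length_map] at hi hj
    rw [swapPair_shift u hi, swapPair_shift u hj] at hij
    exact h hi hj (Sym2.map.injective hinj hij)

/-! ### The run of a Little bump -/

/-- Decrease the letter at position `i` by one, without renormalising; the letter may become `0`. -/
def lower (u : List ℕ) (i : ℕ) : List ℕ := u.set i (u.getD i 0 - 1)

@[simp] theorem length_lower (u : List ℕ) (i : ℕ) : (lower u i).length = u.length := by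
  simp [lower]

theorem getD_lower_self {u : List ℕ} {i : ℕ} (hi : i < u.length) :
    (lower u i).getD i 0 = u.getD i 0 - 1 := by
  rw [List.getD_eq_getElem _ _ (by simpa using hi)]; simp [lower]

theorem getD_lower_of_ne (u : List ℕ) {i j : ℕ} (h : j ≠ i) :
    (lower u i).getD j 0 = u.getD j 0 := by
  simp [lower, List.getD_eq_getElem?_getD, List.getElem?_set_ne h.symm]

theorem eraseIdx_lower (u : List ℕ) (i : ℕ) : (lower u i).eraseIdx i = u.eraseIdx i := by
  simp [lower, List.eraseIdx_set_eq]

theorem prefixPerm_lower (u : List ℕ) (i : ℕ) : prefixPerm (lower u i) i = prefixPerm u i := by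
  rw [prefixPerm, lower, List.take_set_of_le (le_refl i)]; rfl

/-- A state of a Little bump just after the letter at position `i` has been lowered: this letter may
be `0`, the others are positive, and deleting it leaves a word with distinct swap pairs. -/
structure Lowered (u : List ℕ) (i : ℕ) : Prop where
  lt : i < u.length
  pos : ∀ j < u.length, j ≠ i → 1 ≤ u.getD j 0
  erase : DistinctSwaps (u.eraseIdx i)

/-- The run of a Little bump, without renormalisation: `BumpRun u i u'` means that, once the letter
at position `i` has just been lowered with result `u`, the bump ends with `u'`. -/
inductive BumpRun : List ℕ → ℕ → List ℕ → Prop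
  | halt (u : List ℕ) (i : ℕ) : DistinctSwaps u → BumpRun u i u
  | step (u : List ℕ) (i j : ℕ) (u' : List ℕ) : j < u.length → j ≠ i →
      swapPair u j = swapPair u i → BumpRun (lower u j) j u' → BumpRun u i u'

theorem not_distinctSwaps_of_conflict {u : List ℕ} {i j : ℕ} (hi : i < u.length)
    (hj : j < u.length) (hji : j ≠ i) (h : swapPair u j = swapPair u i) : ¬ DistinctSwaps u :=
  fun hu => hji (hu hj hi h)

/-- In a state with a repeated pair, all letters are positive. -/
theorem Lowered.pos_of_not_distinct {u : List ℕ} {i : ℕ} (h : Lowered u i)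
    (hu : ¬ DistinctSwaps u) {j : ℕ} (hj : j < u.length) : 1 ≤ u.getD j 0 := by
  by_cases hji : j = i
  · subst hji
    by_contra hc
    exact hu (distinctSwaps_of_zero hj h.erase (by omega) h.pos)
  · exact h.pos j hj hji

theorem Lowered.lower {u : List ℕ} {i : ℕ} (h : Lowered u i) {j : ℕ} (hj : j < u.length)
    (hji : j ≠ i) (hs : swapPair u j = swapPair u i) : Lowered (lower u j) j where
  lt := by simpa using hj
  pos k hk hkj := by
    rw [length_lower] at hk
    rw [getD_lower_of_ne u hkj]
    exact h.pos_of_not_distinct (not_distinctSwaps_of_conflict h.lt hj hji hs) hk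
  erase := by
    rw [eraseIdx_lower]
    exact distinctSwaps_erase_conflict h.lt h.erase hj hs

theorem sum_lower_lt {u : List ℕ} {j : ℕ} (hj : j < u.length) (h : 1 ≤ u.getD j 0) :
    (lower u j).sum < u.sum := by
  have h1 : u.sum = (u.take j).sum + (u.getD j 0 + (u.drop (j + 1)).sum) := by
    conv_lhs => rw [eq_take_cons_drop u hj]
    simp
  have h2 : (lower u j).sum = (u.take j).sum + ((u.getD j 0 - 1) + (u.drop (j + 1)).sum) := by
    rw [lower, List.set_eq_take_append_cons_drop, if_pos hj]
    simp
  omega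

/-- A bump ends: each step lowers the sum of the letters, and once a letter is `0` all pairs are
distinct. -/
theorem Lowered.exists_run {u : List ℕ} {i : ℕ} (h : Lowered u i) : ∃ u', BumpRun u i u' := by
  induction hs : u.sum using Nat.strong_induction_on generalizing u i with
  | _ n ih =>
    by_cases hu : DistinctSwaps u
    · exact ⟨u, .halt u i hu⟩
    · obtain ⟨j, hj, hji, hp⟩ := exists_conflict h.lt h.erase hu
      obtain ⟨u', hu'⟩ := ih _ (hs ▸ sum_lower_lt hj (h.pos_of_not_distinct hu hj))
        (h.lower hj hji hp) rfl
      exact ⟨u', .step u i j u' hj hji hp hu'⟩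

/-- A property that is kept by each step of a bump holds at its end. -/
theorem BumpRun.invariant {I : List ℕ → ℕ → Prop}
    (hI : ∀ u i j, Lowered u i → I u i → j < u.length → j ≠ i → swapPair u j = swapPair u i →
      I (LittleEG.lower u j) j)
    {u : List ℕ} {i : ℕ} {u' : List ℕ} (hr : BumpRun u i u') (h : Lowered u i) (h0 : I u i) :
    ∃ i', Lowered u' i' ∧ DistinctSwaps u' ∧ I u' i' := by
  induction hr with
  | halt u i hu => exact ⟨i, h, hu, h0⟩
  | step u i j u' hj hji hs _ ih => exact ih (h.lower hj hji hs) (hI u i j h h0 hj hji hs)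

/-- The value just above the crossing that is lowered stays the same during a bump: the bump
pushes a single wire downwards. -/
theorem Lowered.wire_step {u : List ℕ} {i j : ℕ} (h : Lowered u i) (hj : j < u.length)
    (hji : j ≠ i) (hs : swapPair u j = swapPair u i) :
    prefixPerm u j (u.getD j 0) = prefixPerm u i (u.getD i 0 + 1) := by
  set q := prefixPerm u i (u.getD i 0) with hq
  set b := prefixPerm u i (u.getD i 0 + 1) with hb
  have hqb : q ≠ b := by rw [hq, hb]; simp
  have hpi : swapPair u i = s(q, b) := rfl
  have hpj : swapPair u j = s(q, b) := hs
  have o1 : (prefixPerm u i).symm q < (prefixPerm u i).symm b := by rw [hq, hb]; simp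
  have hi := h.lt
  have o2 : (prefixPerm u j).symm b < (prefixPerm u j).symm q := by
    rcases lt_or_gt_of_ne hji with hlt | hlt
    · refine (order_flip u (l := j) le_rfl hlt h.lt.le hpj (fun l hl1 hl2 hl3 => ?_)).1 o1
      exact conflict_unique h.lt h.erase (by omega) hj (by omega) hji (hl3.trans hpi.symm) hs
    · refine (order_flip u (l := i) le_rfl hlt hj.le (hpi.trans Sym2.eq_swap)
        (fun l hl1 hl2 hl3 => ?_)).2 o1
      by_contra hne
      have := conflict_unique h.lt h.erase (by omega) hj hne hji
        (hl3.trans (Sym2.eq_swap.trans hpi.symm)) hs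
      omega
  rw [swapPair_eq, Sym2.eq_iff] at hpj
  rcases hpj with ⟨h1, h2⟩ | ⟨h1, h2⟩
  · rw [← h1, ← h2] at o2
    simp at o2
  · exact h1

theorem Lowered.wire_lower {u : List ℕ} {i j b : ℕ} (h : Lowered u i)
    (hb : prefixPerm u i (u.getD i 0 + 1) = b) (hj : j < u.length)
    (hji : j ≠ i) (hs : swapPair u j = swapPair u i) :
    prefixPerm (LittleEG.lower u j) j ((LittleEG.lower u j).getD j 0 + 1) = b := by
  rw [prefixPerm_lower, getD_lower_self hj, Nat.sub_add_cancel (h.pos j hj hji),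
    h.wire_step hj hji hs, hb]

/-! ### Bumps preserve the descents of a word -/

/-- `u` and `v` have the same length and the same pattern of ascents and descents. -/
def SameDescents (u v : List ℕ) : Prop :=
  u.length = v.length ∧ ∀ l, l + 1 < u.length →
    (u.getD l 0 < u.getD (l + 1) 0 ↔ v.getD l 0 < v.getD (l + 1) 0) ∧
    (u.getD (l + 1) 0 < u.getD l 0 ↔ v.getD (l + 1) 0 < v.getD l 0)

theorem SameDescents.refl (u : List ℕ) : SameDescents u u := ⟨rfl, fun _ _ => ⟨Iff.rfl, Iff.rfl⟩⟩

theorem SameDescents.trans {u v w : List ℕ} (h1 : SameDescents u v) (h2 : SameDescents v w) :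
    SameDescents u w :=
  ⟨h1.1.trans h2.1, fun l hl => ⟨(h1.2 l hl).1.trans (h2.2 l (h1.1 ▸ hl)).1,
    (h1.2 l hl).2.trans (h2.2 l (h1.1 ▸ hl)).2⟩⟩

theorem swapPair_succ_of_eq (u : List ℕ) {l : ℕ} (hl : l + 1 < u.length)
    (h : u.getD (l + 1) 0 = u.getD l 0) : swapPair u (l + 1) = swapPair u l := by
  rw [swapPair_eq, swapPair_eq, h, prefixPerm_succ u (by omega)]
  simp [simpleSwap, Sym2.eq_swap]

theorem DistinctSwaps.getD_succ_ne {u : List ℕ} (hu : DistinctSwaps u) {l : ℕ}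
    (hl : l + 1 < u.length) : u.getD (l + 1) 0 ≠ u.getD l 0 := fun h => by
  have := hu hl (by omega) (swapPair_succ_of_eq u hl h)
  omega

/-- During a bump, the pattern of ascents and descents of `w` is kept, except that the letter just
lowered may have become equal to a neighbour. -/
def NearDescents (w u : List ℕ) (i : ℕ) : Prop :=
  w.length = u.length ∧ ∀ l, l + 1 < w.length →
    (w.getD l 0 < w.getD (l + 1) 0 → u.getD l 0 < u.getD (l + 1) 0 ∨
      (u.getD (l + 1) 0 = u.getD l 0 ∧ i = l + 1)) ∧
    (w.getD (l + 1) 0 < w.getD l 0 → u.getD (l + 1) 0 < u.getD l 0 ∨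
      (u.getD (l + 1) 0 = u.getD l 0 ∧ i = l))

theorem getD_lower (u : List ℕ) (i j : ℕ) :
    (lower u i).getD j 0 = if j = i then u.getD j 0 - 1 else u.getD j 0 := by
  split_ifs with h
  · subst h
    by_cases hj : j < u.length
    · exact getD_lower_self hj
    · rw [List.getD_eq_default _ _ (by simp; omega), List.getD_eq_default _ _ (by omega)]
  · exact getD_lower_of_ne u h

theorem NearDescents.step {w u : List ℕ} {i j : ℕ} (h : Lowered u i) (hw : NearDescents w u i)
    (hj : j < u.length) (hji : j ≠ i) (hs : swapPair u j = swapPair u i) :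
    NearDescents w (lower u j) j := by
  refine ⟨by simpa using hw.1, fun l hl => ?_⟩
  have hl' : l + 1 < u.length := hw.1 ▸ hl
  have hpos := h.pos j hj hji
  have hadj : u.getD (l + 1) 0 = u.getD l 0 → (i = l → j = l + 1) ∧ (i = l + 1 → j = l) := by
    intro he
    have hp := swapPair_succ_of_eq u hl' he
    constructor
    · rintro rfl
      exact conflict_unique h.lt h.erase hj hl' hji (by omega) hs hp
    · rintro rfl
      exact conflict_unique h.lt h.erase hj (by omega) hji (by omega) hs hp.symm
  obtain ⟨h1, h2⟩ := hw.2 l hl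
  simp only [getD_lower]
  constructor
  · intro hlt
    rcases h1 hlt with h3 | ⟨h3, h4⟩
    · split_ifs <;> omega
    · have := (hadj h3).2 h4
      subst this
      split_ifs <;> omega
  · intro hlt
    rcases h2 hlt with h3 | ⟨h3, h4⟩
    · split_ifs <;> omega
    · have := (hadj h3).1 h4
      subst this
      split_ifs <;> omega

theorem NearDescents.sameDescents {w u : List ℕ} {i : ℕ} (hw : DistinctSwaps w)
    (hu : DistinctSwaps u) (h : NearDescents w u i) : SameDescents w u := by
  refine ⟨h.1, fun l hl => ?_⟩
  have h1 := hw.getD_succ_ne hl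
  have h2 := hu.getD_succ_ne (h.1 ▸ hl)
  have := h.2 l hl
  omega

/-! ### Bump runs compute `littleBump` -/

/-- Raise all letters by one if the letter `0` occurs. -/
def normalize (u : List ℕ) : List ℕ := if 0 ∈ u then u.map (· + 1) else u

theorem normalize_pos (u : List ℕ) : ∀ x ∈ normalize u, 1 ≤ x := by
  unfold normalize
  split_ifs with h
  · simp
  · intro x hx
    exact Nat.one_le_iff_ne_zero.2 fun h0 => h (h0 ▸ hx)

theorem distinctSwaps_normalize (u : List ℕ) : DistinctSwaps (normalize u) ↔ DistinctSwaps u := by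
  unfold normalize
  split_ifs
  · exact distinctSwaps_shift u
  · rfl

theorem sameDescents_normalize (u : List ℕ) : SameDescents u (normalize u) := by
  unfold normalize
  split_ifs
  · refine ⟨by simp, fun l hl => ?_⟩
    rw [List.getD_eq_getElem _ _ hl, List.getD_eq_getElem _ _ (by omega),
      List.getD_eq_getElem _ _ (by rw [List.length_map]; omega),
      List.getD_eq_getElem _ _ (by rw [List.length_map]; omega)]
    simp
  · exact .refl u

theorem decrementAt_eq {w : List ℕ} {i : ℕ} (hi : i < w.length) (hw : ∀ x ∈ w, 1 ≤ x) :
    decrementAt w i = normalize (lower w i) := by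
  have h1 : 1 ≤ w.getD i 0 := by
    rw [List.getD_eq_getElem _ _ hi]; exact hw _ (List.getElem_mem hi)
  unfold decrementAt normalize
  by_cases h : 1 < w.getD i 0
  · rw [if_pos h, if_neg]
    · rfl
    · intro h0
      rcases List.mem_or_eq_of_mem_set h0 with h0 | h0
      · exact absurd (hw 0 h0) (by omega)
      · omega
  · have h2 : w.getD i 0 = 1 := by omega
    rw [if_neg h, if_pos]
    · rw [lower, List.map_set, h2]
    · have : (lower w i).getD i 0 = 0 := by rw [getD_lower_self hi, h2]
      rw [List.getD_eq_getElem _ _ (by simpa using hi)] at this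
      rw [← this]
      exact List.getElem_mem _

theorem getD_pos {w : List ℕ} (hw : ∀ x ∈ w, 1 ≤ x) {i : ℕ} (hi : i < w.length) :
    1 ≤ w.getD i 0 := by
  rw [List.getD_eq_getElem _ _ hi]; exact hw _ (List.getElem_mem hi)

theorem pos_of_getD {w : List ℕ} (hw : ∀ i < w.length, 1 ≤ w.getD i 0) : ∀ x ∈ w, 1 ≤ x := by
  intro x hx
  obtain ⟨i, hi, rfl⟩ := List.mem_iff_getElem.1 hx
  have := hw i hi
  rwa [List.getD_eq_getElem _ _ hi] at this

theorem normalize_of_pos {u : List ℕ} (hu : ∀ x ∈ u, 1 ≤ x) : normalize u = u :=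
  if_neg fun h => absurd (hu 0 h) (by omega)

theorem lowered_lower {w : List ℕ} {i : ℕ} (hi : i < w.length) (hw : ∀ x ∈ w, 1 ≤ x)
    (h : DistinctSwaps (w.eraseIdx i)) : Lowered (lower w i) i where
  lt := by simpa using hi
  pos j hj hji := by
    rw [getD_lower_of_ne w hji]; exact getD_pos hw (by simpa using hj)
  erase := by rwa [eraseIdx_lower]

theorem conflict_eq {u : List ℕ} {i j : ℕ} (h : Lowered u i) (hj : j < u.length) (hji : j ≠ i)
    (hs : swapPair u j = swapPair u i) : conflict u i = some j := by
  have hsome : (conflict u i).isSome := by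
    rw [conflict, List.find?_isSome]
    exact ⟨j, by simpa using hj, by simpa using ⟨hji, hs⟩⟩
  obtain ⟨k, hk⟩ := Option.isSome_iff_exists.1 hsome
  have h1 := List.mem_of_find?_eq_some hk
  have h2 := List.find?_some hk
  simp only [List.mem_range, decide_eq_true_eq] at h1 h2
  rw [hk, conflict_unique h.lt h.erase h1 hj h2.1 hji h2.2 hs]

theorem littleBump_eq {u : List ℕ} {i : ℕ} {u' : List ℕ} (hr : BumpRun u i u') :
    ∀ w : List ℕ, lower w i = u → i < w.length → (∀ x ∈ w, 1 ≤ x) →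
      DistinctSwaps (w.eraseIdx i) → littleBump w i = Part.some (normalize u') := by
  induction hr with
  | halt u i hu =>
    rintro w rfl hi hw he
    refine Part.eq_some_iff.2 (PFun.fix_stop ?_)
    simp only [bumpStep]
    rw [if_pos]
    · rw [decrementAt_eq hi hw]; exact Part.mem_some _
    · rw [decrementAt_eq hi hw, isReduced_iff (normalize_pos _), distinctSwaps_normalize]
      exact hu
  | step u i j u' hj hji hs _ ih =>
    rintro w rfl hi hw he
    have hL := lowered_lower hi hw he
    have hnd := not_distinctSwaps_of_conflict hL.lt hj hji hs
    have hpos : ∀ x ∈ lower w i, 1 ≤ x := pos_of_getD fun k hk => hL.pos_of_not_distinct hnd hk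
    have hdec : decrementAt w i = lower w i := by
      rw [decrementAt_eq hi hw, normalize_of_pos hpos]
    rw [← ih (lower w i) rfl hj hpos (distinctSwaps_erase_conflict hL.lt hL.erase hj hs)]
    refine PFun.fix_fwd_eq ?_
    simp only [bumpStep]
    rw [if_neg]
    · rw [hdec, conflict_eq hL hj hji hs]
      simp
    · rwa [hdec, isReduced_iff hpos]

/-! ### One step of the Little map -/

theorem swapLocation_eq {w : List ℕ} (hw : DistinctSwaps w) {i a b : ℕ} (hi : i < w.length)
    (h : swapPair w i = s(a, b)) : swapLocation w a b = some i := by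
  have hsome : (swapLocation w a b).isSome := by
    rw [swapLocation, List.find?_isSome]
    exact ⟨i, by simpa using hi, by simpa using h⟩
  obtain ⟨k, hk⟩ := Option.isSome_iff_exists.1 hsome
  have h1 := List.mem_of_find?_eq_some hk
  have h2 := List.find?_some hk
  simp only [List.mem_range, decide_eq_true_eq] at h1 h2
  rw [hk, hw h1 hi (h2.trans h.symm)]

theorem isLastInversion_iff {σ : Equiv.Perm ℕ} {r s : ℕ} : IsLastInversion σ (r, s) ↔
    r < s ∧ σ s < σ r ∧ ∀ i j, i < j → σ j < σ i → i < r ∨ i = r ∧ j ≤ s := by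
  unfold IsLastInversion IsInversion
  simp only [Prod.forall, Prod.Lex.toLex_le_toLex, and_imp, and_assoc]

theorem exists_fixed_above (w : List ℕ) : ∃ N, ∀ x, N ≤ x → wordPerm w x = x := by
  induction w with
  | nil => exact ⟨0, fun _ _ => rfl⟩
  | cons y w ih =>
    obtain ⟨N, hN⟩ := ih
    refine ⟨max N (y + 2), fun x hx => ?_⟩
    rw [wordPerm_cons, Equiv.Perm.mul_apply, hN x (by omega)]
    exact Equiv.swap_apply_of_ne_of_ne (by omega) (by omega)

theorem exists_isLastInversion (w : List ℕ) {i j : ℕ} (hij : i < j)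
    (h : wordPerm w j < wordPerm w i) : ∃ r s, IsLastInversion (wordPerm w) (r, s) := by
  obtain ⟨N, hN⟩ := exists_fixed_above w
  have hb : ∀ i j, i < j → wordPerm w j < wordPerm w i → j < N := by
    intro i j hij h
    by_contra hc
    rw [hN j (by omega)] at h
    have := (wordPerm w).injective (hN (wordPerm w i) (by omega))
    omega
  obtain ⟨⟨r, s⟩, hrs, hmax⟩ := Finset.exists_max_image
    ((Finset.range N ×ˢ Finset.range N).filter
      (fun p => p.1 < p.2 ∧ wordPerm w p.2 < wordPerm w p.1)) toLex
    ⟨(i, j), by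
      have := hb i j hij h
      simp only [Finset.mem_filter, Finset.mem_product, Finset.mem_range]
      omega⟩
  simp only [Finset.mem_filter, Finset.mem_product, Finset.mem_range, Prod.forall,
    Prod.Lex.toLex_le_toLex] at hrs hmax
  refine ⟨r, s, isLastInversion_iff.2 ⟨hrs.2.1, hrs.2.2, fun i j hij h => ?_⟩⟩
  have := hb i j hij h
  exact hmax i j ⟨⟨by omega, by omega⟩, hij, h⟩

theorem IsLastInversion.unique {σ : Equiv.Perm ℕ} {p q : ℕ × ℕ} (hp : IsLastInversion σ p)
    (hq : IsLastInversion σ q) : p = q :=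
  toLex.injective (le_antisymm (hq.2 p hp.1) (hp.2 q hq.1))

theorem lastInversionLocation_eq {w : List ℕ} {r s : ℕ}
    (h : IsLastInversion (wordPerm w) (r, s)) :
    lastInversionLocation w = swapLocation w (wordPerm w r) (wordPerm w s) := by
  have hex : ∃ p, IsLastInversion (wordPerm w) p := ⟨_, h⟩
  rw [lastInversionLocation, dif_pos hex, hex.choose_spec.unique h]

/-- `i` is the swap location of the last inversion of the permutation of `w`. -/
def IsBumpStart (w : List ℕ) (i : ℕ) : Prop :=
  i < w.length ∧ ∃ r s, IsLastInversion (wordPerm w) (r, s) ∧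
    swapPair w i = s(wordPerm w r, wordPerm w s)

/-- Words in positive letters with distinct swap pairs, that is, reduced words. -/
structure PosDistinct (w : List ℕ) : Prop where
  pos : ∀ x ∈ w, 1 ≤ x
  distinct : DistinctSwaps w

theorem IsBumpStart.erase {w : List ℕ} (hw : DistinctSwaps w) {i : ℕ} (h : IsBumpStart w i) :
    DistinctSwaps (w.eraseIdx i) := by
  obtain ⟨hi, r, s, hrs, hp⟩ := h
  obtain ⟨h1, h2, h3⟩ := isLastInversion_iff.1 hrs
  refine hw.eraseIdx_of_cover hi hp h2 (fun d hd1 _ hd3 hd4 => ?_)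
  rw [Equiv.symm_apply_apply] at hd3 hd4
  have := h3 _ s hd4 (by rwa [Equiv.apply_symm_apply])
  omega

theorem PosDistinct.exists_isBumpStart {w : List ℕ} (hw : PosDistinct w) (hne : w ≠ []) :
    ∃ i, IsBumpStart w i := by
  obtain ⟨a, b, hab, hs⟩ := exists_swapPair w 0
  have hinv := hw.distinct.inverted (List.length_pos_iff.2 hne) hab hs
  obtain ⟨r, s, hrs⟩ := exists_isLastInversion w hinv (by simpa using hab)
  obtain ⟨h1, h2, -⟩ := isLastInversion_iff.1 hrs
  obtain ⟨i, hi, hp⟩ := exists_swapPair_of_inverted w h2 (by simpa using h1)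
  exact ⟨i, hi, r, s, hrs, hp.trans Sym2.eq_swap⟩

/-- A step of the Little map, from a word that is not Grassmannian. -/
def LittleNext (w w' : List ℕ) : Prop :=
  ¬ IsGrassmannian (wordPerm w) ∧
    ∃ i u', IsBumpStart w i ∧ BumpRun (lower w i) i u' ∧ w' = normalize u'

theorem LittleNext.littleMap_eq {w w' : List ℕ} (hw : PosDistinct w) (h : LittleNext w w') :
    littleMap w = littleMap w' := by
  obtain ⟨hg, i, u', hi, hr, rfl⟩ := h
  refine PFun.fix_fwd_eq ?_
  have hne : w ≠ [] := by
    rintro rfl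
    exact absurd hi.1 (by simp)
  rw [littleStep, if_neg hne, dif_neg hg]
  obtain ⟨hlt, r, s, hrs, hp⟩ := id hi
  rw [lastInversionLocation_eq hrs, swapLocation_eq hw.distinct hlt hp,
    Part.coe_some, Part.bind_some, littleBump_eq hr w rfl hlt hw.pos (hi.erase hw.distinct)]
  simp

theorem exists_littleNext {w : List ℕ} (hw : PosDistinct w) (hne : w ≠ [])
    (hg : ¬ IsGrassmannian (wordPerm w)) : ∃ w', LittleNext w w' := by
  obtain ⟨i, hi⟩ := hw.exists_isBumpStart hne
  obtain ⟨u', hu'⟩ := (lowered_lower hi.1 hw.pos (hi.erase hw.distinct)).exists_run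
  exact ⟨_, hg, i, u', hi, hu', rfl⟩

/-- What is known about the result of a bump, before renormalisation. -/
theorem bumpRun_result {w : List ℕ} (hw : PosDistinct w) {i : ℕ} (hi : i < w.length)
    (he : DistinctSwaps (w.eraseIdx i)) {u' : List ℕ} (hr : BumpRun (lower w i) i u') :
    ∃ i', Lowered u' i' ∧ DistinctSwaps u' ∧ NearDescents w u' i' ∧
      wordPerm (u'.eraseIdx i') = wordPerm (w.eraseIdx i) ∧
      prefixPerm u' i' (u'.getD i' 0 + 1) = prefixPerm w i (w.getD i 0) := by
  have hpos := getD_pos hw.pos hi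
  refine hr.invariant (I := fun u j => NearDescents w u j ∧
      wordPerm (u.eraseIdx j) = wordPerm (w.eraseIdx i) ∧
      prefixPerm u j (u.getD j 0 + 1) = prefixPerm w i (w.getD i 0)) ?_
    (lowered_lower hi hw.pos he) ⟨⟨by simp, fun l hl => ?_⟩, ?_, ?_⟩
  · rintro u k j hL ⟨h1, h2, h3⟩ hj hji hs
    refine ⟨h1.step hL hj hji hs, ?_, hL.wire_lower h3 hj hji hs⟩
    rw [eraseIdx_lower, wordPerm_eraseIdx u hj, letterSwap_eq_of_swapPair hs,
      ← wordPerm_eraseIdx u hL.lt, h2]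
  · simp only [getD_lower]
    split_ifs <;> omega
  · rw [eraseIdx_lower]
  · rw [prefixPerm_lower, getD_lower_self hi, Nat.sub_add_cancel hpos]

theorem LittleNext.sameDescents {w w' : List ℕ} (hw : PosDistinct w) (h : LittleNext w w') :
    PosDistinct w' ∧ SameDescents w w' := by
  obtain ⟨hg, i, u', hi, hr, rfl⟩ := h
  obtain ⟨i', hL, hd, hn, -, -⟩ := bumpRun_result hw hi.1 (hi.erase hw.distinct) hr
  exact ⟨⟨normalize_pos u', (distinctSwaps_normalize u').2 hd⟩,
    (hn.sameDescents hw.distinct hd).trans (sameDescents_normalize u')⟩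

/-! ### The Little map terminates -/

/-- At the end of a bump the pushed wire `b` crosses a smaller value `q`, and no intermediate value
stands between them. -/
theorem Lowered.exists_cover {u : List ℕ} {i b : ℕ} (h : Lowered u i) (hu : DistinctSwaps u)
    (hb : prefixPerm u i (u.getD i 0 + 1) = b) : ∃ q < b,
      wordPerm u = Equiv.swap q b * wordPerm (u.eraseIdx i) ∧
      (wordPerm (u.eraseIdx i)).symm q < (wordPerm (u.eraseIdx i)).symm b ∧
      ∀ c, q < c → c < b →
        (wordPerm (u.eraseIdx i)).symm q < (wordPerm (u.eraseIdx i)).symm c →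
        (wordPerm (u.eraseIdx i)).symm c < (wordPerm (u.eraseIdx i)).symm b → False := by
  have hlen := List.length_eraseIdx_of_lt h.lt
  have hi := h.lt
  set q := prefixPerm u i (u.getD i 0) with hq
  have hqb' : q ≠ b := by rw [hq, ← hb]; simp
  have hp : swapPair u i = s(q, b) := by rw [swapPair_eq, hb]
  have hqb : q < b := by
    rw [← order_start u h.lt.le (fun l hl hs => ?_)]
    · rw [hq, ← hb]; simp
    · have := hu (by omega) h.lt (hs.trans hp.symm)
      omega
  have hlS := letterSwap_eq hp
  have hperm : wordPerm u = Equiv.swap q b * wordPerm (u.eraseIdx i) := by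
    rw [wordPerm_eraseIdx u h.lt, ← hlS, ← mul_assoc]; simp
  refine ⟨q, hqb, hperm, ?_, fun c hqc hcb h1 h2 => ?_⟩
  · by_contra hc
    rw [← symm_lt_asymm hqb'] at hc
    obtain ⟨l, hl, hs⟩ := exists_swapPair_of_inverted _ hqb hc
    rcases lt_or_ge l i with hli | hli
    · rw [swapPair_eraseIdx_of_lt u h.lt hli] at hs
      have := hu (by omega) h.lt (hs.trans hp.symm)
      omega
    · rw [swapPair_eraseIdx_of_ge u h.lt hli] at hs
      have hs' := congrArg (Sym2.map (letterSwap u i)) hs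
      rw [map_letterSwap_map, ← hp, map_letterSwap_self] at hs'
      have := hu (by omega) h.lt hs'
      omega
  · have hsymm : ∀ x, (wordPerm u).symm x =
        (wordPerm (u.eraseIdx i)).symm (Equiv.swap q b x) := by
      intro x
      rw [hperm, ← Equiv.Perm.inv_def, mul_inv_rev, Equiv.swap_inv]; rfl
    have hswc : Equiv.swap q b c = c := Equiv.swap_apply_of_ne_of_ne hqc.ne' hcb.ne
    obtain ⟨l, hl, hs⟩ := exists_swapPair_of_inverted u hcb (by
      rw [hsymm, hsymm, hswc, Equiv.swap_apply_right]; exact h1)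
    have hli : l ≠ i := by
      rintro rfl
      rw [hp, Sym2.eq_iff] at hs
      omega
    rcases lt_or_gt_of_ne hli with hli | hli
    · have := h.erase.inverted (l := l) (by omega) hcb
        (by rw [swapPair_eraseIdx_of_lt u h.lt hli, hs])
      omega
    · have := h.erase.inverted (l := l - 1) (by omega) hqc (by
        rw [swapPair_eraseIdx_of_ge u h.lt (by omega), Nat.sub_add_cancel (by omega), hs, hlS,
          Sym2.map_mk, hswc, Equiv.swap_apply_right, Sym2.eq_swap])
      omega

/-- Effect of a bump on one-line notation, with respect to its last inversion `(r, s)`: besides the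
places `r`, `s`, only one place `q < r` is affected. -/
theorem LittleNext.exists_perm {w w' : List ℕ} (hw : PosDistinct w) (h : LittleNext w w') :
    ∃ u' r s q, w' = normalize u' ∧ IsLastInversion (wordPerm w) (r, s) ∧ q < r ∧
      wordPerm w q < wordPerm w s ∧
      (∀ x, q < x → x < r → wordPerm w q < wordPerm w x → wordPerm w x < wordPerm w s → False) ∧
      ∀ x, wordPerm u' x = if x = r then wordPerm w q else if x = q then wordPerm w s
        else if x = s then wordPerm w r else wordPerm w x := by
  obtain ⟨hg, i, u', hi, hr, rfl⟩ := h
  obtain ⟨i', hL, hd, -, hperm, hwire⟩ := bumpRun_result hw hi.1 (hi.erase hw.distinct) hr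
  obtain ⟨hlt, r, s, hrs, hp⟩ := hi
  obtain ⟨h1, h2, h3⟩ := isLastInversion_iff.1 hrs
  set σ := wordPerm w with hσ
  -- the wire pushed down is that of the smaller value `σ s`
  have hb : prefixPerm w i (w.getD i 0) = σ s := by
    have o := order_start w hlt.le (fun l hl hs => by
      have := hw.distinct (by omega) hlt (hs.trans hp.symm)
      omega)
    have hp' := hp
    rw [swapPair_eq, Sym2.eq_iff] at hp'
    rcases hp' with ⟨h4, h5⟩ | ⟨h4, -⟩
    · rw [← h4, ← h5] at o h2
      simp only [Equiv.symm_apply_apply] at o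
      omega
    · exact h4
  obtain ⟨q, hqb, hτ, hqpos, hcov⟩ := hL.exists_cover hd (hwire.trans hb)
  rw [hperm, wordPerm_eraseIdx w hlt, letterSwap_eq hp] at hτ hqpos hcov
  have hsymm : ∀ x, (Equiv.swap (σ r) (σ s) * σ).symm x = σ.symm (Equiv.swap (σ r) (σ s) x) := by
    intro x
    rw [← Equiv.Perm.inv_def, mul_inv_rev, Equiv.swap_inv]; rfl
  simp only [← hσ, hsymm] at hqpos hcov
  rw [Equiv.swap_apply_right, Equiv.symm_apply_apply] at hqpos hcov
  have hq1 : q ≠ σ r := by omega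
  have hq2 : q ≠ σ s := by omega
  rw [Equiv.swap_apply_of_ne_of_ne hq1 hq2] at hqpos hcov
  refine ⟨u', r, s, σ.symm q, rfl, hrs, hqpos, by simpa using hqb, fun x hx1 hx2 hx3 hx4 => ?_,
    fun x => ?_⟩
  · rw [Equiv.apply_symm_apply] at hx3
    have hx5 : σ x ≠ σ r := by simpa using hx2.ne
    refine hcov (σ x) hx3 hx4 ?_ ?_
    · rw [Equiv.swap_apply_of_ne_of_ne hx5 hx4.ne]; simpa using hx1
    · rw [Equiv.swap_apply_of_ne_of_ne hx5 hx4.ne]; simpa using hx2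
  · rw [hτ, Equiv.Perm.mul_apply, Equiv.Perm.mul_apply, ← hσ]
    split_ifs with hx1 hx2 hx3
    · rw [hx1, Equiv.swap_apply_left, Equiv.swap_apply_right, Equiv.apply_symm_apply]
    · rw [hx2, Equiv.apply_symm_apply, Equiv.swap_apply_of_ne_of_ne hq1 hq2,
        Equiv.swap_apply_left]
    · rw [hx3, Equiv.swap_apply_right, Equiv.swap_apply_of_ne_of_ne hq1.symm h2.ne']
    · have e1 : σ x ≠ σ r := by simpa using hx1
      have e2 : σ x ≠ σ s := by simpa using hx3
      have e3 : σ x ≠ q := fun h => hx2 (by rw [← h, Equiv.symm_apply_apply])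
      rw [Equiv.swap_apply_of_ne_of_ne e1 e2, Equiv.swap_apply_of_ne_of_ne e3 e2]

/-- All descents of `σ` lie between `f` and `f + n`, and only the `c` places after `f + n` can hold
values below the value at `f + n`. -/
def DescentBound (σ : Equiv.Perm ℕ) (f n c : ℕ) : Prop :=
  (∀ d, IsDescent σ d → f ≤ d ∧ d ≤ f + n) ∧ ∀ j, f + n + c < j → σ (f + n) < σ j

theorem exists_isDescent {σ : Equiv.Perm ℕ} {i j : ℕ} (hij : i < j) (h : σ j < σ i) :
    ∃ d, i ≤ d ∧ d < j ∧ IsDescent σ d := by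
  by_contra! hc
  have : ∀ k, i ≤ k → k ≤ j → σ i ≤ σ k := by
    intro k hk
    induction k, hk using Nat.le_induction with
    | base => simp
    | succ k hk ih =>
      intro hkj
      have := hc k hk (by omega)
      unfold IsDescent at this
      have := ih (by omega)
      omega
  have := this j hij.le le_rfl
  omega

/-- One step of the Little map, for a permutation whose last inversion is `(f + n, s)`. -/
theorem DescentBound.step {w u' : List ℕ} {f n s q : ℕ}
    (hrs : IsLastInversion (wordPerm w) (f + n, s)) (hf : ∀ d, IsDescent (wordPerm w) d → f ≤ d)
    (hn : 0 < n) (hq : q < f + n) (hqs : wordPerm w q < wordPerm w s)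
    (hcov : ∀ x, q < x → x < f + n → wordPerm w q < wordPerm w x →
      wordPerm w x < wordPerm w s → False)
    (hu' : ∀ x, wordPerm u' x = if x = f + n then wordPerm w q else if x = q then wordPerm w s
        else if x = s then wordPerm w (f + n) else wordPerm w x) :
    DescentBound (wordPerm u') f n (s - (f + n) - 1) := by
  obtain ⟨h1, h2, h3⟩ := isLastInversion_iff.1 hrs
  set σ := wordPerm w
  have hinj : ∀ x y, σ x = σ y → x = y := fun x y h => σ.injective h
  refine ⟨fun d hd => ?_, fun j hj => ?_⟩
  · unfold IsDescent at hd hf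
    rw [hu', hu'] at hd
    constructor
    · by_contra hlt
      have e1 := hf d
      have e2 : ¬ (q < d + 1 ∧ d + 1 < f + n ∧ σ q < σ (d + 1) ∧ σ (d + 1) < σ s) :=
        fun h => hcov _ h.1 h.2.1 h.2.2.1 h.2.2.2
      have e3 := hinj (d + 1) s
      have e4 := hinj d (d + 1)
      by_cases hdq : d = q
      · subst hdq
        split_ifs at hd <;> omega
      · by_cases hdq' : d + 1 = q
        · subst hdq'
          split_ifs at hd <;> omega
        · split_ifs at hd <;> omega
    · by_contra hlt
      have e1 := h3 d (d + 1) (by omega)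
      have e2 := h3 (f + n) (d + 1) (by omega)
      have e3 := h3 d s
      have e4 := hinj (f + n) (d + 1)
      by_cases hds : d = s
      · subst hds
        split_ifs at hd <;> omega
      · by_cases hds' : d + 1 = s
        · subst hds'
          split_ifs at hd <;> omega
        · split_ifs at hd <;> omega
  · rw [hu', hu', if_pos rfl, if_neg (by omega), if_neg (by omega)]
    split_ifs with hjs
    · omega
    · have e1 := h3 (f + n) j (by omega)
      have e2 := hinj (f + n) j
      omega

theorem DescentBound.normalize {u : List ℕ} {f n c : ℕ} (h : DescentBound (wordPerm u) f n c) :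
    ∃ f', DescentBound (wordPerm (normalize u)) f' n c := by
  unfold LittleEG.normalize
  split_ifs
  · refine ⟨f + 1, fun d hd => ?_, fun j hj => ?_⟩
    · unfold IsDescent at hd
      cases d with
      | zero => rw [wordPerm_shift_zero] at hd; omega
      | succ d =>
        rw [wordPerm_shift, wordPerm_shift] at hd
        have := h.1 d (by unfold IsDescent; omega)
        omega
    · obtain ⟨j, rfl⟩ : ∃ k, j = k + 1 := ⟨j - 1, by omega⟩
      rw [show f + 1 + n = f + n + 1 by omega, wordPerm_shift, wordPerm_shift]
      have := h.2 j (by omega)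
      omega
  · exact ⟨f, h⟩

/-- Induction on the distance `n` from a lower bound `f` of the descents to the last descent and, for
fixed `n`, on the number `c` of places after it that may hold smaller values: a step of the Little
map lowers `c` as long as the last descent stays at the same place. -/
theorem exists_littleChain_of_bound (n : ℕ) : ∀ (c f : ℕ) (w : List ℕ), PosDistinct w → w ≠ [] →
    DescentBound (wordPerm w) f n c →
    ∃ g, Relation.ReflTransGen LittleNext w g ∧ IsGrassmannian (wordPerm g) := by
  induction n using Nat.strong_induction_on with
  | _ n ihn =>
    intro c
    induction c using Nat.strong_induction_on with
    | _ c ihc =>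
      intro f w hw hne hb
      by_cases hg : IsGrassmannian (wordPerm w)
      · exact ⟨w, .refl, hg⟩
      obtain ⟨w', hw'⟩ := exists_littleNext hw hne hg
      obtain ⟨u', r, s, q, hu', hrs, hqr, hqs, hcov, hperm⟩ := hw'.exists_perm hw
      obtain ⟨h1, h2, h3⟩ := isLastInversion_iff.1 hrs
      obtain ⟨d, hd1, -, hd⟩ := exists_isDescent h1 h2
      have hle : ∀ d, IsDescent (wordPerm w) d → d ≤ r := fun d hd => by
        have := h3 d (d + 1) (by omega) hd
        omega
      have hdr : d = r := le_antisymm (hle d hd) hd1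
      subst hdr
      have hbd := hb.1 d hd
      -- the last inversion starts at the last descent `d`
      by_cases hdn : d = f + n
      · subst hdn
        have hn : 0 < n := by
          by_contra hn
          have : n = 0 := by omega
          subst this
          refine hg ⟨f + 0, hd, fun d' hd' => ?_⟩
          have := hb.1 d' hd'
          omega
        have hs : s ≤ f + n + c := by
          by_contra hs
          have := hb.2 s (by omega)
          omega
        obtain ⟨f', hf'⟩ := (DescentBound.step hrs (fun d hd => (hb.1 d hd).1) hn hqr hqs hcov
          hperm).normalize
        have hsd := hw'.sameDescents hw
        rw [← hu'] at hf'
        obtain ⟨g, hg1, hg2⟩ := ihc _ (by omega) f' w' hsd.1 (by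
          rintro rfl
          exact hne (List.length_eq_zero_iff.1 hsd.2.1)) hf'
        exact ⟨g, .head hw' hg1, hg2⟩
      · refine ihn (d - f) (by omega) s f w hw hne ⟨fun d' hd' => ?_, fun j hj => ?_⟩
        · have := hb.1 d' hd'
          have := hle d' hd'
          omega
        · rw [Nat.add_sub_cancel' hbd.1] at hj ⊢
          by_contra hc
          have hne' : wordPerm w j ≠ wordPerm w d := fun h => by
            have := (wordPerm w).injective h
            omega
          have := h3 d j (by omega) (by omega)
          omega

/-- Repeating the steps of the Little map, one reaches a Grassmannian word. -/
theorem exists_littleChain {w : List ℕ} (hw : PosDistinct w) (hne : w ≠ []) :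
    ∃ g, Relation.ReflTransGen LittleNext w g ∧ IsGrassmannian (wordPerm g) := by
  obtain ⟨N, hN⟩ := exists_fixed_above w
  refine exists_littleChain_of_bound N (wordPerm w N) 0 w hw hne ⟨fun d hd => ⟨by omega, ?_⟩,
    fun j hj => ?_⟩
  · by_contra hc
    unfold IsDescent at hd
    rw [hN d (by omega), hN (d + 1) (by omega)] at hd
    omega
  · rw [Nat.zero_add] at hj ⊢
    rw [hN j (by omega)]; omega

/-! ### Coxeter–Knuth moves -/

/-- The elementary Coxeter–Knuth moves on three adjacent letters, in one chosen direction.  The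
last argument tells to which place each of the three crossings is moved. -/
inductive KnuthTriple : List ℕ → List ℕ → Equiv.Perm ℕ → Prop
  | swap_left (a b c : ℕ) : a < b → b < c → KnuthTriple [a, c, b] [c, a, b] (Equiv.swap 0 1)
  | swap_right (a b c : ℕ) : a < b → b < c → KnuthTriple [b, c, a] [b, a, c] (Equiv.swap 1 2)
  | braid (a : ℕ) : KnuthTriple [a, a + 1, a] [a + 1, a, a + 1] (Equiv.swap 0 2)

/-- `v` arises from `u` by an elementary Coxeter–Knuth move on the three letters that follow the
first `p` letters. -/
def KnuthMove (p : ℕ) (u v : List ℕ) : Prop :=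
  ∃ pre t t' suf π, pre.length = p ∧ KnuthTriple t t' π ∧ u = pre ++ (t ++ suf) ∧
    v = pre ++ (t' ++ suf)

theorem swapPair_triple_zero (x y z : ℕ) : swapPair [x, y, z] 0 = s(x, x + 1) := rfl

theorem swapPair_triple_one (x y z : ℕ) :
    swapPair [x, y, z] 1 = s(simpleSwap x y, simpleSwap x (y + 1)) := by
  simp [swapPair, wordPerm]

theorem swapPair_triple_two (x y z : ℕ) :
    swapPair [x, y, z] 2 = s(simpleSwap x (simpleSwap y z), simpleSwap x (simpleSwap y (z + 1))) := by
  simp [swapPair, wordPerm]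

theorem simpleSwap_apply (x y : ℕ) :
    simpleSwap x y = if y = x then x + 1 else if y = x + 1 then x else y := by
  rw [simpleSwap, Equiv.swap_apply_def]

theorem simpleSwap_left (x : ℕ) : simpleSwap x x = x + 1 := by simp [simpleSwap]

theorem simpleSwap_right (x : ℕ) : simpleSwap x (x + 1) = x := by simp [simpleSwap]

theorem simpleSwap_of_ne {x y : ℕ} (h1 : y ≠ x) (h2 : y ≠ x + 1) : simpleSwap x y = y :=
  Equiv.swap_apply_of_ne_of_ne h1 h2

theorem KnuthTriple.length {t t' : List ℕ} {π : Equiv.Perm ℕ} (h : KnuthTriple t t' π) :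
    t.length = 3 ∧ t'.length = 3 := by
  cases h <;> simp

theorem KnuthTriple.apply_lt {t t' : List ℕ} {π : Equiv.Perm ℕ} (h : KnuthTriple t t' π) {e : ℕ}
    (he : e < 3) : π e < 3 := by
  cases h <;> rw [Equiv.swap_apply_def] <;> split_ifs <;> omega

theorem KnuthTriple.apply_apply {t t' : List ℕ} {π : Equiv.Perm ℕ} (h : KnuthTriple t t' π)
    (e : ℕ) : π (π e) = e := by
  cases h <;> simp

theorem simpleSwap_comm {a c : ℕ} (h : a + 1 < c) (x : ℕ) :
    simpleSwap a (simpleSwap c x) = simpleSwap c (simpleSwap a x) := by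
  simp only [simpleSwap_apply]; split_ifs <;> omega

theorem KnuthTriple.wordPerm_eq {t t' : List ℕ} {π : Equiv.Perm ℕ} (h : KnuthTriple t t' π) :
    wordPerm t = wordPerm t' := by
  ext x
  cases h with
  | swap_left a b c h1 h2 =>
    simp only [wordPerm_cons, Equiv.Perm.mul_apply]
    exact simpleSwap_comm (by omega) _
  | swap_right a b c h1 h2 =>
    simp only [wordPerm_cons, Equiv.Perm.mul_apply]
    exact congrArg _ (simpleSwap_comm (by omega) _).symm
  | braid a =>
    simp only [wordPerm_cons, Equiv.Perm.mul_apply, wordPerm_nil, Equiv.Perm.one_apply,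
      simpleSwap_apply]
    split_ifs <;> omega

/-- Corresponding crossings of the two words exchange the same two values. -/
theorem KnuthTriple.swapPair_eq {t t' : List ℕ} {π : Equiv.Perm ℕ} (h : KnuthTriple t t' π)
    {e : ℕ} (he : e < 3) : swapPair t' (π e) = swapPair t e := by
  cases h with
  | swap_left a b c h1 h2 =>
    interval_cases e
    · rw [Equiv.swap_apply_left, swapPair_triple_one, simpleSwap_of_ne (by omega) (by omega),
        simpleSwap_of_ne (by omega) (by omega)]
      rfl
    · rw [Equiv.swap_apply_right, swapPair_triple_one, simpleSwap_of_ne (by omega) (by omega),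
        simpleSwap_of_ne (by omega) (by omega)]
      rfl
    · rw [Equiv.swap_apply_of_ne_of_ne (by omega) (by omega), swapPair_triple_two,
        swapPair_triple_two, simpleSwap_comm (a := a) (c := c) (by omega) b,
        simpleSwap_comm (a := a) (c := c) (by omega) (b + 1)]
  | swap_right a b c h1 h2 =>
    interval_cases e
    · rw [Equiv.swap_apply_of_ne_of_ne (by omega) (by omega)]
      rfl
    · rw [Equiv.swap_apply_left, swapPair_triple_one, swapPair_triple_two,
        simpleSwap_of_ne (x := a) (y := c) (by omega) (by omega),
        simpleSwap_of_ne (x := a) (y := c + 1) (by omega) (by omega)]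
    · rw [Equiv.swap_apply_right, swapPair_triple_one, swapPair_triple_two,
        simpleSwap_of_ne (x := c) (y := a) (by omega) (by omega),
        simpleSwap_of_ne (x := c) (y := a + 1) (by omega) (by omega)]
  | braid a =>
    have h1 := simpleSwap_left a
    have h2 := simpleSwap_right a
    have h3 := simpleSwap_left (a + 1)
    have h4 := simpleSwap_right (a + 1)
    have h5 := simpleSwap_of_ne (x := a + 1) (y := a) (by omega) (by omega)
    have h6 := simpleSwap_of_ne (x := a) (y := a + 1 + 1) (by omega) (by omega)
    interval_cases e
    · rw [Equiv.swap_apply_left, swapPair_triple_two, swapPair_triple_zero, h2, h5, h6, h4]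
    · rw [Equiv.swap_apply_of_ne_of_ne (by omega) (by omega), swapPair_triple_one,
        swapPair_triple_one, h5, h3, h2, h6, Sym2.eq_swap]
    · rw [Equiv.swap_apply_right, swapPair_triple_two, swapPair_triple_zero, h5, h1, h3, h6]

theorem KnuthTriple.shift {t t' : List ℕ} {π : Equiv.Perm ℕ} (h : KnuthTriple t t' π) :
    KnuthTriple (t.map (· + 1)) (t'.map (· + 1)) π := by
  cases h with
  | swap_left a b c h1 h2 => exact .swap_left _ _ _ (Nat.succ_lt_succ h1) (Nat.succ_lt_succ h2)
  | swap_right a b c h1 h2 => exact .swap_right _ _ _ (Nat.succ_lt_succ h1) (Nat.succ_lt_succ h2)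
  | braid a => exact .braid _

theorem KnuthTriple.mem_iff {t t' : List ℕ} {π : Equiv.Perm ℕ} (h : KnuthTriple t t' π) (x : ℕ) :
    x ∈ t ↔ x ∈ t' := by
  cases h <;> simp <;> tauto

theorem KnuthMove.length_eq {p : ℕ} {u v : List ℕ} (h : KnuthMove p u v) :
    u.length = v.length := by
  obtain ⟨pre, t, t', suf, π, -, ht, rfl, rfl⟩ := h
  simp [ht.length]

theorem KnuthMove.wordPerm_eq {p : ℕ} {u v : List ℕ} (h : KnuthMove p u v) :
    wordPerm u = wordPerm v := by
  obtain ⟨pre, t, t', suf, π, -, ht, rfl, rfl⟩ := h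
  simp only [wordPerm_append, ht.wordPerm_eq]

theorem KnuthMove.mem_iff {p : ℕ} {u v : List ℕ} (h : KnuthMove p u v) (x : ℕ) :
    x ∈ u ↔ x ∈ v := by
  obtain ⟨pre, t, t', suf, π, -, ht, rfl, rfl⟩ := h
  simp only [List.mem_append, ht.mem_iff]

theorem KnuthMove.posDistinct_iff {p : ℕ} {u v : List ℕ} (h : KnuthMove p u v) :
    PosDistinct u ↔ PosDistinct v :=
  ⟨fun hu => ⟨fun x hx => hu.pos x ((h.mem_iff x).2 hx),
      hu.distinct.of_wordPerm_eq h.wordPerm_eq.symm h.length_eq.symm⟩,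
    fun hv => ⟨fun x hx => hv.pos x ((h.mem_iff x).1 hx),
      hv.distinct.of_wordPerm_eq h.wordPerm_eq h.length_eq⟩⟩

theorem KnuthMove.normalize {p : ℕ} {u v : List ℕ} (h : KnuthMove p u v) :
    KnuthMove p (normalize u) (normalize v) := by
  unfold LittleEG.normalize
  simp only [h.mem_iff 0]
  split_ifs
  · obtain ⟨pre, t, t', suf, π, hp, ht, rfl, rfl⟩ := h
    exact ⟨pre.map (· + 1), _, _, suf.map (· + 1), π, by simpa using hp, ht.shift, by simp,
      by simp⟩
  · exact h

theorem KnuthMove.append_left {p : ℕ} {u v : List ℕ} (h : KnuthMove p u v) (x : List ℕ) :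
    KnuthMove (x.length + p) (x ++ u) (x ++ v) := by
  obtain ⟨pre, t, t', suf, π, hp, ht, rfl, rfl⟩ := h
  exact ⟨x ++ pre, t, t', suf, π, by simp [hp], ht, by simp, by simp⟩

theorem KnuthMove.append_right {p : ℕ} {u v : List ℕ} (h : KnuthMove p u v) (x : List ℕ) :
    KnuthMove p (u ++ x) (v ++ x) := by
  obtain ⟨pre, t, t', suf, π, hp, ht, rfl, rfl⟩ := h
  exact ⟨pre, t, t', suf ++ x, π, hp, ht, by simp, by simp⟩

/-! ### Bumps commute with Coxeter–Knuth moves -/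

/-- The place to which a Coxeter–Knuth move with permutation `π` after `p` letters moves the
crossing at position `i`. -/
def movedPosition (p : ℕ) (π : Equiv.Perm ℕ) (i : ℕ) : ℕ :=
  if p ≤ i ∧ i < p + 3 then p + π (i - p) else i

theorem movedPosition_add {p e : ℕ} (π : Equiv.Perm ℕ) (he : e < 3) :
    movedPosition p π (p + e) = p + π e := by
  rw [movedPosition, if_pos (by omega), Nat.add_sub_cancel_left]

theorem swapPair_movedPosition {pre t t' suf : List ℕ} {π : Equiv.Perm ℕ}
    (ht : KnuthTriple t t' π) (i : ℕ) :
    swapPair (pre ++ (t' ++ suf)) (movedPosition pre.length π i) =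
      swapPair (pre ++ (t ++ suf)) i := by
  have hl := ht.length
  rcases lt_or_ge i pre.length with h1 | h1
  · rw [movedPosition, if_neg (by omega), swapPair_append_left _ _ h1, swapPair_append_left _ _ h1]
  obtain ⟨e, rfl⟩ := Nat.exists_eq_add_of_le h1
  rcases lt_or_ge e 3 with h2 | h2
  · have h3 := ht.apply_lt h2
    rw [movedPosition_add π h2, swapPair_append_right, swapPair_append_right,
      swapPair_append_left _ _ (by omega), swapPair_append_left _ _ (by omega), ht.swapPair_eq h2]
  · obtain ⟨l, rfl⟩ := Nat.exists_eq_add_of_le h2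
    have e1 := swapPair_append_right t suf l
    have e2 := swapPair_append_right t' suf l
    rw [hl.1] at e1
    rw [hl.2] at e2
    rw [movedPosition, if_neg (by omega), swapPair_append_right, swapPair_append_right, e1, e2,
      ht.wordPerm_eq]

theorem KnuthTriple.movedPosition_lt {t t' : List ℕ} {π : Equiv.Perm ℕ}
    (ht : KnuthTriple t t' π) {p n i : ℕ} (hn : p + 3 ≤ n) (hi : i < n) :
    movedPosition p π i < n := by
  unfold movedPosition
  split_ifs with h
  · have := ht.apply_lt (e := i - p) (by omega)
    omega
  · exact hi

theorem KnuthTriple.movedPosition_movedPosition {t t' : List ℕ} {π : Equiv.Perm ℕ}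
    (ht : KnuthTriple t t' π) (p i : ℕ) : movedPosition p π (movedPosition p π i) = i := by
  by_cases h : p ≤ i ∧ i < p + 3
  · obtain ⟨e, rfl⟩ := Nat.exists_eq_add_of_le h.1
    rw [movedPosition_add π (by omega), movedPosition_add π (ht.apply_lt (by omega)),
      ht.apply_apply]
  · have : movedPosition p π i = i := if_neg h
    rw [this, this]

/-- One or two consecutive steps of a bump inside three letters: the letter at `e` is lowered, and
then possibly a letter in conflict with it. -/
inductive LocalRun : List ℕ → ℕ → List ℕ → ℕ → Prop
  | one (t : List ℕ) (e : ℕ) : LocalRun t e (lower t e) e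
  | two (t : List ℕ) (e e' : ℕ) : e' < t.length → e' ≠ e →
      swapPair (lower t e) e' = swapPair (lower t e) e → LocalRun t e (lower (lower t e) e') e'

theorem lower_append_right (p r : List ℕ) (e : ℕ) :
    lower (p ++ r) (p.length + e) = p ++ lower r e := by
  simp only [lower]
  rw [List.getD_append_right _ _ _ _ (by omega), List.set_append_right _ _ (by omega)]
  simp

theorem lower_append_left (p r : List ℕ) {e : ℕ} (h : e < p.length) :
    lower (p ++ r) e = lower p e ++ r := by
  simp only [lower]
  rw [List.getD_append _ _ _ _ h, List.set_append_left _ _ h]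

theorem lower_middle (pre t suf : List ℕ) {e : ℕ} (h : e < t.length) :
    lower (pre ++ (t ++ suf)) (pre.length + e) = pre ++ (lower t e ++ suf) := by
  rw [lower_append_right, lower_append_left _ _ h]

theorem swapPair_middle_eq (pre t suf : List ℕ) {e e' : ℕ} (h : e < t.length) (h' : e' < t.length)
    (hs : swapPair t e = swapPair t e') : swapPair (pre ++ (t ++ suf)) (pre.length + e) =
      swapPair (pre ++ (t ++ suf)) (pre.length + e') := by
  rw [swapPair_append_right, swapPair_append_right, swapPair_append_left _ _ h,
    swapPair_append_left _ _ h', hs]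

theorem LocalRun.lift {t t2 : List ℕ} {e e2 : ℕ} (h : LocalRun t e t2 e2) (he : e < t.length)
    {pre suf : List ℕ} (hpos : ∀ x ∈ pre ++ (t ++ suf), 1 ≤ x)
    (her : DistinctSwaps ((pre ++ (t ++ suf)).eraseIdx (pre.length + e))) :
    Lowered (pre ++ (t2 ++ suf)) (pre.length + e2) ∧
      (pre ++ (t2 ++ suf)).sum < (pre ++ (t ++ suf)).sum ∧
      ∀ x, BumpRun (pre ++ (t2 ++ suf)) (pre.length + e2) x →
        BumpRun (lower (pre ++ (t ++ suf)) (pre.length + e)) (pre.length + e) x := by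
  have hlt : pre.length + e < (pre ++ (t ++ suf)).length := by simp; omega
  have hL := lowered_lower hlt hpos her
  have hsum := sum_lower_lt hlt (getD_pos hpos hlt)
  rw [lower_middle pre t suf he] at hL hsum ⊢
  cases h with
  | one => exact ⟨hL, hsum, fun _ h => h⟩
  | two _ h1 h2 h3 =>
    have h1' : e2 < (lower t e).length := by simpa using h1
    have h4 : pre.length + e2 < (pre ++ (lower t e ++ suf)).length := by simp; omega
    have h5 : pre.length + e2 ≠ pre.length + e := by omega
    have h6 := swapPair_middle_eq pre (lower t e) suf h1' (by simpa using he) h3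
    have h7 := sum_lower_lt h4 (hL.pos _ h4 h5)
    have h8 := hL.lower h4 h5 h6
    rw [lower_middle pre _ suf h1'] at h7 h8
    refine ⟨h8, h7.trans hsum, fun x hx => .step _ _ _ _ h4 h5 h6 ?_⟩
    rwa [lower_middle pre _ suf h1']

theorem LocalRun.of_eq {t t2 : List ℕ} {e : ℕ} (h : lower t e = t2) : LocalRun t e t2 e :=
  h ▸ .one t e

theorem LocalRun.of_eq_eq {t t1 t2 : List ℕ} {e e' : ℕ} (h1 : lower t e = t1)
    (h2 : lower t1 e' = t2) (he : e' < t.length) (hne : e' ≠ e)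
    (hs : swapPair t1 e' = swapPair t1 e) : LocalRun t e t2 e' := by
  subst h1 h2; exact .two t e e' he hne hs

theorem swapPair_conflict_outer {x y : ℕ} (z : ℕ) (h : y + 1 < x ∨ x + 1 < y) (hz : z = x) :
    swapPair [x, y, z] 2 = swapPair [x, y, z] 0 := by
  subst hz
  rw [swapPair_triple_two, swapPair_triple_zero, simpleSwap_of_ne (y := z) (by omega) (by omega),
    simpleSwap_of_ne (y := z + 1) (by omega) (by omega), simpleSwap_left, simpleSwap_right,
    Sym2.eq_swap]

theorem swapPair_conflict_left (x z : ℕ) : swapPair [x, x, z] 1 = swapPair [x, x, z] 0 :=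
  swapPair_succ_of_eq _ (by simp) rfl

theorem swapPair_conflict_right (x y : ℕ) : swapPair [x, y, y] 2 = swapPair [x, y, y] 1 :=
  swapPair_succ_of_eq _ (by simp) rfl

/-- Lowering corresponding letters of two words related by a Coxeter–Knuth move leads again to two
words related by a Coxeter–Knuth move, after at most one further step of the bump in each word. -/
theorem KnuthTriple.exists_localRun {t t' : List ℕ} {π : Equiv.Perm ℕ} (ht : KnuthTriple t t' π)
    {e : ℕ} (he : e < 3) (hpos : ∀ x ∈ t, 1 ≤ x) (her : DistinctSwaps (t.eraseIdx e)) :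
    ∃ t2 t2' e2 π2, KnuthTriple t2 t2' π2 ∧ e2 < 3 ∧ LocalRun t e t2 e2 ∧
      LocalRun t' (π e) t2' (π2 e2) := by
  cases ht with
  | swap_left a b c h1 h2 =>
    obtain ⟨a, rfl⟩ : ∃ k, a = k + 1 := ⟨a - 1, by have := hpos a (by simp); omega⟩
    obtain ⟨b, rfl⟩ : ∃ k, b = k + 1 := ⟨b - 1, by omega⟩
    obtain ⟨c, rfl⟩ : ∃ k, c = k + 1 := ⟨c - 1, by omega⟩
    interval_cases e
    · exact ⟨_, _, 0, _, .swap_left a (b + 1) (c + 1) (by omega) (by omega), by omega,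
        .of_eq rfl, .of_eq rfl⟩
    · rcases (show b + 1 < c ∨ c = b + 1 by omega) with h | rfl
      · exact ⟨_, _, 1, _, .swap_left (a + 1) (b + 1) c (by omega) (by omega), by omega,
          .of_eq rfl, .of_eq rfl⟩
      rcases (show a + 1 < b ∨ b = a + 1 by omega) with h | rfl
      · exact ⟨_, _, 2, _, .swap_left (a + 1) b (b + 1) (by omega) (by omega), by omega,
          .of_eq_eq rfl rfl (by simp) (by omega) (swapPair_conflict_right _ _),
          .of_eq_eq rfl rfl (by change _ < 3; decide) (by decide)
            (swapPair_conflict_outer (x := b + 1) (y := a + 1) _ (Or.inl (by omega)) rfl)⟩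
      · exact ⟨_, _, 2, _, .braid (a + 1), by omega,
          .of_eq_eq rfl rfl (by simp) (by omega) (swapPair_conflict_right _ _), .of_eq rfl⟩
    · rcases (show a + 1 < b ∨ b = a + 1 by omega) with h | rfl
      · exact ⟨_, _, 2, _, .swap_left (a + 1) b (c + 1) (by omega) (by omega), by omega,
          .of_eq rfl, .of_eq rfl⟩
      · exact ⟨_, _, 0, _, .swap_left a (a + 1) (c + 1) (by omega) (by omega), by omega,
          .of_eq_eq rfl rfl (by simp) (by omega)
            (swapPair_conflict_outer (x := a + 1) (y := c + 1) _ (Or.inr (by omega)) rfl).symm,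
          .of_eq_eq rfl rfl (by change _ < 3; decide) (by decide) (swapPair_conflict_right _ _).symm⟩
  | swap_right a b c h1 h2 =>
    obtain ⟨a, rfl⟩ : ∃ k, a = k + 1 := ⟨a - 1, by have := hpos a (by simp); omega⟩
    obtain ⟨b, rfl⟩ : ∃ k, b = k + 1 := ⟨b - 1, by omega⟩
    obtain ⟨c, rfl⟩ : ∃ k, c = k + 1 := ⟨c - 1, by omega⟩
    interval_cases e
    · rcases (show a + 1 < b ∨ b = a + 1 by omega) with h | rfl
      · exact ⟨_, _, 0, _, .swap_right (a + 1) b (c + 1) (by omega) (by omega), by omega,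
          .of_eq rfl, .of_eq rfl⟩
      · exact ⟨_, _, 2, _, .swap_right a (a + 1) (c + 1) (by omega) (by omega), by omega,
          .of_eq_eq rfl rfl (by simp) (by omega)
            (swapPair_conflict_outer (x := a + 1) (y := c + 1) _ (Or.inr (by omega)) rfl),
          .of_eq_eq rfl rfl (by change _ < 3; decide) (by decide) (swapPair_conflict_left _ _)⟩
    · rcases (show b + 1 < c ∨ c = b + 1 by omega) with h | rfl
      · exact ⟨_, _, 1, _, .swap_right (a + 1) (b + 1) c (by omega) (by omega), by omega,
          .of_eq rfl, .of_eq rfl⟩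
      rcases (show a + 1 < b ∨ b = a + 1 by omega) with h | rfl
      · exact ⟨_, _, 0, _, .swap_right (a + 1) b (b + 1) (by omega) (by omega), by omega,
          .of_eq_eq rfl rfl (by simp) (by omega) (swapPair_conflict_left _ _).symm,
          .of_eq_eq rfl rfl (by change _ < 3; decide) (by decide)
            (swapPair_conflict_outer (x := b + 1) (y := a + 1) _ (Or.inl (by omega)) rfl).symm⟩
      · exact ⟨_, _, 0, _, .braid (a + 1), by omega,
          .of_eq_eq rfl rfl (by simp) (by omega) (swapPair_conflict_left _ _).symm, .of_eq rfl⟩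
    · exact ⟨_, _, 2, _, .swap_right a (b + 1) (c + 1) (by omega) (by omega), by omega,
        .of_eq rfl, .of_eq rfl⟩
  | braid a =>
    obtain ⟨a, rfl⟩ : ∃ k, a = k + 1 := ⟨a - 1, by have := hpos a (by simp); omega⟩
    interval_cases e
    · exact ⟨_, _, 0, _, .swap_left a (a + 1) (a + 2) (by omega) (by omega), by omega,
        .of_eq rfl,
        .of_eq_eq rfl rfl (by change _ < 3; decide) (by decide) (swapPair_conflict_right _ _).symm⟩
    · exact absurd rfl (her.getD_succ_ne (l := 0) (by simp))
    · exact ⟨_, _, 2, _, .swap_right a (a + 1) (a + 2) (by omega) (by omega), by omega,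
        .of_eq rfl,
        .of_eq_eq rfl rfl (by change _ < 3; decide) (by decide) (swapPair_conflict_left _ _)⟩

/-- Two bump states, just after lowering, that are related by a Coxeter–Knuth move. -/
def KnuthStates (p : ℕ) (u : List ℕ) (i : ℕ) (v : List ℕ) (j : ℕ) : Prop :=
  Lowered u i ∧ Lowered v j ∧ ∃ pre t t' suf π, pre.length = p ∧ KnuthTriple t t' π ∧
    u = pre ++ (t ++ suf) ∧ v = pre ++ (t' ++ suf) ∧ j = movedPosition p π i

/-- Lowering corresponding letters of two words related by a Coxeter–Knuth move. -/
theorem KnuthTriple.exists_states {pre t t' suf : List ℕ} {π : Equiv.Perm ℕ}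
    (ht : KnuthTriple t t' π) {i j : ℕ} (hj : j = movedPosition pre.length π i)
    (hi : i < (pre ++ (t ++ suf)).length)
    (hu : ∀ x ∈ pre ++ (t ++ suf), 1 ≤ x) (hv : ∀ x ∈ pre ++ (t' ++ suf), 1 ≤ x)
    (heu : DistinctSwaps ((pre ++ (t ++ suf)).eraseIdx i))
    (hev : DistinctSwaps ((pre ++ (t' ++ suf)).eraseIdx j)) :
    ∃ u2 i2 v2 j2, KnuthStates pre.length u2 i2 v2 j2 ∧ u2.sum < (pre ++ (t ++ suf)).sum ∧
      (∀ x, BumpRun u2 i2 x → BumpRun (lower (pre ++ (t ++ suf)) i) i x) ∧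
      ∀ x, BumpRun v2 j2 x → BumpRun (lower (pre ++ (t' ++ suf)) j) j x := by
  have hl := ht.length
  have hjlt : j < (pre ++ (t' ++ suf)).length := by
    rw [hj]
    refine ht.movedPosition_lt (by simp; omega) ?_
    simpa [hl] using hi
  have outside : ∀ {k}, (k < pre.length ∨ pre.length + 3 ≤ k) → movedPosition pre.length π k = k :=
    fun h => if_neg (by omega)
  rcases lt_or_ge i pre.length with h1 | h1
  · rw [outside (Or.inl h1)] at hj
    subst hj
    refine ⟨_, j, _, j, ⟨lowered_lower hi hu heu, lowered_lower hjlt hv hev, lower pre j, t, t',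
      suf, π, by simp, ht, lower_append_left _ _ h1, lower_append_left _ _ h1,
      (outside (Or.inl h1)).symm⟩, sum_lower_lt hi (getD_pos hu hi), fun _ h => h, fun _ h => h⟩
  obtain ⟨e, rfl⟩ := Nat.exists_eq_add_of_le h1
  rcases lt_or_ge e 3 with h2 | h2
  · rw [movedPosition_add π h2] at hj
    subst hj
    have her : DistinctSwaps (t.eraseIdx e) := by
      rw [List.eraseIdx_append_of_length_le (by omega), Nat.add_sub_cancel_left,
        List.eraseIdx_append_of_lt_length (by omega)] at heu
      exact heu.append_right.append_left
    obtain ⟨t2, t2', e2, π2, h3, h4, h5, h6⟩ := ht.exists_localRun h2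
      (fun x hx => hu x (by simp [hx])) her
    obtain ⟨h7, h8, h9⟩ := h5.lift (by omega) hu heu
    obtain ⟨h10, h11, h12⟩ := h6.lift (by rw [hl.2]; exact ht.apply_lt h2) hv hev
    exact ⟨_, _, _, _, ⟨h7, h10, pre, t2, t2', suf, π2, rfl, h3, rfl, rfl,
      (movedPosition_add π2 h4).symm⟩, h8, h9, h12⟩
  · rw [outside (Or.inr (by omega))] at hj
    subst hj
    obtain ⟨l, rfl⟩ := Nat.exists_eq_add_of_le h2
    refine ⟨_, _, _, _, ⟨lowered_lower hi hu heu, lowered_lower hjlt hv hev, pre, t, t',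
      lower suf l, π, rfl, ht, ?_, ?_, (outside (Or.inr (by omega))).symm⟩,
      sum_lower_lt hi (getD_pos hu hi), fun _ h => h, fun _ h => h⟩
    · rw [lower_append_right, ← lower_append_right t suf l, hl.1]
    · rw [lower_append_right, ← lower_append_right t' suf l, hl.2]

/-- Bumps of words related by a Coxeter–Knuth move end with words related by such a move at the
same place. -/
theorem KnuthStates.exists_run {p : ℕ} {u v : List ℕ} {i j : ℕ} (h : KnuthStates p u i v j) :
    ∃ u' v', BumpRun u i u' ∧ BumpRun v j v' ∧ KnuthMove p u' v' := by
  induction hs : u.sum using Nat.strong_induction_on generalizing u v i j with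
  | _ n ih =>
    obtain ⟨hLu, hLv, pre, t, t', suf, π, rfl, ht, hu, hv, hj⟩ := h
    have hm : KnuthMove pre.length u v := ⟨pre, t, t', suf, π, rfl, ht, hu, hv⟩
    by_cases hd : DistinctSwaps u
    · exact ⟨u, v, .halt u i hd,
        .halt v j (hd.of_wordPerm_eq hm.wordPerm_eq.symm hm.length_eq.symm), hm⟩
    have hdv : ¬ DistinctSwaps v := fun h => hd (h.of_wordPerm_eq hm.wordPerm_eq hm.length_eq)
    obtain ⟨k, hk, hki, hp⟩ := exists_conflict hLu.lt hLu.erase hd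
    have hposu := pos_of_getD fun l hl => hLu.pos_of_not_distinct hd hl
    have hposv := pos_of_getD fun l hl => hLv.pos_of_not_distinct hdv hl
    set k' := movedPosition pre.length π k with hk'
    have hl := ht.length
    have hk'lt : k' < v.length := by
      rw [← hm.length_eq]
      exact ht.movedPosition_lt (by rw [hu]; simp; omega) hk
    have hk'j : k' ≠ j := by
      rw [hj]
      intro h
      have := congrArg (movedPosition pre.length π) h
      rw [hk', ht.movedPosition_movedPosition, ht.movedPosition_movedPosition] at this
      exact hki this
    have hp' : swapPair v k' = swapPair v j := by
      rw [hv, hk', hj, swapPair_movedPosition ht, swapPair_movedPosition ht, ← hu, hp]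
    have heu := distinctSwaps_erase_conflict hLu.lt hLu.erase hk hp
    have hev := distinctSwaps_erase_conflict hLv.lt hLv.erase hk'lt hp'
    rw [hu] at hk hposu heu
    rw [hv] at hposv hev
    obtain ⟨u2, i2, v2, j2, h1, h2, h3, h4⟩ := ht.exists_states hk' hk hposu hposv heu hev
    rw [← hu] at hk h2 h3
    rw [← hv] at h4
    obtain ⟨u', v', h5, h6, h7⟩ := ih _ (hs ▸ h2) h1 rfl
    exact ⟨u', v', .step _ _ _ _ hk hki hp (h3 _ h5), .step _ _ _ _ hk'lt hk'j hp' (h4 _ h6), h7⟩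

theorem BumpRun.unique {u : List ℕ} {i : ℕ} {x y : List ℕ} (hL : Lowered u i)
    (hx : BumpRun u i x) (hy : BumpRun u i y) : x = y := by
  induction hx with
  | halt u i hd =>
    cases hy with
    | halt => rfl
    | step _ _ j _ h1 h2 h3 _ => exact absurd (hd h1 hL.lt h3) h2
  | step u i j x h1 h2 h3 _ ih =>
    cases hy with
    | halt _ _ hd => exact absurd (hd h1 hL.lt h3) h2
    | step _ _ k _ h4 h5 h6 h7 =>
      have := conflict_unique hL.lt hL.erase h1 h4 h2 h5 h3 h6
      subst this
      exact ih (hL.lower h1 h2 h3) h7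

theorem IsBumpStart.unique {w : List ℕ} (hw : DistinctSwaps w) {i j : ℕ} (hi : IsBumpStart w i)
    (hj : IsBumpStart w j) : i = j := by
  obtain ⟨h1, r, s, h2, h3⟩ := hi
  obtain ⟨h4, r', s', h5, h6⟩ := hj
  obtain ⟨rfl, rfl⟩ := Prod.mk.inj (h2.unique h5)
  exact hw h1 h4 (h3.trans h6.symm)

theorem LittleNext.unique {w x y : List ℕ} (hw : PosDistinct w) (hx : LittleNext w x)
    (hy : LittleNext w y) : x = y := by
  obtain ⟨-, i, u, h1, h2, rfl⟩ := hx
  obtain ⟨-, j, v, h3, h4, rfl⟩ := hy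
  obtain rfl := h1.unique hw.distinct h3
  rw [h2.unique (lowered_lower h1.1 hw.pos (h1.erase hw.distinct)) h4]

/-- Steps of the Little map commute with elementary Coxeter–Knuth moves. -/
theorem KnuthMove.exists_littleNext {p : ℕ} {w v : List ℕ} (hw : PosDistinct w)
    (hm : KnuthMove p w v) (hg : ¬ IsGrassmannian (wordPerm w)) (hne : w ≠ []) :
    ∃ w' v', LittleNext w w' ∧ LittleNext v v' ∧ KnuthMove p w' v' := by
  have hv := hm.posDistinct_iff.1 hw
  obtain ⟨i, hi⟩ := hw.exists_isBumpStart hne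
  obtain ⟨pre, t, t', suf, π, rfl, ht, hwe, hve⟩ := id hm
  have hj : IsBumpStart v (movedPosition pre.length π i) := by
    obtain ⟨h1, r, s, h2, h3⟩ := hi
    refine ⟨?_, r, s, hm.wordPerm_eq ▸ h2, ?_⟩
    · rw [← hm.length_eq]
      have := ht.length
      exact ht.movedPosition_lt (by rw [hwe]; simp; omega) h1
    · rw [← hm.wordPerm_eq, ← h3, hve, swapPair_movedPosition ht, ← hwe]
  have hei := hi.erase hw.distinct
  have hej := hj.erase hv.distinct
  have hilt := hi.1
  have hposw := hw.pos
  have hposv := hv.pos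
  rw [hwe] at hei hilt hposw
  rw [hve] at hej hposv
  obtain ⟨u2, i2, v2, j2, h1, -, h3, h4⟩ := ht.exists_states rfl hilt hposw hposv hei hej
  obtain ⟨u', v', h5, h6, h7⟩ := h1.exists_run
  rw [← hwe] at h3
  rw [← hve] at h4
  exact ⟨_, _, ⟨hg, i, u', hi, h3 _ h5, rfl⟩,
    ⟨hm.wordPerm_eq ▸ hg, _, v', hj, h4 _ h6, rfl⟩, h7.normalize⟩

/-- `w` and `v` are connected by elementary Coxeter–Knuth moves that do not touch the first `n`
letters. -/
def KnuthEquiv (n : ℕ) (w v : List ℕ) : Prop :=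
  Relation.EqvGen (fun x y => ∃ p, n ≤ p ∧ KnuthMove p x y) w v

theorem KnuthEquiv.posDistinct_iff {n : ℕ} {w v : List ℕ} (h : KnuthEquiv n w v) :
    PosDistinct w ↔ PosDistinct v := by
  induction h with
  | rel x y h => obtain ⟨p, -, h⟩ := h; exact h.posDistinct_iff
  | refl => rfl
  | symm _ _ _ ih => exact ih.symm
  | trans _ _ _ _ _ ih1 ih2 => exact ih1.trans ih2

theorem KnuthEquiv.wordPerm_eq {n : ℕ} {w v : List ℕ} (h : KnuthEquiv n w v) :
    wordPerm w = wordPerm v := by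
  induction h with
  | rel x y h => obtain ⟨p, -, h⟩ := h; exact h.wordPerm_eq
  | refl => rfl
  | symm _ _ _ ih => exact ih.symm
  | trans _ _ _ _ _ ih1 ih2 => exact ih1.trans ih2

theorem KnuthEquiv.length_eq {n : ℕ} {w v : List ℕ} (h : KnuthEquiv n w v) :
    w.length = v.length := by
  induction h with
  | rel x y h => obtain ⟨p, -, h⟩ := h; exact h.length_eq
  | refl => rfl
  | symm _ _ _ ih => exact ih.symm
  | trans _ _ _ _ _ ih1 ih2 => exact ih1.trans ih2

theorem KnuthMove.take_eq {n p : ℕ} {w v : List ℕ} (h : KnuthMove p w v) (hn : n ≤ p) :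
    w.take n = v.take n := by
  obtain ⟨pre, t, t', suf, π, rfl, -, rfl, rfl⟩ := h
  rw [List.take_append_of_le_length hn, List.take_append_of_le_length hn]

theorem KnuthEquiv.take_eq {n : ℕ} {w v : List ℕ} (h : KnuthEquiv n w v) :
    w.take n = v.take n := by
  induction h with
  | rel x y h => obtain ⟨p, hp, h⟩ := h; exact h.take_eq hp
  | refl => rfl
  | symm _ _ _ ih => exact ih.symm
  | trans _ _ _ _ _ ih1 ih2 => exact ih1.trans ih2

theorem KnuthEquiv.refl (n : ℕ) (w : List ℕ) : KnuthEquiv n w w := Relation.EqvGen.refl w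

theorem KnuthEquiv.symm {n : ℕ} {w v : List ℕ} (h : KnuthEquiv n w v) : KnuthEquiv n v w :=
  Relation.EqvGen.symm _ _ h

theorem KnuthEquiv.trans {n : ℕ} {w v x : List ℕ} (h : KnuthEquiv n w v) (h' : KnuthEquiv n v x) :
    KnuthEquiv n w x :=
  Relation.EqvGen.trans _ _ _ h h'

theorem KnuthEquiv.of_eq {n : ℕ} {w v : List ℕ} (h : w = v) : KnuthEquiv n w v := h ▸ .refl n w

theorem KnuthEquiv.append_left {n : ℕ} {w v : List ℕ} (h : KnuthEquiv n w v) (x : List ℕ) :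
    KnuthEquiv (x.length + n) (x ++ w) (x ++ v) := by
  induction h with
  | rel y z h =>
    obtain ⟨p, hp, h⟩ := h
    exact .rel _ _ ⟨_, by omega, h.append_left x⟩
  | refl => exact .refl _ _
  | symm _ _ _ ih => exact ih.symm
  | trans _ _ _ _ _ ih1 ih2 => exact ih1.trans ih2

theorem KnuthEquiv.append_right {n : ℕ} {w v : List ℕ} (h : KnuthEquiv n w v) (x : List ℕ) :
    KnuthEquiv n (w ++ x) (v ++ x) := by
  induction h with
  | rel y z h =>
    obtain ⟨p, hp, h⟩ := h
    exact .rel _ _ ⟨p, hp, h.append_right x⟩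
  | refl => exact .refl _ _
  | symm _ _ _ ih => exact ih.symm
  | trans _ _ _ _ _ ih1 ih2 => exact ih1.trans ih2

theorem KnuthEquiv.mono {m n : ℕ} {w v : List ℕ} (h : KnuthEquiv n w v) (hmn : m ≤ n) :
    KnuthEquiv m w v :=
  Relation.EqvGen.mono (fun _ _ ⟨p, hp, h⟩ => ⟨p, hmn.trans hp, h⟩) _ _ h

theorem ne_nil_of_length_eq {w v : List ℕ} (h : w.length = v.length) (hw : w ≠ []) : v ≠ [] := by
  rintro rfl; exact hw (List.length_eq_zero_iff.1 h)

/-- Steps of the Little map carry Coxeter–Knuth equivalent words to such words. -/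
theorem KnuthEquiv.littleNext {n : ℕ} {w v : List ℕ} (h : KnuthEquiv n w v) (hw : PosDistinct w)
    (hne : w ≠ []) (hg : ¬ IsGrassmannian (wordPerm w)) :
    ∃ w' v', LittleNext w w' ∧ LittleNext v v' ∧ KnuthEquiv n w' v' := by
  induction h with
  | rel x y h =>
    obtain ⟨p, hp, h⟩ := h
    obtain ⟨w', v', h1, h2, h3⟩ := h.exists_littleNext hw hg hne
    exact ⟨w', v', h1, h2, .rel _ _ ⟨p, hp, h3⟩⟩
  | refl x =>
    obtain ⟨w', h⟩ := LittleEG.exists_littleNext hw hne hg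
    exact ⟨w', w', h, h, .refl _ _⟩
  | symm x y h ih =>
    have h' : KnuthEquiv n x y := h
    obtain ⟨w', v', h1, h2, h3⟩ := ih (h'.posDistinct_iff.2 hw)
      (ne_nil_of_length_eq h'.length_eq.symm hne) (h'.wordPerm_eq ▸ hg)
    exact ⟨v', w', h2, h1, h3.symm⟩
  | trans x y z h _ ih1 ih2 =>
    have h' : KnuthEquiv n x y := h
    have hy := h'.posDistinct_iff.1 hw
    obtain ⟨w', v', h1, h2, h3⟩ := ih1 hw hne hg
    obtain ⟨w'', v'', h4, h5, h6⟩ := ih2 hy (ne_nil_of_length_eq h'.length_eq hne)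
      (h'.wordPerm_eq ▸ hg)
    obtain rfl := h2.unique hy h4
    exact ⟨w', v'', h1, h5, h3.trans h6⟩

theorem KnuthEquiv.littleChain {n : ℕ} {w v g : List ℕ} (h : KnuthEquiv n w v)
    (hw : PosDistinct w) (hc : Relation.ReflTransGen LittleNext w g) :
    ∃ g', Relation.ReflTransGen LittleNext v g' ∧ KnuthEquiv n g g' := by
  induction hc using Relation.ReflTransGen.head_induction_on generalizing v with
  | refl => exact ⟨v, .refl, h⟩
  | head h1 _ ih =>
    have hne := h1
    obtain ⟨hg, i, -, hi, -, -⟩ := hne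
    obtain ⟨w', v', h3, h4, h5⟩ := h.littleNext hw (by
      rintro rfl
      exact absurd hi.1 (by simp)) hg
    obtain rfl := h1.unique hw h3
    obtain ⟨g', h6, h7⟩ := ih h5 (h1.sameDescents hw).1
    exact ⟨g', .head h4 h6, h7⟩

theorem littleChain_sameDescents {w g : List ℕ} (hw : PosDistinct w)
    (hc : Relation.ReflTransGen LittleNext w g) : PosDistinct g ∧ SameDescents w g := by
  induction hc with
  | refl => exact ⟨hw, .refl w⟩
  | tail _ h ih =>
    have := h.sameDescents ih.1
    exact ⟨this.1, ih.2.trans this.2⟩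

theorem littleChain_littleMap {w g : List ℕ} (hw : PosDistinct w)
    (hc : Relation.ReflTransGen LittleNext w g) : littleMap w = littleMap g := by
  induction hc with
  | refl => rfl
  | tail h1 h2 ih => rw [ih, h2.littleMap_eq (littleChain_sameDescents hw h1).1]

/-! ### Sliding letters by Coxeter–Knuth moves -/

theorem KnuthTriple.equiv {t t' : List ℕ} {π : Equiv.Perm ℕ} (h : KnuthTriple t t' π)
    (suf : List ℕ) : KnuthEquiv 0 (t ++ suf) (t' ++ suf) :=
  .rel _ _ ⟨0, le_rfl, [], t, t', suf, π, rfl, h, rfl, rfl⟩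

theorem KnuthEquiv.prepend {w v : List ℕ} (h : KnuthEquiv 0 w v) (x : List ℕ) :
    KnuthEquiv 0 (x ++ w) (x ++ v) :=
  (h.append_left x).mono (Nat.zero_le _)

theorem KnuthEquiv.cons {w v : List ℕ} (h : KnuthEquiv 0 w v) (x : ℕ) :
    KnuthEquiv 0 (x :: w) (x :: v) :=
  h.prepend [x]

/-- A small letter slides past a decreasing run, up to the last letter of the run. -/
theorem knuthEquiv_slide_small {a t : ℕ} (hat : a < t) : ∀ D : List ℕ,
    (D ++ [t]).Pairwise (· > ·) → KnuthEquiv 0 (a :: (D ++ [t])) (D ++ [a, t])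
  | [], _ => .refl _ _
  | [c], h => by
    simp at h
    exact (KnuthTriple.swap_left a t c hat h).equiv []
  | c :: d :: D, h => by
    have h' := h
    simp only [List.cons_append, List.pairwise_cons] at h'
    have hcd : d < c := h'.1 d (by simp)
    have hdt : t < d := h'.2.1 t (by simp)
    refine ((KnuthTriple.swap_left a d c (by omega) hcd).equiv (D ++ [t])).trans ?_
    exact (knuthEquiv_slide_small hat (d :: D) (List.Pairwise.of_cons h)).cons c

/-- A large letter slides past a decreasing run, up to the first letter of the run. -/
theorem knuthEquiv_slide_large {r : ℕ} : ∀ (D : List ℕ) (x : ℕ), x < r →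
    (x :: D).Pairwise (· > ·) → KnuthEquiv 0 (x :: r :: D) (x :: (D ++ [r]))
  | [], _, _, _ => .refl _ _
  | d :: D, x, hx, h => by
    have hd : d < x := (List.pairwise_cons.1 h).1 d (by simp)
    refine ((KnuthTriple.swap_right d x r hd hx).equiv D).trans ?_
    exact (knuthEquiv_slide_large D d (by omega) (List.Pairwise.of_cons h)).cons x

/-- An increasing run slides past a decreasing run of larger letters. -/
theorem knuthEquiv_slide_column {t : ℕ} {D : List ℕ} (hD : (D ++ [t]).Pairwise (· > ·)) :
    ∀ cs : List ℕ, (cs ++ [t]).Pairwise (· < ·) →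
      KnuthEquiv 0 (cs ++ (D ++ [t])) (D ++ (cs ++ [t]))
  | [], _ => .refl _ _
  | a :: cs, h => by
    have ih := (knuthEquiv_slide_column hD cs (List.Pairwise.of_cons h)).cons a
    refine ih.trans ?_
    obtain ⟨b, l, hbl⟩ : ∃ b l, cs ++ [t] = b :: l := by
      cases cs with
      | nil => exact ⟨t, [], rfl⟩
      | cons b l => exact ⟨b, l ++ [t], rfl⟩
    have h : (a :: (cs ++ [t])).Pairwise (· < ·) := h
    have hab : a < b := (List.pairwise_cons.1 h).1 b (by rw [hbl]; simp)
    have hbt : b ≤ t := by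
      have h1 := List.Pairwise.of_cons h
      rw [hbl] at h1
      have h2 : t ∈ b :: l := by rw [← hbl]; simp
      rcases List.mem_cons.1 h2 with h2 | h2
      · omega
      · exact ((List.pairwise_cons.1 h1).1 t h2).le
    have hDb : (D ++ [b]).Pairwise (· > ·) := by
      rw [List.pairwise_append] at hD ⊢
      refine ⟨hD.1, by simp, fun x hx y hy => ?_⟩
      have := hD.2.2 x hx t (by simp)
      simp at hy
      omega
    rw [List.cons_append, hbl]
    have := (knuthEquiv_slide_small hab D hDb).append_right l
    simpa using this

/-! ### Row insertion -/

/-- Inserting `n` into a strictly increasing row `R` turns it into `R'` and passes on `y`. -/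
inductive RowBump : List ℕ → ℕ → List ℕ → ℕ → Prop
  | special (A : List ℕ) (n : ℕ) (B : List ℕ) : (∀ a ∈ A, a < n) →
      RowBump (A ++ n :: (n + 1) :: B) n (A ++ n :: (n + 1) :: B) (n + 1)
  | replace (A : List ℕ) (n r : ℕ) (B : List ℕ) : (∀ a ∈ A, a < n) → n < r →
      RowBump (A ++ r :: B) n (A ++ n :: B) r

theorem rowBump_cases {R : List ℕ} (hR : R.Pairwise (· < ·)) {n : ℕ} (hn : n ∈ R → n + 1 ∈ R) :
    (∀ a ∈ R, a < n) ∨ ∃ R' y, RowBump R n R' y := by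
  induction R with
  | nil => simp
  | cons c R ih =>
    have hc := List.pairwise_cons.1 hR
    rcases lt_trichotomy c n with h | h | h
    · rcases ih hc.2 (fun hm => by
        have := hn (by simp [hm])
        rcases List.mem_cons.1 this with h' | h'
        · omega
        · exact h') with h1 | ⟨R', y, h1⟩
      · left
        intro a ha
        rcases List.mem_cons.1 ha with rfl | ha
        · exact h
        · exact h1 a ha
      · right
        cases h1 with
        | special A _ B hA => exact ⟨_, _, .special (c :: A) n B (by simpa using ⟨h, hA⟩)⟩
        | replace A _ r B hA hr => exact ⟨_, _, .replace (c :: A) n _ B (by simpa using ⟨h, hA⟩) hr⟩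
    · subst h
      have h1 : c + 1 ∈ R := by simpa using hn (by simp)
      cases R with
      | nil => simp at h1
      | cons d R =>
        have h2 : c < d := hc.1 d (by simp)
        have h3 : d = c + 1 := by
          rcases List.mem_cons.1 h1 with h3 | h3
          · exact h3.symm
          · have := (List.pairwise_cons.1 hc.2).1 _ h3
            omega
        subst h3
        exact Or.inr ⟨_, _, .special [] c R (by simp)⟩
    · exact Or.inr ⟨_, _, .replace [] n c R (by simp) h⟩

theorem findIdx?_append_eq {A : List ℕ} {n r : ℕ} (B : List ℕ) (hA : ∀ a ∈ A, a ≤ n) (hr : n < r) :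
    (A ++ r :: B).findIdx? (fun x => n < x) = some A.length := by
  have h1 : A.findIdx? (fun x => n < x) = none := by
    rw [List.findIdx?_eq_none_iff]
    simpa using hA
  rw [List.findIdx?_append, h1, List.findIdx?_cons]
  simp [hr]

theorem egInsert_append {R : List ℕ} {n : ℕ} (T : List (List ℕ)) (h : ∀ a ∈ R, a < n) :
    egInsert n (R :: T) = ((R ++ [n]) :: T, (0, R.length)) := by
  have h1 : R.findIdx? (fun r => n < r) = none := by
    rw [List.findIdx?_eq_none_iff]
    intro a ha
    have := h a ha
    simp
    omega
  rw [egInsert, h1]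

theorem RowBump.egInsert_eq {R R' : List ℕ} {n y : ℕ} (h : RowBump R n R' y) (T : List (List ℕ)) :
    egInsert n (R :: T) = (R' :: (egInsert y T).1, ((egInsert y T).2.1 + 1, (egInsert y T).2.2)) := by
  cases h with
  | special A _ B hA =>
    have h1 : (A ++ n :: (n + 1) :: B).findIdx? (fun r => n < r) = some (A.length + 1) := by
      have := findIdx?_append_eq (A := A ++ [n]) (n := n) (r := n + 1) B (fun a ha => by
        rcases List.mem_append.1 ha with ha | ha
        · exact (hA a ha).le
        · simp at ha; omega) (by omega)
      simpa using this
    rw [egInsert, h1]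
    simp
  | replace A _ r B hA hr =>
    rw [egInsert, findIdx?_append_eq B (fun a ha => (hA a ha).le) hr]
    have h2 : ¬ (1 ≤ A.length ∧ (A ++ y :: B)[A.length - 1]? = some n) := by
      rintro ⟨h2, h3⟩
      rw [List.getElem?_append_left (by omega)] at h3
      have := hA n (List.mem_of_getElem? h3)
      omega
    simp only [h2, and_false, if_false]
    simp [List.set_append_right]

theorem RowBump.pairwise {R R' : List ℕ} {n y : ℕ} (h : RowBump R n R' y)
    (hR : R.Pairwise (· < ·)) : R'.Pairwise (· < ·) := by
  cases h with
  | special => exact hR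
  | replace A _ r B hA hr =>
    rw [List.pairwise_append] at hR ⊢
    have h1 := List.pairwise_cons.1 hR.2.1
    refine ⟨hR.1, List.pairwise_cons.2 ⟨fun b hb => hr.trans (h1.1 b hb), h1.2⟩,
      fun a ha b hb => ?_⟩
    rcases List.mem_cons.1 hb with rfl | hb
    · exact hA a ha
    · exact hR.2.2 a ha b (by simp [hb])

/-- Row insertion is a sequence of Coxeter–Knuth moves. -/
theorem RowBump.knuthEquiv {R R' : List ℕ} {n y : ℕ} (h : RowBump R n R' y)
    (hR : R.Pairwise (· < ·)) : KnuthEquiv 0 (n :: R.reverse) (R'.reverse ++ [y]) := by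
  cases h with
  | special A _ B hA =>
    rw [List.pairwise_append] at hR
    have h1 : (B.reverse ++ [n + 1]).Pairwise (· > ·) := by
      have := List.pairwise_reverse.2 (List.Pairwise.of_cons hR.2.1)
      simpa using this
    have h2 : (n :: A.reverse).Pairwise (· > ·) :=
      List.pairwise_cons.2 ⟨by simpa using hA, List.pairwise_reverse.2 hR.1⟩
    have e1 := (knuthEquiv_slide_small (a := n) (by omega) _ h1).append_right (n :: A.reverse)
    have e2 := ((KnuthTriple.braid n).equiv A.reverse).prepend B.reverse
    have e3 := (knuthEquiv_slide_large (r := n + 1) A.reverse n (by omega) h2).prepend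
      (B.reverse ++ [n + 1])
    have e4 : KnuthEquiv 0 (n :: (B.reverse ++ (n + 1) :: n :: A.reverse))
        (B.reverse ++ n :: (n + 1) :: n :: A.reverse) := by simpa using e1
    have e5 : KnuthEquiv 0 (B.reverse ++ (n + 1) :: n :: (n + 1) :: A.reverse)
        (B.reverse ++ (n + 1) :: n :: (A.reverse ++ [n + 1])) := by simpa using e3
    simpa using (e4.trans e2).trans e5
  | replace A _ r B hA hr =>
    rw [List.pairwise_append] at hR
    have h1 : (B.reverse ++ [y]).Pairwise (· > ·) := by
      have := List.pairwise_reverse.2 hR.2.1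
      simpa using this
    have h2 : (n :: A.reverse).Pairwise (· > ·) :=
      List.pairwise_cons.2 ⟨by simpa using hA, List.pairwise_reverse.2 hR.1⟩
    have e1 := (knuthEquiv_slide_small hr _ h1).append_right A.reverse
    have e2 := (knuthEquiv_slide_large (r := y) A.reverse n hr h2).prepend B.reverse
    have e4 : KnuthEquiv 0 (n :: (B.reverse ++ y :: A.reverse))
        (B.reverse ++ n :: y :: A.reverse) := by simpa using e1
    simpa using e4.trans e2

theorem PosDistinct.append_right {u v : List ℕ} (h : PosDistinct (u ++ v)) : PosDistinct v :=
  ⟨fun x hx => h.pos x (by simp [hx]), h.distinct.append_right⟩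

theorem PosDistinct.append_left {u v : List ℕ} (h : PosDistinct (u ++ v)) : PosDistinct u :=
  ⟨fun x hx => h.pos x (by simp [hx]), h.distinct.append_left⟩

/-- In a reduced word, the exceptional case of row insertion is the only one in which the letter
inserted already occurs. -/
theorem succ_mem_of_posDistinct {n : ℕ} {R : List ℕ} (hR : R.Pairwise (· < ·))
    (h : PosDistinct (n :: R.reverse)) (hn : n ∈ R) : n + 1 ∈ R := by
  obtain ⟨A, B, rfl⟩ := List.append_of_mem hn
  rw [List.pairwise_append] at hR
  have hB := List.pairwise_cons.1 hR.2.1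
  cases B with
  | nil =>
    have h' : PosDistinct (n :: n :: A.reverse) := by simpa using h
    exact absurd rfl (h'.distinct.getD_succ_ne (l := 0) (by simp))
  | cons b B =>
    have hnb : n < b := hB.1 b (by simp)
    by_contra hc
    have hne : b ≠ n + 1 := by
      rintro rfl
      exact hc (by simp)
    have h1 : (B.reverse ++ [b]).Pairwise (· > ·) := by
      have := List.pairwise_reverse.2 hB.2
      simpa using this
    have e1 := (knuthEquiv_slide_small hnb _ h1).append_right (n :: A.reverse)
    have h2 : PosDistinct ((n :: (B.reverse ++ [b])) ++ n :: A.reverse) := by simpa using h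
    have h3 : PosDistinct (B.reverse ++ ([n, b, n] ++ A.reverse)) := by
      simpa using e1.posDistinct_iff.1 h2
    have h4 := h3.append_right.append_left.distinct (i := 2) (j := 0) (by simp) (by simp)
      (swapPair_conflict_outer n (Or.inr (by omega)) rfl)
    omega

/-! ### Increasing tableaux -/

/-- Row `S` can stand below row `R` in an increasing tableau. -/
def ColLess (R S : List ℕ) : Prop :=
  S.length ≤ R.length ∧ ∀ j < S.length, R.getD j 0 < S.getD j 0

/-- Tableaux, given by their lists of rows, with strictly increasing rows and columns. -/
structure IsIncreasing (T : List (List ℕ)) : Prop where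
  rows : ∀ R ∈ T, R.Pairwise (· < ·)
  cols : T.IsChain ColLess

/-- The row reading word: the rows from top to bottom, each read from right to left. -/
def rowWord (T : List (List ℕ)) : List ℕ := (T.map List.reverse).flatten

theorem rowWord_cons (R : List ℕ) (T : List (List ℕ)) :
    rowWord (R :: T) = R.reverse ++ rowWord T := rfl

/-- The entry `y` passed on from a row `R` stands at some place `j` of `R`, and the places of the
new row up to `j` hold entries at most `y`. -/
theorem RowBump.exists_index {R R' : List ℕ} {n y : ℕ} (h : RowBump R n R' y) :
    R'.length = R.length ∧ ∃ j < R.length, R.getD j 0 = y ∧ (∀ i, R'.getD i 0 ≤ R.getD i 0) ∧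
      (∀ i < j, R'.getD i 0 < y) ∧
      (R'.getD j 0 < y ∨ R'.getD j 0 = y ∧ 1 ≤ j ∧ R.getD (j - 1) 0 + 1 = y) := by
  cases h with
  | special A _ B hA =>
    refine ⟨rfl, A.length + 1, by simp, ?_, fun i => le_rfl, fun i hi => ?_, Or.inr ⟨?_, ?_⟩⟩
    · simp
    · rcases lt_or_ge i A.length with h | h
      · rw [List.getD_append _ _ _ _ h, List.getD_eq_getElem _ _ h]
        have := hA _ (List.getElem_mem h)
        omega
      · have : i = A.length := by omega
        subst this
        simp
    · simp
    · simp
  | replace A _ r B hA hr =>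
    refine ⟨by simp, A.length, by simp, ?_, fun i => ?_, fun i hi => ?_, Or.inl ?_⟩
    · simp
    · rcases lt_or_ge i A.length with h | h
      · rw [List.getD_append _ _ _ _ h, List.getD_append _ _ _ _ h]
      · rw [List.getD_append_right _ _ _ _ h, List.getD_append_right _ _ _ _ h]
        obtain ⟨k, rfl⟩ := Nat.exists_eq_add_of_le h
        cases k with
        | zero => simpa using hr.le
        | succ k => simp
    · rw [List.getD_append _ _ _ _ hi, List.getD_eq_getElem _ _ hi]
      have := hA _ (List.getElem_mem hi)
      omega
    · simpa [List.getD_append_right] using hr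

/-- Only one entry of a row changes, namely to the entry inserted, and the entries before it are
smaller. -/
theorem RowBump.getD_cases {R R' : List ℕ} {n y : ℕ} (h : RowBump R n R' y) (i : ℕ) :
    R'.getD i 0 = R.getD i 0 ∨ (R'.getD i 0 = n ∧ ∀ k < i, R.getD k 0 < n) := by
  cases h with
  | special => exact Or.inl rfl
  | replace A _ r B hA hr =>
    rcases lt_or_ge i A.length with h | h
    · rw [List.getD_append _ _ _ _ h, List.getD_append _ _ _ _ h]; exact Or.inl rfl
    · rw [List.getD_append_right _ _ _ _ h, List.getD_append_right _ _ _ _ h]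
      obtain ⟨k, rfl⟩ := Nat.exists_eq_add_of_le h
      cases k with
      | zero =>
        refine Or.inr ⟨by simp, fun k hk => ?_⟩
        rw [Nat.add_zero] at hk
        rw [List.getD_append _ _ _ _ hk, List.getD_eq_getElem _ _ hk]
        exact hA _ (List.getElem_mem hk)
      | succ k => exact Or.inl (by simp)

theorem RowBump.colLess_append {R R' S : List ℕ} {n y : ℕ} (h : RowBump R n R' y)
    (hRS : ColLess R S) (hS : ∀ a ∈ S, a < y) : ColLess R' (S ++ [y]) := by
  obtain ⟨hlen, j, hj, hjy, hle, hlt, hlast⟩ := h.exists_index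
  have hS' : ∀ k < S.length, S.getD k 0 < y := fun k hk => by
    rw [List.getD_eq_getElem _ _ hk]; exact hS _ (List.getElem_mem hk)
  have hSj : S.length ≤ j := by
    by_contra hc
    have h1 := hRS.2 j (by omega)
    have h2 := hS' j (by omega)
    omega
  refine ⟨by simp; omega, fun i hi => ?_⟩
  rcases lt_or_ge i S.length with h1 | h1
  · rw [List.getD_append _ _ _ _ h1]
    exact (hle i).trans_lt (hRS.2 i h1)
  · have : i = S.length := by simp at hi; omega
    subst this
    have e : (S ++ [y]).getD S.length 0 = y := by simp
    rw [e]
    rcases hSj.lt_or_eq with h2 | h2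
    · exact hlt _ h2
    · rw [h2]
      rcases hlast with h3 | ⟨-, h3, h4⟩
      · exact h3
      · have h5 := hRS.2 (j - 1) (by omega)
        have h6 := hS' (j - 1) (by omega)
        omega

theorem RowBump.colLess {R R' S S' : List ℕ} {n y z : ℕ} (h : RowBump R n R' y)
    (hRS : ColLess R S) (hS : RowBump S y S' z) : ColLess R' S' := by
  obtain ⟨hlen, j, hj, hjy, hle, hlt, hlast⟩ := h.exists_index
  have hlenS := hS.exists_index.1
  have hl := hRS.1
  refine ⟨by omega, fun i hi => ?_⟩
  have h0 := hRS.2 i (by omega)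
  rcases hS.getD_cases i with h1 | ⟨h1, h2⟩
  · rw [h1]
    exact (hle i).trans_lt h0
  · rw [h1]
    rcases lt_trichotomy i j with h3 | h3 | h3
    · exact hlt i h3
    · subst h3
      rcases hlast with h4 | ⟨-, h4, h5⟩
      · exact h4
      · have h6 := hRS.2 (i - 1) (by omega)
        have h7 := h2 (i - 1) (by omega)
        omega
    · have h4 := hRS.2 j (by omega)
      have h5 := h2 j h3
      omega

theorem ColLess.append {R S : List ℕ} (h : ColLess R S) (n : ℕ) : ColLess (R ++ [n]) S := by
  have := h.1
  refine ⟨by simp; omega, fun j hj => ?_⟩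
  rw [List.getD_append _ _ _ _ (by omega)]
  exact h.2 j hj

theorem IsIncreasing.tail {R : List ℕ} {T : List (List ℕ)} (h : IsIncreasing (R :: T)) :
    IsIncreasing T :=
  ⟨fun S hS => h.rows S (by simp [hS]), h.cols.tail⟩

theorem pairwise_append_singleton {R : List ℕ} {n : ℕ} (hR : R.Pairwise (· < ·))
    (h : ∀ a ∈ R, a < n) : (R ++ [n]).Pairwise (· < ·) := by
  rw [List.pairwise_append]
  exact ⟨hR, by simp, by simpa using h⟩

/-- Edelman–Greene insertion of a letter that keeps the reading word reduced gives an increasing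
tableau, whose reading word arises by Coxeter–Knuth moves. -/
theorem egInsert_spec (T : List (List ℕ)) : ∀ n, IsIncreasing T → PosDistinct (n :: rowWord T) →
    IsIncreasing (egInsert n T).1 ∧
      KnuthEquiv 0 (n :: rowWord T) (rowWord (egInsert n T).1) := by
  induction T with
  | nil =>
    intro n _ _
    refine ⟨⟨?_, ?_⟩, ?_⟩
    · simp [egInsert]
    · simp [egInsert]
    · exact .refl _ _
  | cons R T ih =>
    intro n hT hw
    have hR := hT.rows R (by simp)
    rw [rowWord_cons] at hw ⊢
    have hw1 : PosDistinct (n :: R.reverse) := PosDistinct.append_left (v := rowWord T)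
      (by simpa using hw)
    rcases rowBump_cases hR (succ_mem_of_posDistinct hR hw1) with h | ⟨R', y, h⟩
    · rw [egInsert_append T h]
      refine ⟨⟨?_, ?_⟩, .of_eq (by simp [rowWord_cons])⟩
      · intro S hS
        rcases List.mem_cons.1 hS with rfl | hS
        · exact pairwise_append_singleton hR h
        · exact hT.rows S (by simp [hS])
      · have := hT.cols
        cases T with
        | nil => simp
        | cons S T =>
          rw [List.isChain_cons_cons] at this ⊢
          exact ⟨this.1.append n, this.2⟩
    · rw [h.egInsert_eq]
      have e1 : KnuthEquiv 0 (n :: (R.reverse ++ rowWord T)) (R'.reverse ++ (y :: rowWord T)) := by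
        simpa using (h.knuthEquiv hR).append_right (rowWord T)
      have hy := (e1.posDistinct_iff.1 hw).append_right
      obtain ⟨h1, h2⟩ := ih y hT.tail hy
      refine ⟨⟨?_, ?_⟩, e1.trans (h2.prepend _)⟩
      · intro S hS
        rcases List.mem_cons.1 hS with rfl | hS
        · exact h.pairwise hR
        · exact h1.rows S hS
      · have hc := hT.cols
        have hc1 := h1.cols
        cases T with
        | nil =>
          have : ColLess R [] := ⟨by simp, by simp⟩
          have := h.colLess_append this (by simp)
          simpa [egInsert] using this
        | cons S T =>
          have hS := hT.rows S (by simp)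
          rw [List.isChain_cons_cons] at hc
          have hw2 : PosDistinct (y :: S.reverse) := PosDistinct.append_left (v := rowWord T)
            (by simpa [rowWord_cons] using hy)
          rcases rowBump_cases hS (succ_mem_of_posDistinct hS hw2) with h3 | ⟨S', z, h3⟩
          · rw [egInsert_append T h3] at hc1 ⊢
            exact List.isChain_cons_cons.2 ⟨h.colLess_append hc.1 h3, hc1⟩
          · rw [h3.egInsert_eq] at hc1 ⊢
            exact List.isChain_cons_cons.2 ⟨h.colLess hc.1 h3, hc1⟩

/-- The insertion tableau of a reduced word is increasing, and its reading word is Coxeter–Knuth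
equivalent to the word. -/
theorem insertionTableau_spec {w : List ℕ} (hw : PosDistinct w) :
    IsIncreasing (insertionTableau w) ∧ KnuthEquiv 0 w (rowWord (insertionTableau w)) := by
  induction w with
  | nil => exact ⟨⟨by simp [insertionTableau], by simp [insertionTableau]⟩, .refl _ _⟩
  | cons x w ih =>
    obtain ⟨h1, h2⟩ := ih (PosDistinct.append_right (u := [x]) hw)
    have h3 := h2.cons x
    obtain ⟨h4, h5⟩ := egInsert_spec _ x h1 (h3.posDistinct_iff.1 hw)
    exact ⟨h4, h3.trans h5⟩

/-! ### Column reading -/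

/-- The first column of a tableau. -/
def heads (T : List (List ℕ)) : List ℕ := T.filterMap List.head?

/-- The tableau without its first column. -/
def tails (T : List (List ℕ)) : List (List ℕ) := T.map List.tail

theorem ColLess.trans {R S U : List ℕ} (h1 : ColLess R S) (h2 : ColLess S U) : ColLess R U :=
  ⟨h2.1.trans h1.1, fun j hj => (h1.2 j (hj.trans_le h2.1)).trans (h2.2 j hj)⟩

instance : IsTrans (List ℕ) ColLess := ⟨fun _ _ _ => ColLess.trans⟩

theorem ColLess.tail {R S : List ℕ} (h : ColLess R S) : ColLess R.tail S.tail := by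
  have := h.1
  refine ⟨by simp; omega, fun j hj => ?_⟩
  rw [List.length_tail] at hj
  have := h.2 (j + 1) (by omega)
  simpa [List.getD_eq_getElem?_getD] using this

theorem IsIncreasing.tails {T : List (List ℕ)} (h : IsIncreasing T) :
    IsIncreasing (LittleEG.tails T) := by
  refine ⟨fun R hR => ?_, ?_⟩
  · obtain ⟨S, hS, rfl⟩ := List.mem_map.1 hR
    exact (h.rows S hS).tail
  · rw [LittleEG.tails, List.isChain_map]
    exact h.cols.imp fun _ _ => ColLess.tail

theorem IsIncreasing.pairwise_heads {T : List (List ℕ)} (h : IsIncreasing T) :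
    (heads T).Pairwise (· < ·) := by
  rw [heads, List.pairwise_filterMap]
  refine h.cols.pairwise.imp fun {R S} hRS a ha b hb => ?_
  cases R with
  | nil => simp at ha
  | cons x R =>
    cases S with
    | nil => simp at hb
    | cons y S =>
      have := hRS.2 0 (by simp)
      simp at this ha hb
      omega

/-- A column, preceded by an increasing run of smaller letters, slides out of the reading word. -/
theorem knuthEquiv_column (T : List (List ℕ)) : ∀ cs : List ℕ,
    (∀ R ∈ T, R.Pairwise (· < ·)) → (cs ++ heads T).Pairwise (· < ·) →
    KnuthEquiv 0 (cs ++ rowWord T) (rowWord (tails T) ++ (cs ++ heads T)) := by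
  induction T with
  | nil => exact fun cs _ _ => .of_eq (by simp [rowWord, tails, heads])
  | cons R T ih =>
    intro cs hT hcs
    cases R with
    | nil => exact ih cs (fun R hR => hT R (by simp [hR])) hcs
    | cons t R =>
      have hR := hT (t :: R) (by simp)
      have e0 : heads ((t :: R) :: T) = t :: heads T := rfl
      rw [e0] at hcs ⊢
      have h1 : (cs ++ [t]).Pairwise (· < ·) := by
        refine hcs.sublist ?_
        simp
      have h2 : (R.reverse ++ [t]).Pairwise (· > ·) := by
        simpa using List.pairwise_reverse.2 hR
      have e1 := (knuthEquiv_slide_column h2 cs h1).append_right (rowWord T)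
      have e2 := (ih (cs ++ [t]) (fun R hR => hT R (by simp [hR])) (by simpa using hcs)).prepend
        R.reverse
      have e3 : KnuthEquiv 0 (cs ++ (R.reverse ++ t :: rowWord T))
          (R.reverse ++ (cs ++ t :: rowWord T)) := by simpa using e1
      have e4 : KnuthEquiv 0 (R.reverse ++ (cs ++ t :: rowWord T))
          (R.reverse ++ (rowWord (tails T) ++ (cs ++ t :: heads T))) := by simpa using e2
      simpa [rowWord_cons, tails] using e3.trans e4

/-- The first `n` columns of a tableau, the first column last. -/
def columns : ℕ → List (List ℕ) → List (List ℕ)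
  | 0, _ => []
  | n + 1, T => columns n (tails T) ++ [heads T]

/-- Up to Coxeter–Knuth moves, the reading word ends with any number of columns of the tableau. -/
theorem exists_knuthEquiv_columns (n : ℕ) : ∀ T : List (List ℕ), IsIncreasing T →
    ∃ v, KnuthEquiv 0 (rowWord T) (v ++ (columns n T).flatten) := by
  induction n with
  | zero => exact fun T _ => ⟨rowWord T, .of_eq (by simp [columns])⟩
  | succ n ih =>
    intro T hT
    obtain ⟨v, hv⟩ := ih (tails T) hT.tails
    have e1 := knuthEquiv_column T [] hT.rows hT.pairwise_heads
    refine ⟨v, e1.trans ?_⟩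
    simpa [columns] using hv.append_right (heads T)

theorem IsIncreasing.columns_pairwise (n : ℕ) : ∀ T : List (List ℕ), IsIncreasing T →
    ∀ C ∈ columns n T, C.Pairwise (· < ·) := by
  induction n with
  | zero => simp [columns]
  | succ n ih =>
    intro T hT C hC
    rcases List.mem_append.1 hC with hC | hC
    · exact ih _ hT.tails C hC
    · obtain rfl := List.mem_singleton.1 hC
      exact hT.pairwise_heads

/-! ### Shapes and recording tableaux -/

/-- The length of row `r` of the tableau with the list of rows `T`. -/
def rowLen (T : List (List ℕ)) (r : ℕ) : ℕ := (T.getD r []).length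

@[simp] theorem rowLen_cons_zero (R : List ℕ) (T : List (List ℕ)) :
    rowLen (R :: T) 0 = R.length := rfl

@[simp] theorem rowLen_cons_succ (R : List ℕ) (T : List (List ℕ)) (r : ℕ) :
    rowLen (R :: T) (r + 1) = rowLen T r := rfl

@[simp] theorem rowLen_nil (r : ℕ) : rowLen [] r = 0 := rfl

/-- Insertion adds one box, at the end of a row. -/
theorem egInsert_shape (T : List (List ℕ)) : ∀ n,
    (egInsert n T).2.2 = rowLen T (egInsert n T).2.1 ∧
    ∀ r, rowLen (egInsert n T).1 r =
      if r = (egInsert n T).2.1 then rowLen T r + 1 else rowLen T r := by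
  induction T with
  | nil =>
    intro n
    refine ⟨rfl, fun r => ?_⟩
    cases r <;> simp [egInsert]
  | cons R T ih =>
    intro n
    rw [egInsert]
    split
    · refine ⟨rfl, fun r => ?_⟩
      cases r <;> simp
    · split_ifs
      · refine ⟨(ih _).1, fun r => ?_⟩
        cases r with
        | zero => simp
        | succ r => simpa using (ih _).2 r
      · refine ⟨(ih _).1, fun r => ?_⟩
        cases r with
        | zero => simp
        | succ r => simpa using (ih _).2 r

theorem egInsert_length_le (T : List (List ℕ)) : ∀ n, (egInsert n T).1.length ≤ T.length + 1 := by
  induction T with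
  | nil => intro n; simp [egInsert]
  | cons R T ih =>
    intro n
    rw [egInsert]
    split
    · simp
    · split_ifs <;> simpa using ih _

theorem insertionTableau_length_le (w : List ℕ) : (insertionTableau w).length ≤ w.length := by
  induction w with
  | nil => simp [insertionTableau]
  | cons x w ih =>
    have := egInsert_length_le (insertionTableau w) x
    simp only [insertionTableau, List.length_cons]
    omega

theorem rowLen_le_append (v w : List ℕ) (r : ℕ) :
    rowLen (insertionTableau w) r ≤ rowLen (insertionTableau (v ++ w)) r := by
  induction v with
  | nil => rfl
  | cons x v ih =>
    refine ih.trans ?_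
    have := (egInsert_shape (insertionTableau (v ++ w)) x).2 r
    rw [List.cons_append, insertionTableau, this]
    split_ifs <;> omega

/-- The recording tableau is determined by the shapes of the insertion tableaux of the suffixes. -/
theorem recordingTableau_congr : ∀ (w g : List ℕ), w.length = g.length →
    (∀ n r, rowLen (insertionTableau (w.drop n)) r = rowLen (insertionTableau (g.drop n)) r) →
    recordingTableau w = recordingTableau g
  | [], [], _, _ => rfl
  | x :: w, y :: g, hl, h => by
    have hl' : w.length = g.length := by simpa using hl
    have ih := recordingTableau_congr w g hl' (fun n r => h (n + 1) r)
    have h0 : ∀ r, rowLen (insertionTableau w) r = rowLen (insertionTableau g) r := h 1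
    have h1 : ∀ r, rowLen (egInsert x (insertionTableau w)).1 r =
        rowLen (egInsert y (insertionTableau g)).1 r := h 0
    obtain ⟨a1, a2⟩ := egInsert_shape (insertionTableau w) x
    obtain ⟨b1, b2⟩ := egInsert_shape (insertionTableau g) y
    have hrow : (egInsert x (insertionTableau w)).2.1 = (egInsert y (insertionTableau g)).2.1 := by
      by_contra hne
      have := h1 (egInsert x (insertionTableau w)).2.1
      rw [a2, b2, if_pos rfl, if_neg hne, h0] at this
      omega
    have hcell : (egInsert x (insertionTableau w)).2 = (egInsert y (insertionTableau g)).2 :=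
      Prod.ext hrow (by rw [a1, b1, hrow, h0])
    funext r c
    simp only [recordingTableau, hcell, ih, hl']

/-! ### Insertion of Grassmannian words -/

/-- `σ` has no descent except possibly at `k`. -/
def OnlyDescent (k : ℕ) (σ : Equiv.Perm ℕ) : Prop := ∀ d, IsDescent σ d → d = k

/-- `σ` is the permutation, with all descents at `k`, that belongs to the partition with row
lengths `lam` and column lengths `h`. -/
structure GrassShape (k : ℕ) (σ : Equiv.Perm ℕ) (lam h : ℕ → ℕ) : Prop where
  row : ∀ r < k, σ (k - r) = k - r + lam r
  col : ∀ c, σ (k + 1 + c) + h c = k + 1 + c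
  lt_iff : ∀ r c, c < lam r ↔ r < h c
  zero : ∀ r, k ≤ r → lam r = 0

/-- Row `r` of the insertion tableau of a Grassmannian word. -/
def grassRow (k : ℕ) (lam h : ℕ → ℕ) (r : ℕ) : List ℕ :=
  (List.range (lam r)).map fun c => k + 1 + c + r - h c

/-- The insertion tableau of a Grassmannian word: in column `c` the entries are consecutive, the
last one being `k + c`. -/
def grassInsertionTableau (k : ℕ) (lam h : ℕ → ℕ) : List (List ℕ) :=
  (List.range (h 0)).map (grassRow k lam h)

/-- The row lengths after adding the box at the end of row `r₀`. -/
def addBox (lam : ℕ → ℕ) (r₀ : ℕ) : ℕ → ℕ := fun r => if r = r₀ then lam r + 1 else lam r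

theorem GrassShape.rowLen_eq {k : ℕ} {σ : Equiv.Perm ℕ} {lam h : ℕ → ℕ}
    (hs : GrassShape k σ lam h) (r : ℕ) : rowLen (grassInsertionTableau k lam h) r = lam r := by
  unfold rowLen grassInsertionTableau
  by_cases hr : r < h 0
  · rw [List.getD_eq_getElem _ _ (by simpa using hr)]
    simp [grassRow]
  · rw [List.getD_eq_default _ _ (by simpa using hr)]
    have := hs.lt_iff r 0
    simp
    omega

theorem range_split {n c : ℕ} (h : c < n) :
    List.range n = List.range c ++ c :: List.range' (c + 1) (n - c - 1) := by
  have h1 := @List.range'_append_1 0 c (n - c)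
  rw [Nat.zero_add, Nat.add_sub_cancel' h.le, show n - c = (n - c - 1) + 1 by omega,
    List.range'_succ] at h1
  rw [List.range_eq_range', List.range_eq_range', ← h1]

/-- Inserting the letter of an addable box moves a whole column down by one place. -/
theorem egInsert_grassRows {k x r₀ c₀ : ℕ} {lam h : ℕ → ℕ}
    (hiff : ∀ r c, c < lam r ↔ r < h c) (hr : r₀ < k) (hlam : lam r₀ = c₀) (hh : h c₀ = r₀)
    (hx : x + r₀ = k + c₀) (d : ℕ) : ∀ s, s + d = r₀ →
    egInsert (x + s) ((List.range' s (h 0 - s)).map (grassRow k lam h)) =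
      ((List.range' s (addBox h c₀ 0 - s)).map (grassRow k (addBox lam r₀) (addBox h c₀)), (d, c₀)) := by
  have hrest : ∀ r, r₀ < r → grassRow k (addBox lam r₀) (addBox h c₀) r = grassRow k lam h r := by
    intro r hr
    have e1 : addBox lam r₀ r = lam r := if_neg (by omega)
    unfold grassRow
    rw [e1]
    refine List.map_congr_left fun c hc => ?_
    have hc' := (hiff r c).1 (List.mem_range.1 hc)
    have e2 : addBox h c₀ c = h c := if_neg (by rintro rfl; omega)
    rw [e2]
  induction d with
  | zero =>
    intro s hs
    have hs : s = r₀ := by omega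
    subst hs
    rcases Nat.eq_zero_or_pos c₀ with h0 | h0
    · subst h0
      have e1 : addBox h 0 0 - s = 1 := by simp [addBox, hh]
      have e2 : h 0 - s = 0 := by omega
      rw [e1, e2]
      simp [egInsert, grassRow, addBox, hlam, hh]
      omega
    · have h1 : s < h 0 := (hiff s 0).1 (by omega)
      have e1 : addBox h c₀ 0 = h 0 := if_neg (by omega)
      rw [e1, show h 0 - s = (h 0 - s - 1) + 1 by omega, List.range'_succ, List.map_cons,
        List.map_cons]
      have hrow : grassRow k (addBox lam s) (addBox h c₀) s = grassRow k lam h s ++ [x + s] := by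
        unfold grassRow
        have e2 : addBox lam s s = lam s + 1 := if_pos rfl
        rw [e2, List.range_succ, List.map_append]
        congr 1
        · refine List.map_congr_left fun c hc => ?_
          have e3 : addBox h c₀ c = h c := if_neg (by have := List.mem_range.1 hc; omega)
          rw [e3]
        · have e3 : addBox h c₀ (lam s) = s + 1 := by rw [hlam, addBox, if_pos rfl, hh]
          rw [List.map_singleton, e3, hlam]
          congr 1
          omega
      rw [egInsert_append, hrow]
      · congr 1
        · congr 1
          refine List.map_congr_left fun r hr => (hrest r ?_).symm
          have := List.mem_range'_1.1 hr
          omega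
        · simp [grassRow, hlam]
      · intro a ha
        obtain ⟨c, hc, rfl⟩ := List.mem_map.1 ha
        have hc' := List.mem_range.1 hc
        have := (hiff s c).1 hc'
        omega
  | succ d ih =>
    intro s hs
    have h1 : c₀ < lam s := (hiff s c₀).2 (by omega)
    have h2 : s < h 0 := (hiff s 0).1 (by omega)
    have e1 : h 0 - s = (h 0 - (s + 1)) + 1 := by omega
    have e2 : addBox h c₀ 0 - s = (addBox h c₀ 0 - (s + 1)) + 1 := by
      unfold addBox; split_ifs <;> omega
    have hA : ∀ c < c₀, addBox h c₀ c = h c := fun c hc => if_neg (by omega)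
    have hB : ∀ c, c₀ < c → addBox h c₀ c = h c := fun c hc => if_neg (by omega)
    rw [e1, e2, List.range'_succ, List.range'_succ, List.map_cons, List.map_cons]
    set A := (List.range c₀).map fun c => k + 1 + c + s - h c with hAdef
    set B := (List.range' (c₀ + 1) (lam s - c₀ - 1)).map fun c => k + 1 + c + s - h c with hBdef
    have hrow : grassRow k lam h s = A ++ (x + s + 1) :: B := by
      rw [grassRow, range_split h1, List.map_append, List.map_cons, hh]
      congr 2
      omega
    have hrow' : grassRow k (addBox lam r₀) (addBox h c₀) s = A ++ (x + s) :: B := by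
      have e3 : addBox lam r₀ s = lam s := if_neg (by omega)
      have e4 : addBox h c₀ c₀ = r₀ + 1 := by rw [addBox, if_pos rfl, hh]
      rw [grassRow, e3, range_split h1, List.map_append, List.map_cons, e4]
      congr 1
      · exact List.map_congr_left fun c hc => by rw [hA c (List.mem_range.1 hc)]
      · congr 1
        · omega
        · exact List.map_congr_left fun c hc => by
            rw [hB c (by have := List.mem_range'_1.1 hc; omega)]
    have hb : RowBump (grassRow k lam h s) (x + s)
        (grassRow k (addBox lam r₀) (addBox h c₀) s) (x + s + 1) := by
      rw [hrow, hrow']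
      refine .replace A (x + s) (x + s + 1) B (fun a ha => ?_) (by omega)
      obtain ⟨c, hc, rfl⟩ := List.mem_map.1 ha
      have hc' := List.mem_range.1 hc
      have := (hiff r₀ c).1 (by omega)
      omega
    rw [hb.egInsert_eq, Nat.add_assoc, ih (s + 1) (by omega)]

/-- Deleting the first letter `x` of a Grassmannian word creates no new descent, and `x` exchanges
a value at a place up to `k` with a value at a place after `k`. -/
theorem OnlyDescent.cons {k x : ℕ} {w : List ℕ} (hw : PosDistinct (x :: w))
    (hk : OnlyDescent k (wordPerm (x :: w))) :
    OnlyDescent k (wordPerm w) ∧ ∃ p q, p ≤ k ∧ 0 < p ∧ k < q ∧ wordPerm (x :: w) p = x + 1 ∧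
      wordPerm (x :: w) q = x := by
  set τ := wordPerm (x :: w) with hτ
  have hσ : ∀ y, wordPerm w y = simpleSwap x (τ y) := by
    intro y
    rw [hτ, wordPerm_cons, Equiv.Perm.mul_apply]
    simp [simpleSwap]
  have hinv : τ.symm (x + 1) < τ.symm x :=
    hw.distinct.inverted (l := 0) (by simp) (by omega) rfl
  have hval : τ (τ.symm x) < τ (τ.symm (x + 1)) := by
    rw [Equiv.apply_symm_apply, Equiv.apply_symm_apply]; omega
  obtain ⟨d, hd1, hd2, hd⟩ := exists_isDescent hinv hval
  obtain rfl := hk d hd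
  have h0 : τ 0 = 0 := wordPerm_apply_zero hw.pos
  refine ⟨fun d' hd' => ?_, τ.symm (x + 1), τ.symm x, hd1, ?_, hd2, by simp, by simp⟩
  · unfold IsDescent at hd'
    rw [hσ, hσ, simpleSwap_lt_iff] at hd'
    split_ifs at hd' with h
    · rcases Sym2.eq_iff.1 h with ⟨h1, h2⟩ | ⟨h1, h2⟩
      · have q1 := (Equiv.symm_apply_eq τ).2 h1.symm
        have q2 := (Equiv.symm_apply_eq τ).2 h2.symm
        omega
      · have q1 := (Equiv.symm_apply_eq τ).2 h1.symm
        have q2 := (Equiv.symm_apply_eq τ).2 h2.symm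
        omega
    · exact hk d' hd'
  · by_contra hc
    have h1 : τ.symm (x + 1) = 0 := by omega
    rw [Equiv.symm_apply_eq, h0] at h1
    omega

/-- Prepending a letter to a Grassmannian word adds a box to its partition; the letter is `k` plus
the content of the box. -/
theorem GrassShape.cons {k x : ℕ} {w : List ℕ} (hw : PosDistinct (x :: w))
    (hk : OnlyDescent k (wordPerm (x :: w))) {lam h : ℕ → ℕ}
    (hs : GrassShape k (wordPerm w) lam h) :
    ∃ r₀ c₀, r₀ < k ∧ lam r₀ = c₀ ∧ h c₀ = r₀ ∧ x + r₀ = k + c₀ ∧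
      wordPerm (x :: w) (k - r₀) = x + 1 ∧ wordPerm (x :: w) (k + 1 + c₀) = x ∧
      GrassShape k (wordPerm (x :: w)) (addBox lam r₀) (addBox h c₀) := by
  obtain ⟨-, p, q, hp, hp0, hq, hxp, hxq⟩ := hk.cons hw
  obtain ⟨c₀, rfl⟩ := Nat.exists_eq_add_of_le hq
  obtain ⟨r₀, hr₀, rfl⟩ : ∃ r₀ < k, p = k - r₀ := ⟨k - p, by omega, by omega⟩
  rw [Nat.succ_eq_add_one] at hxq
  have hτ : ∀ y, wordPerm (x :: w) y = simpleSwap x (wordPerm w y) := by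
    intro y; rw [wordPerm_cons]; rfl
  have hσ : ∀ y, wordPerm w y = simpleSwap x (wordPerm (x :: w) y) := by
    intro y; rw [hτ]; simp [simpleSwap]
  have e1 : wordPerm w (k - r₀) = x := by rw [hσ, hxp, simpleSwap_right]
  have e2 : wordPerm w (k + 1 + c₀) = x + 1 := by rw [hσ, hxq, simpleSwap_left]
  have f1 := hs.row r₀ hr₀
  have f2 := hs.col c₀
  have f3 := hs.lt_iff r₀ c₀
  rw [e1] at f1
  rw [e2] at f2
  have hlam : lam r₀ = c₀ := by omega
  have hh : h c₀ = r₀ := by omega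
  refine ⟨r₀, c₀, hr₀, hlam, hh, by omega, hxp, hxq, fun r hr => ?_, fun c => ?_, fun r c => ?_,
    fun r hr => ?_⟩
  · unfold addBox
    split_ifs with h1
    · subst h1
      rw [hxp]
      omega
    · have g1 : wordPerm w (k - r) ≠ x := fun h => by
        have := (wordPerm w).injective (h.trans e1.symm)
        omega
      have g2 : wordPerm w (k - r) ≠ x + 1 := fun h => by
        have := (wordPerm w).injective (h.trans e2.symm)
        omega
      rw [hτ, simpleSwap_of_ne g1 g2, hs.row r hr]
  · unfold addBox
    split_ifs with h1
    · subst h1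
      rw [hxq]
      omega
    · have g1 : wordPerm w (k + 1 + c) ≠ x := fun h => by
        have := (wordPerm w).injective (h.trans e1.symm)
        omega
      have g2 : wordPerm w (k + 1 + c) ≠ x + 1 := fun h => by
        have := (wordPerm w).injective (h.trans e2.symm)
        omega
      rw [hτ, simpleSwap_of_ne g1 g2, hs.col c]
  · have g := hs.lt_iff r c
    unfold addBox
    split_ifs with h1 h2 h2
    · subst h1 h2; omega
    · subst h1; omega
    · subst h2; omega
    · exact g
  · unfold addBox
    rw [if_neg (by omega)]
    exact hs.zero r hr

theorem insertionTableau_cons_grass {k x r₀ c₀ : ℕ} {w : List ℕ} {lam h : ℕ → ℕ}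
    (hs : GrassShape k (wordPerm w) lam h) (hT : insertionTableau w = grassInsertionTableau k lam h)
    (hr : r₀ < k) (hlam : lam r₀ = c₀) (hh : h c₀ = r₀) (hx : x + r₀ = k + c₀) :
    egInsert x (insertionTableau w) =
      (grassInsertionTableau k (addBox lam r₀) (addBox h c₀), (r₀, c₀)) := by
  have := egInsert_grassRows hs.lt_iff hr hlam hh hx r₀ 0 (Nat.zero_add _)
  rw [hT, grassInsertionTableau, grassInsertionTableau, List.range_eq_range',
    List.range_eq_range']
  simpa using this

theorem exists_grassShape {k : ℕ} {w : List ℕ} (hw : PosDistinct w)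
    (hk : OnlyDescent k (wordPerm w)) : ∃ lam h, GrassShape k (wordPerm w) lam h ∧
      insertionTableau w = grassInsertionTableau k lam h := by
  induction w with
  | nil => exact ⟨fun _ => 0, fun _ => 0, ⟨fun r _ => by simp, fun c => by simp, by simp, by simp⟩, rfl⟩
  | cons x w ih =>
    obtain ⟨lam, h, hs, hT⟩ := ih (PosDistinct.append_right (u := [x]) hw) (hk.cons hw).1
    obtain ⟨r₀, c₀, hr₀, hlam, hh, hx, -, -, hs'⟩ := hs.cons hw hk
    refine ⟨_, _, hs', ?_⟩
    rw [insertionTableau, insertionTableau_cons_grass hs hT hr₀ hlam hh hx]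

/-- The shape of the insertion tableau of a Grassmannian word depends on the permutation only. -/
theorem rowLen_congr_of_onlyDescent {k : ℕ} {w v : List ℕ} (hw : PosDistinct w)
    (hv : PosDistinct v) (hk : OnlyDescent k (wordPerm w)) (h : wordPerm w = wordPerm v) (r : ℕ) :
    rowLen (insertionTableau w) r = rowLen (insertionTableau v) r := by
  obtain ⟨lam, hc, hs, hT⟩ := exists_grassShape hw hk
  obtain ⟨lam', hc', hs', hT'⟩ := exists_grassShape hv (h ▸ hk)
  rw [hT, hT', hs.rowLen_eq, hs'.rowLen_eq]
  rcases lt_or_ge r k with hr | hr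
  · have h1 := hs.row r hr
    have h2 := hs'.row r hr
    rw [h] at h1
    omega
  · rw [hs.zero r hr, hs'.zero r hr]

/-- The box added by a letter of a Grassmannian word. -/
theorem rowLen_cons_of_onlyDescent {k x : ℕ} {w : List ℕ} (hw : PosDistinct (x :: w))
    (hk : OnlyDescent k (wordPerm (x :: w))) :
    ∃ r₀, x + r₀ = k + rowLen (insertionTableau w) r₀ ∧
      (∀ r, r + 1 = r₀ → rowLen (insertionTableau w) r₀ < rowLen (insertionTableau w) r) ∧
      ∀ r, rowLen (insertionTableau (x :: w)) r = if r = r₀ then rowLen (insertionTableau w) r + 1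
        else rowLen (insertionTableau w) r := by
  obtain ⟨lam, h, hs, hT⟩ := exists_grassShape (PosDistinct.append_right (u := [x]) hw)
    (hk.cons hw).1
  obtain ⟨r₀, c₀, hr₀, hlam, hh, hx, -, -, hs'⟩ := hs.cons hw hk
  have hlen : ∀ r, rowLen (insertionTableau w) r = lam r := fun r => by rw [hT, hs.rowLen_eq]
  refine ⟨r₀, by rw [hlen]; omega, fun r hr => ?_, fun r => ?_⟩
  · rw [hlen, hlen, hlam, hs.lt_iff]
    omega
  · rw [insertionTableau, insertionTableau_cons_grass hs hT hr₀ hlam hh hx, hs'.rowLen_eq, hlen]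
    rfl

theorem swapLocation_cons (x : ℕ) (w : List ℕ) (a b : ℕ) : swapLocation (x :: w) a b =
    if s(x, x + 1) = s(a, b) then some 0
    else (swapLocation w (simpleSwap x a) (simpleSwap x b)).map (· + 1) := by
  have h0 : swapPair (x :: w) 0 = s(x, x + 1) := rfl
  have h1 : ∀ l, swapPair (x :: w) (l + 1) = s(a, b) ↔
      swapPair w l = s(simpleSwap x a, simpleSwap x b) := by
    intro l
    have e : swapPair (x :: w) (l + 1) = Sym2.map (simpleSwap x) (swapPair w l) := by
      have := swapPair_append_right [x] w l
      rw [List.length_singleton, Nat.add_comm] at this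
      simpa [wordPerm] using this
    have hinv : ∀ y, simpleSwap x (simpleSwap x y) = y := fun y => by simp [simpleSwap]
    rw [e]
    constructor
    · intro h
      have := congrArg (Sym2.map (simpleSwap x)) h
      rw [Sym2.map_map, Sym2.map_mk] at this
      rw [← this]
      have hid : (simpleSwap x : ℕ → ℕ) ∘ simpleSwap x = id := funext hinv
      rw [hid, Sym2.map_id]; rfl
    · intro h
      rw [h, Sym2.map_mk, hinv, hinv]
  rw [swapLocation, List.length_cons, List.range_succ_eq_map, List.find?_cons]
  split_ifs with h
  · simp [h0, h]
  · simp only [h0, h, decide_false]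
    rw [List.find?_map, swapLocation]
    congr 2
    funext l
    simp [h1]

/-- The recording tableau of a Grassmannian word is its tableau of exchanged values. -/
theorem recordingTableau_eq_grassmannianTableau {k : ℕ} {w : List ℕ} (hw : PosDistinct w)
    (hk : OnlyDescent k (wordPerm w)) : recordingTableau w = grassmannianTableau w k := by
  induction w with
  | nil =>
    funext r c
    simp [recordingTableau, grassmannianTableau, swapLocation]
  | cons x w ih =>
    have hw' := PosDistinct.append_right (u := [x]) hw
    have ih := ih hw' (hk.cons hw).1
    obtain ⟨lam, h, hs, hT⟩ := exists_grassShape hw' (hk.cons hw).1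
    obtain ⟨r₀, c₀, hr₀, hlam, hh, hx, hxp, hxq, -⟩ := hs.cons hw hk
    have hσ : ∀ y, simpleSwap x (wordPerm (x :: w) y) = wordPerm w y := by
      intro y; rw [wordPerm_cons, Equiv.Perm.mul_apply]; simp [simpleSwap]
    funext r c
    rw [recordingTableau, insertionTableau_cons_grass hs hT hr₀ hlam hh hx, ih]
    unfold grassmannianTableau
    beta_reduce
    rw [swapLocation_cons, hσ, hσ]
    by_cases hrk : r < k
    · have hiff : s(x, x + 1) = s(wordPerm (x :: w) (k - r), wordPerm (x :: w) (k + 1 + c)) ↔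
          (r, c) = (r₀, c₀) := by
        constructor
        · intro h
          rcases Sym2.eq_iff.1 h with ⟨h1, -⟩ | ⟨h1, h2⟩
          · have := (wordPerm (x :: w)).injective (hxq.trans h1)
            omega
          · have g1 := (wordPerm (x :: w)).injective (hxq.trans h1)
            have g2 := (wordPerm (x :: w)).injective (hxp.trans h2)
            exact Prod.ext (by simp only; omega) (by simp only; omega)
        · intro h
          obtain ⟨rfl, rfl⟩ := Prod.mk.inj h
          rw [hxp, hxq, Sym2.eq_swap]
      rw [if_pos hrk, if_pos hrk]
      simp only [hiff]
      split_ifs with h1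
      · simp
      · rw [Option.map_map]
        congr 1
        funext l
        simp
    · rw [if_neg hrk, if_neg hrk, if_neg]
      intro h1
      have := congrArg Prod.fst h1
      simp only at this
      omega

/-! ### Monotone runs add strips to Grassmannian shapes -/

theorem OnlyDescent.of_append {k : ℕ} {w : List ℕ} : ∀ {v : List ℕ}, PosDistinct (v ++ w) →
    OnlyDescent k (wordPerm (v ++ w)) → OnlyDescent k (wordPerm w)
  | [], _, h => h
  | x :: _, hw, h => OnlyDescent.of_append (PosDistinct.append_right (u := [x]) hw)
      (OnlyDescent.cons (x := x) hw h).1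

theorem rowLen_succ_le {T : List (List ℕ)} (hT : IsIncreasing T) (r : ℕ) :
    rowLen T (r + 1) ≤ rowLen T r := by
  unfold rowLen
  rcases lt_or_ge (r + 1) T.length with h | h
  · rw [List.getD_eq_getElem _ _ h, List.getD_eq_getElem _ _ (by omega)]
    exact (List.pairwise_iff_getElem.1 hT.cols.pairwise r (r + 1) (by omega) h (by omega)).1
  · rw [List.getD_eq_default _ _ h]; simp

/-- A decreasing run of letters adds a horizontal strip.  The second clause carries the induction:
since a letter is `k` plus the content of its box, the boxes already added have contents below that
of the next box. -/
theorem rowLen_of_decreasing {k : ℕ} {w : List ℕ} (D : List ℕ) (hw : PosDistinct (D ++ w))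
    (hk : OnlyDescent k (wordPerm (D ++ w))) (hD : D.Pairwise (· > ·)) :
    (∀ r, rowLen (insertionTableau (D ++ w)) (r + 1) ≤ rowLen (insertionTableau w) r) ∧
      ∀ x, (∀ y ∈ D, y < x) → ∀ r,
        rowLen (insertionTableau w) r < rowLen (insertionTableau (D ++ w)) r →
        k + rowLen (insertionTableau (D ++ w)) r ≤ x + r := by
  induction D with
  | nil =>
    exact ⟨rowLen_succ_le (insertionTableau_spec hw).1, fun x _ r h => absurd h (lt_irrefl _)⟩
  | cons x D ih =>
    have hw' : PosDistinct (D ++ w) := PosDistinct.append_right (u := [x]) hw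
    have hD' := List.pairwise_cons.1 hD
    obtain ⟨h1, h2⟩ := ih hw' (OnlyDescent.cons (x := x) hw hk).1 hD'.2
    obtain ⟨r₀, e1, e2, e3⟩ := rowLen_cons_of_onlyDescent (x := x) (w := D ++ w) hw hk
    have h3 := h2 x hD'.1
    have hle := rowLen_le_append D w
    rw [List.cons_append]
    refine ⟨fun r => ?_, fun z hz r => ?_⟩
    · rw [e3]
      split_ifs with h
      · have := e2 r h
        have := h3 r
        have := hle r
        rw [h]
        omega
      · exact h1 r
    · have hzx := hz x (by simp)
      rw [e3]
      split_ifs with h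
      · subst h; omega
      · have := h3 r
        omega

/-- An increasing run of letters adds a vertical strip.  As for decreasing runs, the second clause
bounds the contents of the boxes already added. -/
theorem rowLen_of_increasing {k : ℕ} {w : List ℕ} (C : List ℕ) (hw : PosDistinct (C ++ w))
    (hk : OnlyDescent k (wordPerm (C ++ w))) (hC : C.Pairwise (· < ·)) :
    (∀ r, rowLen (insertionTableau (C ++ w)) r ≤ rowLen (insertionTableau w) r + 1) ∧
      ∀ x, (∀ y ∈ C, x < y) → ∀ r,
        rowLen (insertionTableau w) r < rowLen (insertionTableau (C ++ w)) r →
        x + r + 2 ≤ k + rowLen (insertionTableau (C ++ w)) r := by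
  induction C with
  | nil => exact ⟨fun r => Nat.le_succ _, fun x _ r h => absurd h (lt_irrefl _)⟩
  | cons x C ih =>
    have hw' : PosDistinct (C ++ w) := PosDistinct.append_right (u := [x]) hw
    have hC' := List.pairwise_cons.1 hC
    obtain ⟨h1, h2⟩ := ih hw' (OnlyDescent.cons (x := x) hw hk).1 hC'.2
    obtain ⟨r₀, e1, e2, e3⟩ := rowLen_cons_of_onlyDescent (x := x) (w := C ++ w) hw hk
    have h3 := h2 x hC'.1
    have hle := rowLen_le_append C w
    rw [List.cons_append]
    refine ⟨fun r => ?_, fun z hz r => ?_⟩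
    · rw [e3]
      split_ifs with h
      · subst h
        have := h3 r
        have := hle r
        omega
      · exact h1 r
    · have hzx := hz x (by simp)
      rw [e3]
      split_ifs with h
      · subst h; omega
      · have := h3 r
        omega

/-! ### Words with prescribed runs -/

theorem SameDescents.append {a b v : List ℕ} (h : SameDescents (a ++ b) v) :
    SameDescents a (v.take a.length) ∧ SameDescents b (v.drop a.length) := by
  have hlen := h.1
  rw [List.length_append] at hlen
  refine ⟨⟨by simp; omega, fun l hl => ?_⟩, ⟨by simp; omega, fun l hl => ?_⟩⟩
  · have := h.2 l (by simp; omega)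
    rw [List.getD_append _ _ _ _ (by omega), List.getD_append _ _ _ _ hl] at this
    have e : ∀ i < a.length, (v.take a.length).getD i 0 = v.getD i 0 := fun i hi => by
      simp [List.getD_eq_getElem?_getD, hi]
    rw [e l (by omega), e _ hl]
    exact this
  · have := h.2 (a.length + l) (by simp; omega)
    rw [Nat.add_assoc, List.getD_append_right _ _ _ _ (by omega),
      List.getD_append_right _ _ _ _ (by omega), Nat.add_sub_cancel_left,
      Nat.add_sub_cancel_left] at this
    simpa [List.getD_eq_getElem?_getD, List.getElem?_drop] using this

theorem SameDescents.decreasing {a v : List ℕ} (h : SameDescents a v)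
    (ha : a.Pairwise (· > ·)) : v.Pairwise (· > ·) := by
  rw [← List.isChain_iff_pairwise, List.isChain_iff_getElem] at ha ⊢
  intro i hi
  have h1 := ha i (by rw [h.1]; exact hi)
  have h2 := (h.2 i (by rw [h.1]; exact hi)).2
  rw [List.getD_eq_getElem _ _ (by rw [h.1]; exact hi),
    List.getD_eq_getElem _ _ (by rw [h.1]; omega), List.getD_eq_getElem _ _ hi,
    List.getD_eq_getElem _ _ (by omega)] at h2
  exact h2.1 h1

theorem SameDescents.increasing {a v : List ℕ} (h : SameDescents a v)
    (ha : a.Pairwise (· < ·)) : v.Pairwise (· < ·) := by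
  rw [← List.isChain_iff_pairwise, List.isChain_iff_getElem] at ha ⊢
  intro i hi
  have h1 := ha i (by rw [h.1]; exact hi)
  have h2 := (h.2 i (by rw [h.1]; exact hi)).1
  rw [List.getD_eq_getElem _ _ (by rw [h.1]; omega),
    List.getD_eq_getElem _ _ (by rw [h.1]; exact hi), List.getD_eq_getElem _ _ (by omega),
    List.getD_eq_getElem _ _ hi] at h2
  exact h2.1 h1

theorem sum_map_length (f : ℕ → ℕ) (hf : f 0 = 0) (T : List (List ℕ)) : ∀ L, T.length ≤ L →
    (T.map fun R => f R.length).sum = ∑ r ∈ Finset.range L, f (rowLen T r) := by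
  induction T with
  | nil => intro L _; simp [hf]
  | cons R T ih =>
    intro L hL
    obtain ⟨L, rfl⟩ : ∃ M, L = M + 1 := ⟨L - 1, by simp at hL; omega⟩
    rw [Finset.sum_range_succ', List.map_cons, List.sum_cons, ih L (by simpa using hL)]
    simp [Nat.add_comm]

theorem rowWord_length (T : List (List ℕ)) {L : ℕ} (hL : T.length ≤ L) :
    (rowWord T).length = ∑ r ∈ Finset.range L, rowLen T r := by
  rw [← sum_map_length (fun x => x) rfl T L hL, rowWord, List.length_flatten, List.map_map]
  congr 1
  exact List.map_congr_left fun R _ => by simp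

theorem length_eq_sum_rowLen {w : List ℕ} (hw : PosDistinct w) {L : ℕ} (hL : w.length ≤ L) :
    w.length = ∑ r ∈ Finset.range L, rowLen (insertionTableau w) r := by
  rw [← rowWord_length _ ((insertionTableau_length_le w).trans hL)]
  exact (insertionTableau_spec hw).2.length_eq

/-- If the reading word of `T` has the same descents as a Grassmannian word, then the lower rows of
`T` hold at least as many boxes as those of the shape of the Grassmannian word. -/
theorem sum_rowLen_le_of_rowWord {k : ℕ} (n : ℕ) : ∀ (T : List (List ℕ)) (v : List ℕ),
    (∀ R ∈ T, R.Pairwise (· < ·)) → PosDistinct v → OnlyDescent k (wordPerm v) →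
    SameDescents (rowWord T) v → ∀ L, T.length ≤ L → v.length ≤ L →
    ∑ i ∈ Finset.range L, rowLen (insertionTableau v) (n + i) ≤
      ∑ i ∈ Finset.range L, rowLen T (n + i) := by
  induction n with
  | zero =>
    intro T v _ hv _ hd L hT hL
    simp only [Nat.zero_add]
    rw [← rowWord_length T hT, ← length_eq_sum_rowLen hv hL, hd.1]
  | succ n ih =>
    intro T v hT hv hk hd L hTL hL
    cases T with
    | nil =>
      have : v = [] := List.length_eq_zero_iff.1 hd.1.symm
      subst this
      simp [insertionTableau]
    | cons R T =>
      rw [rowWord_cons] at hd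
      obtain ⟨h1, h2⟩ := hd.append
      set a := v.take R.reverse.length
      set b := v.drop R.reverse.length
      have hv' : v = a ++ b := (List.take_append_drop _ _).symm
      have hbL : b.length ≤ v.length := by rw [hv']; simp
      have ha : a.Pairwise (· > ·) := h1.decreasing (List.pairwise_reverse.2 (hT R (by simp)))
      clear_value a b
      subst hv'
      have h3 := (rowLen_of_decreasing a hv hk ha).1
      have h4 := ih T b (fun S hS => hT S (by simp [hS])) hv.append_right
        (OnlyDescent.of_append hv hk) h2 L (by simp at hTL; omega) (by omega)
      refine (Finset.sum_le_sum fun i _ => ?_).trans (h4.trans (le_of_eq ?_))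
      · rw [show n + 1 + i = n + i + 1 by omega]
        exact h3 _
      · refine Finset.sum_congr rfl fun i _ => ?_
        rw [show n + 1 + i = n + i + 1 by omega, rowLen_cons_succ]

/-- A Grassmannian word that consists of as many increasing runs as there are lists in `Cs` has at
most that many columns, since each run adds a vertical strip. -/
theorem rowLen_le_of_columns {k : ℕ} : ∀ (Cs : List (List ℕ)) (v : List ℕ),
    (∀ C ∈ Cs, C.Pairwise (· < ·)) → PosDistinct v → OnlyDescent k (wordPerm v) →
    SameDescents Cs.flatten v → ∀ r, rowLen (insertionTableau v) r ≤ Cs.length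
  | [], v, _, _, _, hd, r => by
    have : v = [] := List.length_eq_zero_iff.1 hd.1.symm
    subst this
    simp [insertionTableau]
  | C :: Cs, v, hC, hv, hk, hd, r => by
    rw [List.flatten_cons] at hd
    obtain ⟨h1, h2⟩ := hd.append
    set a := v.take C.length
    set b := v.drop C.length
    have hv' : v = a ++ b := (List.take_append_drop _ _).symm
    have ha : a.Pairwise (· < ·) := h1.increasing (hC C (by simp))
    clear_value a b
    subst hv'
    have h3 := (rowLen_of_increasing a hv hk ha).1 r
    have h4 := rowLen_le_of_columns Cs b (fun S hS => hC S (by simp [hS])) hv.append_right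
      (OnlyDescent.of_append hv hk) h2 r
    simp only [List.length_cons]
    omega

theorem columns_length (n : ℕ) : ∀ T : List (List ℕ), (columns n T).length = n := by
  induction n with
  | zero => simp [columns]
  | succ n ih => intro T; simp [columns, ih]

theorem heads_length (T : List (List ℕ)) :
    (heads T).length = (T.map fun R => min 1 R.length).sum := by
  induction T with
  | nil => rfl
  | cons R T ih =>
    rw [List.map_cons, List.sum_cons, ← ih]
    cases R with
    | nil => exact (Nat.zero_add _).symm
    | cons x R => simp [heads]; omega

theorem columns_flatten_length (n : ℕ) : ∀ T : List (List ℕ),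
    (columns n T).flatten.length = (T.map fun R => min n R.length).sum := by
  induction n with
  | zero => intro T; simp [columns]
  | succ n ih =>
    intro T
    have h1 : (columns (n + 1) T).flatten.length =
        (columns n (tails T)).flatten.length + (heads T).length := by simp [columns]
    rw [h1, ih, heads_length, tails, List.map_map, ← List.sum_map_add]
    congr 1
    refine List.map_congr_left fun R _ => ?_
    simp only [Function.comp, List.length_tail]
    omega

/-- If a word ending with the first `n` columns of `T` has the same descents as a Grassmannian word,
then these columns hold at most as many boxes as those of the shape of the Grassmannian word. -/
theorem sum_min_rowLen_le_of_columns {k n : ℕ} {T : List (List ℕ)} {u v : List ℕ}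
    (hT : IsIncreasing T) (hv : PosDistinct v) (hk : OnlyDescent k (wordPerm v))
    (hd : SameDescents (u ++ (columns n T).flatten) v) {L : ℕ} (hTL : T.length ≤ L)
    (hL : v.length ≤ L) : ∑ r ∈ Finset.range L, min n (rowLen T r) ≤
      ∑ r ∈ Finset.range L, min n (rowLen (insertionTableau v) r) := by
  obtain ⟨-, h2⟩ := hd.append
  set a := v.take u.length
  set b := v.drop u.length
  have hv' : v = a ++ b := (List.take_append_drop _ _).symm
  have hbL : b.length ≤ v.length := by rw [hv']; simp
  clear_value a b
  subst hv'
  rw [← sum_map_length (fun x => min n x) (by simp) T L hTL, ← columns_flatten_length, h2.1,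
    length_eq_sum_rowLen hv.append_right (hbL.trans hL)]
  refine Finset.sum_le_sum fun r _ => le_min ?_ (rowLen_le_append a b r)
  have := rowLen_le_of_columns (columns n T) b (hT.columns_pairwise n T) hv.append_right
    (OnlyDescent.of_append hv hk) h2 r
  rwa [columns_length] at this

/-! ### Comparison of shapes -/

/-- Two partitions of the same number are equal if one dominates the other with respect to both
rows and columns. -/
theorem eq_of_dominance {lam mu : ℕ → ℕ} {L : ℕ} (hanti : ∀ r, lam (r + 1) ≤ lam r)
    (hlam : ∀ r, L ≤ r → lam r = 0) (hmu : ∀ r, L ≤ r → mu r = 0)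
    (hsum : ∑ r ∈ Finset.range L, lam r = ∑ r ∈ Finset.range L, mu r)
    (hrows : ∀ n, ∑ i ∈ Finset.range L, mu (n + i) ≤ ∑ i ∈ Finset.range L, lam (n + i))
    (hcols : ∀ n, ∑ r ∈ Finset.range L, min n (lam r) ≤ ∑ r ∈ Finset.range L, min n (mu r)) :
    lam = mu := by
  by_contra hne
  obtain ⟨r, hr⟩ := Function.ne_iff.1 hne
  have hex : ∃ r, lam r ≠ mu r := ⟨r, hr⟩
  classical
  obtain ⟨i, hi1, hi2⟩ : ∃ i, lam i ≠ mu i ∧ ∀ r < i, lam r = mu r :=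
    ⟨Nat.find hex, Nat.find_spec hex, fun r hr => not_not.1 (Nat.find_min hex hr)⟩
  -- at the first difference `i`, the rows give `mu i > lam i`, the first `lam i` columns exclude it
  have hiL : i < L := by
    by_contra h
    exact hi1 (by rw [hlam i (by omega), hmu i (by omega)])
  have hle : ∀ r, i ≤ r → lam r ≤ lam i := fun r hr =>
    (antitone_nat_of_succ_le hanti) hr
  have htail : ∀ (f : ℕ → ℕ), (∀ r, L ≤ r → f r = 0) → ∀ n ≤ L,
      ∑ j ∈ Finset.range L, f (n + j) = ∑ r ∈ Finset.Ico n L, f r := by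
    intro f hf n hn
    rw [Finset.sum_Ico_eq_sum_range]
    refine (Finset.sum_subset (Finset.range_mono (Nat.sub_le L n)) fun x _ hx => ?_).symm
    exact hf _ (by simp at hx; omega)
  have hsplit : ∀ f : ℕ → ℕ, ∑ r ∈ Finset.range L, f r =
      ∑ r ∈ Finset.range i, f r + (f i + ∑ r ∈ Finset.Ico (i + 1) L, f r) := by
    intro f
    rw [← Finset.sum_range_add_sum_Ico f hiL.le, Finset.sum_eq_sum_Ico_succ_bot hiL]
  have h1 := hrows (i + 1)
  rw [htail mu hmu (i + 1) hiL, htail lam hlam (i + 1) hiL] at h1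
  have h2 := hcols (lam i)
  rw [hsplit, hsplit, min_self] at h2
  rw [hsplit, hsplit mu] at hsum
  have h3 : ∑ r ∈ Finset.range i, lam r = ∑ r ∈ Finset.range i, mu r :=
    Finset.sum_congr rfl fun r hr => hi2 r (Finset.mem_range.1 hr)
  have h4 : ∑ r ∈ Finset.range i, min (lam i) (lam r) =
      ∑ r ∈ Finset.range i, min (lam i) (mu r) :=
    Finset.sum_congr rfl fun r hr => by rw [hi2 r (Finset.mem_range.1 hr)]
  have h5 : ∑ r ∈ Finset.Ico (i + 1) L, min (lam i) (lam r) =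
      ∑ r ∈ Finset.Ico (i + 1) L, lam r :=
    Finset.sum_congr rfl fun r hr => min_eq_right (hle r (by
      have := (Finset.mem_Ico.1 hr).1
      omega))
  have h6 : ∑ r ∈ Finset.Ico (i + 1) L, min (lam i) (mu r) ≤
      ∑ r ∈ Finset.Ico (i + 1) L, mu r :=
    Finset.sum_le_sum fun r _ => min_le_right _ _
  rw [h4, h5] at h2
  omega

theorem rowLen_eq_zero {T : List (List ℕ)} {r : ℕ} (h : T.length ≤ r) : rowLen T r = 0 := by
  unfold rowLen
  rw [List.getD_eq_default _ _ h]; rfl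

/-- Replacing a suffix of `w` by a Coxeter–Knuth equivalent word `c`, the Little map leads to a
Grassmannian word whose suffix has the descents of `c` and the shape found without replacement. -/
theorem exists_suffix {k : ℕ} {v w g : List ℕ} (hw : PosDistinct (v ++ w))
    (hc : Relation.ReflTransGen LittleNext (v ++ w) g) (hk : OnlyDescent k (wordPerm g))
    {c : List ℕ} (hwc : KnuthEquiv 0 w c) :
    ∃ h, SameDescents c h ∧ PosDistinct h ∧ OnlyDescent k (wordPerm h) ∧
      ∀ r, rowLen (insertionTableau (g.drop v.length)) r = rowLen (insertionTableau h) r := by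
  have e1 := hwc.append_left v
  rw [Nat.add_zero] at e1
  obtain ⟨g', hg', hgg'⟩ := e1.littleChain hw hc
  have hpg := (littleChain_sameDescents hw hc).1
  have hpg' := littleChain_sameDescents (e1.posDistinct_iff.1 hw) hg'
  have htake := hgg'.take_eq
  have hperm := hgg'.wordPerm_eq
  have hgd := (List.take_append_drop v.length g).symm
  have hgd' := (List.take_append_drop v.length g').symm
  rw [← htake] at hgd'
  have hd := hpg'.2.append.2
  generalize g.take v.length = a at *
  generalize g.drop v.length = b at *
  generalize g'.drop v.length = b' at *
  subst hgd hgd'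
  have hperm' : wordPerm b = wordPerm b' := by
    rw [wordPerm_append, wordPerm_append] at hperm
    exact mul_left_cancel hperm
  have hb := OnlyDescent.of_append hpg hk
  exact ⟨b', hd, hpg'.1.append_right, hperm' ▸ hb,
    rowLen_congr_of_onlyDescent hpg.append_right hpg'.1.append_right hb hperm'⟩

/-- The Little map preserves the shapes of the insertion tableaux of all suffixes. -/
theorem rowLen_eq_of_littleChain {k : ℕ} {v w g : List ℕ} (hw : PosDistinct (v ++ w))
    (hc : Relation.ReflTransGen LittleNext (v ++ w) g) (hk : OnlyDescent k (wordPerm g)) (r : ℕ) :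
    rowLen (insertionTableau w) r = rowLen (insertionTableau (g.drop v.length)) r := by
  have hw2 := hw.append_right
  obtain ⟨hT, hTw⟩ := insertionTableau_spec hw2
  have hTL := insertionTableau_length_le w
  set T := insertionTableau w
  set mu := rowLen (insertionTableau (g.drop v.length)) with hmu
  obtain ⟨h, hd, hh, hhk, hr⟩ := exists_suffix hw hc hk hTw
  have hhL : h.length = w.length := by rw [← hd.1, hTw.length_eq]
  have hmuh : mu = rowLen (insertionTableau h) := funext hr
  refine congrFun (eq_of_dominance (lam := rowLen T) (L := w.length) (rowLen_succ_le hT)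
    (fun r hr => rowLen_eq_zero (hTL.trans hr)) (fun r hr => ?_) ?_ (fun n => ?_)
    (fun n => ?_)) r
  · rw [hmuh]
    exact rowLen_eq_zero ((insertionTableau_length_le h).trans (hhL ▸ hr))
  · rw [hmuh, ← length_eq_sum_rowLen hh hhL.le, hhL, ← length_eq_sum_rowLen hw2 le_rfl]
  · rw [hmuh]
    exact sum_rowLen_le_of_rowWord n T h hT.rows hh hhk hd _ hTL hhL.le
  · -- the same chain of bumps, started from a word that ends with the first `n` columns of `T`
    obtain ⟨u, hu⟩ := exists_knuthEquiv_columns n T hT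
    obtain ⟨h', hd', hh', hhk', hr'⟩ := exists_suffix hw hc hk (hTw.trans hu)
    have hmuh' : mu = rowLen (insertionTableau h') := funext hr'
    rw [hmuh']
    refine sum_min_rowLen_le_of_columns hT hh' hhk' hd' hTL ?_
    rw [← hd'.1, ← hu.length_eq, ← hTw.length_eq]

end LittleEG

theorem theorem1 (w : List ℕ) (hw : LittleEG.IsReduced w) :
    LittleEG.littleMap w = Part.some (LittleEG.recordingTableau w) := by
  open LittleEG in
  have hpd : PosDistinct w := ⟨hw.1, (isReduced_iff hw.1).1 hw⟩
  rcases eq_or_ne w [] with rfl | hne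
  · refine Part.eq_some_iff.2 (PFun.fix_stop ?_)
    rw [littleStep, if_pos rfl]
    exact Part.mem_some _
  obtain ⟨g, hc, hg⟩ := exists_littleChain hpd hne
  obtain ⟨hpg, hd⟩ := littleChain_sameDescents hpd hc
  have hk : OnlyDescent hg.exists.choose (wordPerm g) := fun d hd =>
    hg.unique hd hg.exists.choose_spec
  -- every suffix has the same insertion shape as the corresponding suffix of `g`
  have hrec : recordingTableau w = recordingTableau g := by
    refine recordingTableau_congr w g hd.1 fun n r => ?_
    rcases le_or_gt n w.length with hn | hn
    · have hlen : (w.take n).length = n := by simp [hn]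
      have h := rowLen_eq_of_littleChain (v := w.take n) (w := w.drop n)
        (by rwa [List.take_append_drop]) (by rwa [List.take_append_drop]) hk r
      rwa [hlen] at h
    · rw [List.drop_eq_nil_of_le hn.le, List.drop_eq_nil_of_le (by rw [← hd.1]; exact hn.le)]
  rw [hrec, littleChain_littleMap hpd hc, recordingTableau_eq_grassmannianTableau hpg hk]
  refine Part.eq_some_iff.2 (PFun.fix_stop ?_)
  have hgne : g ≠ [] := ne_nil_of_length_eq hd.1 hne
  rw [littleStep, if_neg hgne, dif_pos hg]
  exact Part.mem_some _
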